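/- **Theorem (curves in symplectic space).** Let $n\ge 1$ and let $V=\mathbb R^{2n}$ have coordinates $(t,\mathbf x,y,\mathbf z)$, $\mathbf x,\mathbf z\in\mathbb R^{n-1}$, and symplectic form $\omega=dt\wedge dy+\sum_i dx_i\wedge dz_i$. Let $G=\mathrm{Sp}(2n,\mathbb R)$ act linearly on $V$, and hence, by prolongation, on jets of unparametrized curves in $V$. In the chart of curves $t\mapsto c(t)=(t,\mathbf x(t),y(t),\mathbf z(t))$ the jet coordinates are $t,\mathbf x_k,y_k,\mathbf z_k$ $(k\ge 0)$, where the subscript $k$ denotes the $k$-th $t$-derivative; $J^k$ is the space of $k$-jets and $D_t$ is the total derivative. A differential invariant is a rational function on some $J^k$ that is constant on the orbits of the prolonged action (where it is defined). Put $$\nabla=\frac{1}{t y_1-y+\mathbf x\cdot\mathbf z_1-\mathbf x_1\cdot\mathbf z}\,D_t .$$ Let $w_k=d^kc/dt^k$, so $w_0=(t,\mathbf x,y,\mathbf z)$. For a change of parameter $\tau$, let $\kappa_k=d^k\tau/dt^k$ $(k\ge1)$ and $v_k=d^kc/d\tau^k$ $(k\ge0)$; these are related to the $w_k$ by the chain rules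 of all orders (Faà di Bruno's formula). Normalize the jet of $\tau$ at each point by $\omega(v_0,v_1)=1$ and $\omega(v_0,v_k)=0$ for $k\ge2$, and set $I_k=\omega(v_{k-1},v_k)$ for $2\le k\le 2n$. Then: 1. The normalization determines all $\kappa_k$ and $v_k$ uniquely as rational functions of the jet coordinates. 2. For $2\le k\le 2n$, $I_k$ is a differential invariant of order exactly $k$. 3. $\nabla$ is an invariant derivation: it commutes with the (pulled back) prolonged action of every $g\in G$. 4. The functions $\nabla^j I_k$ $(j\ge 0,\ 2\le k\le 2n)$ are algebraically independent over $\mathbb R$. 5. For every $m\ge 0$, the differential invariants on $J^m$ are exactly the rational functions (with real coefficients) of the $\nabla^j I_k$ with $2\le k\le 2n$, $j+k\le m$. 6. For every $l\ge 2n-1$, the differential invariants that are rational in the jets of order $\le l$ and polynomial in the jet coordinates of order $>l$ are exactly the polynomials in the $\nabla^jI_k$ $(j\ge0,\ 2\le k\le 2n)$ whose coefficients are rational functions of those $\nabla^jI_k$ with $j+k\le l$. In this sense the algebra of differential invariants is freely generated: $\mathcal A=\langle I_2,\dots,I_{2n};\nabla\rangle$. -/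

import Mathlib

open Topology Filter
open scoped Matrix ContDiff Nat

noncomputable section

namespace SymplecticCurves

/-- Indices of the canonical coordinates of `ℝ²ⁿ`: `inl i` is the `i`-th position coordinate,
`inr i` is its conjugate momentum coordinate.  The coordinate `inl 0` is `t`, the coordinate
`inr 0` is `y`, and for `i ≠ 0` the coordinates `inl i`, `inr i` are the components of `x`, `z`. -/
abbrev Ix (n : ℕ) := Fin n ⊕ Fin n

/-- The coordinates on the infinite jet space of curves `t ↦ (t, x(t), y(t), z(t))`: the
independent variable `t`, and the `k`-th derivative of each dependent coordinate. -/
inductive JetCoord (n : ℕ) [NeZero n]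
  | t : JetCoord n
  | u (i : {i : Ix n // i ≠ Sum.inl 0}) (k : ℕ) : JetCoord n

/-- The order of a jet coordinate. -/
def JetCoord.order {n : ℕ} [NeZero n] : JetCoord n → ℕ
  | .t => 0
  | .u _ k => k

/-- Polynomials in the jet coordinates (each involves finitely many of them). -/
abbrev JetPoly (n : ℕ) [NeZero n] := MvPolynomial (JetCoord n) ℝ

/-- Rational functions on the infinite jet space. -/
abbrev JetField (n : ℕ) [NeZero n] := FractionRing (JetPoly n)

variable (n : ℕ) [NeZero n]

/-- A jet coordinate, as a rational function. -/
def coord (a : JetCoord n) : JetField n := algebraMap (JetPoly n) (JetField n) (MvPolynomial.X a)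

/-- The field of rational functions on the space of `k`-jets. -/
def ratJet (k : ℕ) : IntermediateField ℝ (JetField n) :=
  IntermediateField.adjoin ℝ (coord n '' {a | a.order ≤ k})

/-- Functions that are rational in the jets of order `≤ l` and polynomial in the jet coordinates
of order `> l`. -/
def polyAbove (l : ℕ) : Subalgebra (ratJet n l) (JetField n) :=
  Algebra.adjoin (ratJet n l) (Set.range (coord n))

/-- `F` is a function on the space of `k`-jets, and not on a space of jets of lower order. -/
def HasOrder (F : JetField n) (k : ℕ) : Prop :=
  F ∈ ratJet n k ∧ ∀ l < k, F ∉ ratJet n l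

/-! ### The total derivative -/

/-- The total derivative on polynomials: `D t = 1`, `D u_k = u_{k+1}`. -/
def totalDPoly : Derivation ℝ (JetPoly n) (JetPoly n) :=
  MvPolynomial.mkDerivation ℝ fun
    | .t => 1
    | .u i k => MvPolynomial.X (.u i (k + 1))

/-- The total derivative of a rational function, by the quotient rule. -/
def totalDFun (F : JetField n) : JetField n :=
  (algebraMap _ _ (totalDPoly n (IsFractionRing.num (JetPoly n) F)) *
      algebraMap _ _ (IsFractionRing.den (JetPoly n) F : JetPoly n) -
    algebraMap _ _ (IsFractionRing.num (JetPoly n) F) *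
      algebraMap _ _ (totalDPoly n (IsFractionRing.den (JetPoly n) F : JetPoly n))) /
    (algebraMap _ _ (IsFractionRing.den (JetPoly n) F : JetPoly n)) ^ 2

theorem totalDFun_div (p q : JetPoly n) (hq : q ≠ 0) :
    totalDFun n (algebraMap _ _ p / algebraMap _ _ q) =
      (algebraMap _ _ (totalDPoly n p) * algebraMap _ _ q -
        algebraMap _ _ p * algebraMap _ _ (totalDPoly n q)) / (algebraMap _ _ q) ^ 2 := by
  set F : JetField n := algebraMap _ _ p / algebraMap _ _ q with hF
  have hinj := IsFractionRing.injective (JetPoly n) (JetField n)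
  have hq' : algebraMap (JetPoly n) (JetField n) q ≠ 0 := by
    simpa using hq
  set a := IsFractionRing.num (JetPoly n) F with ha
  set b : JetPoly n := (IsFractionRing.den (JetPoly n) F : JetPoly n) with hb
  have hb0 : b ≠ 0 := nonZeroDivisors.coe_ne_zero _
  have hb' : algebraMap (JetPoly n) (JetField n) b ≠ 0 := by simpa using hb0
  have hab : algebraMap (JetPoly n) (JetField n) a / algebraMap _ _ b = F := by
    rw [← IsFractionRing.mk'_num_den (JetPoly n) F, IsFractionRing.mk'_eq_div]
  have hc : a * q = p * b := by
    apply hinj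
    rw [hF, div_eq_div_iff hb' hq'] at hab
    simpa using hab
  have hd := congrArg (totalDPoly n) hc
  simp only [Derivation.leibniz, smul_eq_mul] at hd
  have key : (totalDPoly n a * b - a * totalDPoly n b) * q ^ 2 =
      (totalDPoly n p * q - p * totalDPoly n q) * b ^ 2 := by
    linear_combination (b * q) * hd -
      (b * totalDPoly n q + q * totalDPoly n b) * hc
  have key' := congrArg (algebraMap (JetPoly n) (JetField n)) key
  simp only [map_mul, map_sub, map_pow] at key'
  unfold totalDFun
  rw [div_eq_div_iff (pow_ne_zero 2 hb') (pow_ne_zero 2 hq')]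
  exact key'

theorem totalDFun_add (F G : JetField n) :
    totalDFun n (F + G) = totalDFun n F + totalDFun n G := by
  obtain ⟨p, q, hq, rfl⟩ := IsFractionRing.div_surjective (A := JetPoly n) F
  obtain ⟨r, s, hs, rfl⟩ := IsFractionRing.div_surjective (A := JetPoly n) G
  have hq0 := nonZeroDivisors.ne_zero hq
  have hs0 := nonZeroDivisors.ne_zero hs
  have hq' : algebraMap (JetPoly n) (JetField n) q ≠ 0 := by simpa using hq0
  have hs' : algebraMap (JetPoly n) (JetField n) s ≠ 0 := by simpa using hs0
  have h : algebraMap (JetPoly n) (JetField n) p / algebraMap _ _ q +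
      algebraMap _ _ r / algebraMap _ _ s =
      algebraMap _ _ (p * s + q * r) / algebraMap _ _ (q * s) := by
    rw [div_add_div _ _ hq' hs']; simp only [map_add, map_mul]
  rw [h, totalDFun_div n _ _ hq0, totalDFun_div n _ _ hs0,
    totalDFun_div n _ _ (mul_ne_zero hq0 hs0)]
  simp only [map_add, Derivation.leibniz, smul_eq_mul, map_mul]
  generalize algebraMap (JetPoly n) (JetField n) (totalDPoly n p) = p'
  generalize algebraMap (JetPoly n) (JetField n) (totalDPoly n q) = q'
  generalize algebraMap (JetPoly n) (JetField n) (totalDPoly n r) = r'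
  generalize algebraMap (JetPoly n) (JetField n) (totalDPoly n s) = s'
  generalize algebraMap (JetPoly n) (JetField n) q = q₀ at *
  generalize algebraMap (JetPoly n) (JetField n) s = s₀ at *
  field_simp
  ring

theorem totalDFun_mul (F G : JetField n) :
    totalDFun n (F * G) = F * totalDFun n G + G * totalDFun n F := by
  obtain ⟨p, q, hq, rfl⟩ := IsFractionRing.div_surjective (A := JetPoly n) F
  obtain ⟨r, s, hs, rfl⟩ := IsFractionRing.div_surjective (A := JetPoly n) G
  have hq0 := nonZeroDivisors.ne_zero hq
  have hs0 := nonZeroDivisors.ne_zero hs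
  have hq' : algebraMap (JetPoly n) (JetField n) q ≠ 0 := by simpa using hq0
  have hs' : algebraMap (JetPoly n) (JetField n) s ≠ 0 := by simpa using hs0
  have h : algebraMap (JetPoly n) (JetField n) p / algebraMap _ _ q *
      (algebraMap _ _ r / algebraMap _ _ s) =
      algebraMap _ _ (p * r) / algebraMap _ _ (q * s) := by
    rw [div_mul_div_comm]; simp only [map_mul]
  rw [h, totalDFun_div n _ _ hq0, totalDFun_div n _ _ hs0,
    totalDFun_div n _ _ (mul_ne_zero hq0 hs0)]
  simp only [map_add, Derivation.leibniz, smul_eq_mul, map_mul]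
  generalize algebraMap (JetPoly n) (JetField n) (totalDPoly n p) = p'
  generalize algebraMap (JetPoly n) (JetField n) (totalDPoly n q) = q'
  generalize algebraMap (JetPoly n) (JetField n) (totalDPoly n r) = r'
  generalize algebraMap (JetPoly n) (JetField n) (totalDPoly n s) = s'
  generalize algebraMap (JetPoly n) (JetField n) q = q₀ at *
  generalize algebraMap (JetPoly n) (JetField n) s = s₀ at *
  field_simp
  ring

theorem totalDFun_const (r : ℝ) : totalDFun n (algebraMap ℝ (JetField n) r) = 0 := by
  have h := totalDFun_div n (algebraMap ℝ (JetPoly n) r) 1 one_ne_zero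
  rw [map_one, div_one, ← IsScalarTower.algebraMap_apply, Derivation.map_algebraMap,
    Derivation.map_one_eq_zero] at h
  simpa using h

/-- The total derivative `D_t`, a derivation of the field of rational functions on jets. -/
def totalD : Derivation ℝ (JetField n) (JetField n) :=
  Derivation.mk'
    { toFun := totalDFun n
      map_add' := totalDFun_add n
      map_smul' := fun r F => by
        rw [Algebra.smul_def, totalDFun_mul, totalDFun_const, mul_zero, add_zero,
          RingHom.id_apply, Algebra.smul_def] }
    (totalDFun_mul n)

/-! ### The action of the symplectic group on jets of curves -/

/-- The jet at `t` of the curve `c`, written as a graph over its first coordinate. -/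
def jet (c : ℝ → Ix n → ℝ) (t : ℝ) : JetCoord n → ℝ
  | .t => t
  | .u i k => iteratedDeriv k (fun s => c s i) t

/-- Near `t`, the curve `c` is smooth and is a graph over the first coordinate. -/
def IsGraphAt (c : ℝ → Ix n → ℝ) (t : ℝ) : Prop :=
  ∀ᶠ s in 𝓝 t, ContDiffAt ℝ ∞ c s ∧ c s (Sum.inl 0) = s

/-- The linear map `g` sends the germ at `c t` of the (unparametrized) curve `c` to the germ at
`c' t'` of the curve `c'`, both germs being graphs over the first coordinate.  Hence the prolonged
action of `g` sends the jet of `c` at `t` to the jet of `c'` at `t'`. -/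
structure MapsGerm (g : Matrix (Ix n) (Ix n) ℝ) (c : ℝ → Ix n → ℝ) (t : ℝ)
    (c' : ℝ → Ix n → ℝ) (t' : ℝ) : Prop where
  graph : IsGraphAt n c t
  graph' : IsGraphAt n c' t'
  base : (g *ᵥ c t) (Sum.inl 0) = t'
  immersed : deriv (fun s => (g *ᵥ c s) (Sum.inl 0)) t ≠ 0
  maps : ∀ᶠ s in 𝓝 t, g *ᵥ c s = c' ((g *ᵥ c s) (Sum.inl 0))

/-- `H` is the pullback of `F` under the prolonged action of `g`: the value of `H` at a jet is the
value of `F` at the image of the jet, wherever given denominators do not vanish. -/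
def IsPullback (g : Matrix (Ix n) (Ix n) ℝ) (F H : JetField n) : Prop :=
  ∃ p q r s : JetPoly n, q ≠ 0 ∧ s ≠ 0 ∧
    F = algebraMap _ _ p / algebraMap _ _ q ∧ H = algebraMap _ _ r / algebraMap _ _ s ∧
    ∀ c t c' t', MapsGerm n g c t c' t' →
      MvPolynomial.eval (jet n c' t') q ≠ 0 → MvPolynomial.eval (jet n c t) s ≠ 0 →
      MvPolynomial.eval (jet n c t) r / MvPolynomial.eval (jet n c t) s =
        MvPolynomial.eval (jet n c' t') p / MvPolynomial.eval (jet n c' t') q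

/-- `F` is a (rational) differential invariant: off the zero set of a denominator, it is constant
on the orbits of the prolonged action of the symplectic group. -/
def IsInvariant (F : JetField n) : Prop :=
  ∃ p q : JetPoly n, q ≠ 0 ∧ F = algebraMap _ _ p / algebraMap _ _ q ∧
    ∀ g ∈ Matrix.symplecticGroup (Fin n) ℝ, ∀ c t c' t', MapsGerm n g c t c' t' →
      MvPolynomial.eval (jet n c t) q ≠ 0 → MvPolynomial.eval (jet n c' t') q ≠ 0 →
      MvPolynomial.eval (jet n c t) p / MvPolynomial.eval (jet n c t) q =
        MvPolynomial.eval (jet n c' t') p / MvPolynomial.eval (jet n c' t') q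

/-! ### Normalization of the parametrization -/

/-- The symplectic form `dt ∧ dy + ∑ dxᵢ ∧ dzᵢ`, on vectors with rational-function entries. -/
def omega (a b : Ix n → JetField n) : JetField n :=
  ∑ i : Fin n, (a (Sum.inl i) * b (Sum.inr i) - a (Sum.inr i) * b (Sum.inl i))

/-- `w k = dᵏc/dtᵏ` for the parametrization of the curve by its first coordinate:
`w 0 = (t, x, y, z)`, `w 1 = (1, x₁, y₁, z₁)`, and `w k = (0, x_k, y_k, z_k)` for `k ≥ 2`. -/
def w (k : ℕ) (i : Ix n) : JetField n :=
  if h : i = Sum.inl 0 then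
    match k with
    | 0 => coord n .t
    | 1 => 1
    | _ + 2 => 0
  else coord n (.u ⟨i, h⟩ k)

/-- The coefficient of `dʲc/dτʲ` in the chain rule for `dᵏc/dtᵏ`, where `κ l = dˡτ/dtˡ` for `l ≥ 1`
and `κ 0 = 0` (a partial Bell polynomial): `k!/j!` times the coefficient of `sᵏ` in
`(∑ κ l sˡ / l!)ʲ`. -/
def chainCoeff (κ : ℕ → JetField n) (k j : ℕ) : JetField n :=
  ((k ! : JetField n) / (j ! : JetField n)) *
    PowerSeries.coeff k ((PowerSeries.mk fun l => κ l / (l ! : JetField n)) ^ j)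

/-- `κ l = dˡτ/dtˡ` and `v j = dʲc/dτʲ` are related to the `w k = dᵏc/dtᵏ` by the chain rule of all
orders, and `τ` is normalized by `ω(v₀, v₁) = 1` and `ω(v₀, v_k) = 0` for `k ≥ 2`. -/
structure IsNormalized (κ : ℕ → JetField n) (v : ℕ → Ix n → JetField n) : Prop where
  zero : κ 0 = 0
  chain : ∀ k i, w n k i = ∑ j ∈ Finset.range (k + 1), chainCoeff n κ k j * v j i
  norm_one : omega n (v 0) (v 1) = 1
  norm_ge_two : ∀ k, 2 ≤ k → omega n (v 0) (v k) = 0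

/-- The normalized jet of the change of parameter: `dᵏτ/dtᵏ = ω(v₀, w_k)`. -/
def kappa (k : ℕ) : JetField n :=
  if k = 0 then 0 else omega n (w n 0) (w n k)

/-- The normalized derivatives `v k = dᵏc/dτᵏ`, obtained by solving the chain rule. -/
def v (k : ℕ) (i : Ix n) : JetField n :=
  (w n k i - ∑ j : Fin k, chainCoeff n (kappa n) k j * v j i) / kappa n 1 ^ k

/-- The invariant `I_k = ω(v_{k-1}, v_k)`. -/
def I (k : ℕ) : JetField n := omega n (v n (k - 1)) (v n k)

/-- The derivation `∇ = (t y₁ - y + x·z₁ - x₁·z)⁻¹ D_t`. -/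
def nabla : Derivation ℝ (JetField n) (JetField n) :=
  (w n 0 (Sum.inl 0) * w n 1 (Sum.inr 0) - w n 0 (Sum.inr 0) +
    ∑ i ∈ Finset.univ.erase (0 : Fin n), (w n 0 (Sum.inl i) * w n 1 (Sum.inr i) -
      w n 1 (Sum.inl i) * w n 0 (Sum.inr i)))⁻¹ • totalD n

/-- The `j`-fold derivative `∇ʲ I_k`. -/
def gen (j k : ℕ) : JetField n := (nabla n)^[j] (I n k)

/-- The functions `∇ʲ I_k`, `2 ≤ k ≤ 2n`, of order at most `m`. -/
def gensUpTo (m : ℕ) : Set (JetField n) :=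
  {F | ∃ j k, 2 ≤ k ∧ k ≤ 2 * n ∧ j + k ≤ m ∧ F = gen n j k}

/-- All the functions `∇ʲ I_k`, `2 ≤ k ≤ 2n`. -/
def gens : Set (JetField n) :=
  {F | ∃ j k, 2 ≤ k ∧ k ≤ 2 * n ∧ F = gen n j k}

end SymplecticCurves

end

/-! ### Compositions of power series and derivations -/

namespace PowerSeries

section Composition

variable {L : Type*} [Field L]

/-! The normalization forces `κ_k = ω(w₀, w_k)` and so attaches to every jet a sequence of vectors
`v₀, v₁, …`, of which the first `2n` form a frame. The parameter `τ` depends on the base point, so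
`∇ v_k` is not quite `v_{k+1}`; but `v_{k+1}` is `∇ v_k` plus a combination of `v₁, …, v_k` whose
coefficients are multiples of pairings `ω(v₁, v_l)` (`v_succ`). Under a symplectic map, `κ₁ = ω(c,
dc/dt)` is multiplied by the same factor as `D_t`, so `∇` is invariant. By induction along `v_succ`,
the map `g` takes the frame at a jet to the frame at the image jet (`corresponds_v`), and all
pairings `ω(v_i, v_j)` are invariants.

These pairings are rational functions of the generators, with control of the order
(`omega_v_mem_genField`): the Leibniz rule expresses pairings with `v_{m+1}` through earlier ones,
except `ω(v_m, v_{m+1})`. This one is `I_{m+1}` for `m < 2n`, and follows by expanding `v_m` in the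
frame for `m ≥ 2n`.

Freeness is a count. The pairings of `v_k` with earlier vectors, completed by `2n - k` of the
components of `v_k` when `k < 2n`, determine `v_k`, hence the jet. So the generators together with
these finitely many frame components generate the field of `m`-jets, and up to every order `m ≥ 2n`
there are no more of them than jet coordinates. They are therefore algebraically independent
(`algebraicIndependent_Z`) and serve as a second coordinate system `Z`.

For generation, two generic points with the same generators have frames with the same pairings. A
symplectic matrix takes one frame to the other, hence one jet to the other
(`exists_mapsGerm_of_pairing_eq`). So an invariant, written in the coordinates `Z`, does not depend
on the frame components, and these may be replaced with constants (`exists_specialization`). This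
substitution raises no order and keeps the variables of the denominator under control, which gives
both generation statements. -/

theorem coeff_pow_eq_zero_of_lt {K : L⟦X⟧} (hK : coeff 0 K = 0) {k j : ℕ} (h : k < j) :
    coeff k (K ^ j) = 0 := by
  have h1 : (X : L⟦X⟧) ∣ K := X_dvd_iff.2 (by simpa using hK)
  exact X_pow_dvd_iff.1 (pow_dvd_pow_of_dvd h1 j) k h

theorem coeff_pow_self {K : L⟦X⟧} (hK : coeff 0 K = 0) (k : ℕ) :
    coeff k (K ^ k) = coeff 1 K ^ k := by
  obtain ⟨G, rfl⟩ : (X : L⟦X⟧) ∣ K := X_dvd_iff.2 (by simpa using hK)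
  rw [mul_pow, coeff_X_pow_mul' ]
  simp [coeff_succ_X_mul 0]

variable {R : Type*} [CommRing R] [Algebra R L] (D : Derivation R L L)

/-- The derivation `D`, acting on the coefficients of power series. -/
noncomputable def mapCoeff (f : L⟦X⟧) : L⟦X⟧ := mk fun k => D (coeff k f)

theorem mapCoeff_mul (f g : L⟦X⟧) :
    mapCoeff D (f * g) = f * mapCoeff D g + g * mapCoeff D f := by
  rw [mul_comm g]
  ext k
  simp only [mapCoeff, coeff_mk, coeff_mul, map_sum, map_add, Derivation.leibniz, smul_eq_mul,
    ← Finset.sum_add_distrib]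
  exact Finset.sum_congr rfl fun x _ => by ring

/-- Both `d/ds` and the coefficientwise `D` are derivations of the ring of power series, so their
difference obeys the power rule. The exponent `j - 1` is harmless at `j = 0` because of the factor
`j`. -/
theorem derivative_sub_mapCoeff_pow (K : L⟦X⟧) (j : ℕ) :
    d⁄dX L (K ^ j) - mapCoeff D (K ^ j) =
      (j : L⟦X⟧) * (K ^ (j - 1) * (d⁄dX L K - mapCoeff D K)) := by
  have h : mapCoeff D (1 : L⟦X⟧) = 0 := by
    ext k
    simp [mapCoeff, coeff_one, apply_ite D]
  induction j with
  | zero => simp [h]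
  | succ j ih =>
    rw [pow_succ, mapCoeff_mul, Derivation.leibniz, smul_eq_mul, smul_eq_mul]
    rcases j with _ | j
    · simp [h]
    · simp only [Nat.add_sub_cancel, pow_succ] at ih ⊢
      push_cast at ih ⊢
      linear_combination K * ih

/-- If `W = V ∘ K` for power series in `s` with `D W = dW/ds` and `dK/ds - D K = -κ A ∘ K`, then
`D V = -κ A V'`. -/
theorem derivation_coeff_of_composition {K : L⟦X⟧} {κ : L} {W V A : ℕ → L}
    (hK0 : coeff 0 K = 0) (hK1 : coeff 1 K ≠ 0)
    (hW : ∀ k, W k = ∑ j ∈ Finset.range (k + 1), V j * coeff k (K ^ j))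
    (hD : ∀ k, D (W k) = (k + 1) * W (k + 1))
    (hK : ∀ k, coeff (k + 1) K * (k + 1) - D (coeff k K) =
      -κ * ∑ l ∈ Finset.range (k + 1), A l * coeff k (K ^ l)) (k : ℕ) :
    D (V k) = -κ * ∑ x ∈ Finset.HasAntidiagonal.antidiagonal k, A x.1 * ((x.2 + 1) * V (x.2 + 1)) := by
  have hext : ∀ {k N : ℕ} (f : ℕ → L), k < N → ∑ j ∈ Finset.range (k + 1), f j * coeff k (K ^ j) =
      ∑ j ∈ Finset.range N, f j * coeff k (K ^ j) := fun {k N} f h =>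
    Finset.sum_subset (Finset.range_mono h) fun j _ hj => by
      rw [coeff_pow_eq_zero_of_lt hK0 (by simpa using hj), mul_zero]
  -- coefficients of `K ^ q * (dK/ds - D K)`
  have h1 : ∀ k q, coeff k (K ^ q * (d⁄dX L K - mapCoeff D K)) =
      -κ * ∑ l ∈ Finset.range (k + 1), A l * coeff k (K ^ (q + l)) := by
    intro k q
    simp only [pow_add, coeff_mul, Finset.mul_sum]
    rw [Finset.sum_comm]
    refine Finset.sum_congr rfl fun x hx => ?_
    have hx2 : x.2 < k + 1 := by
      have := Finset.HasAntidiagonal.mem_antidiagonal.1 hx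
      omega
    rw [map_sub, coeff_derivative, mapCoeff, coeff_mk, hK, hext _ hx2, Finset.mul_sum,
      Finset.mul_sum]
    exact Finset.sum_congr rfl fun l _ => by ring
  have h2 : ∀ k j, (k + 1) * coeff (k + 1) (K ^ j) - D (coeff k (K ^ j)) =
      j * (-κ * ∑ l ∈ Finset.range (k + 1), A l * coeff k (K ^ (j - 1 + l))) := by
    intro k j
    have h := congrArg (coeff k) (derivative_sub_mapCoeff_pow D K j)
    rw [← map_natCast (C (R := L)) j, coeff_C_mul, h1, map_sub, coeff_derivative, mapCoeff,
      coeff_mk] at h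
    rw [← h, mul_comm]
  set U : ℕ → L := fun k =>
    -κ * ∑ x ∈ Finset.HasAntidiagonal.antidiagonal k, A x.1 * ((x.2 + 1) * V (x.2 + 1)) with hU
  -- Coefficient form of `(D V - U) ∘ K = 0`: comparing `D (V ∘ K)` with `d(V ∘ K)/ds` leaves `(D V)
  -- ∘ K = (V' ∘ K) (dK/ds - D K)`.
  have key : ∀ k, ∑ j ∈ Finset.range (k + 1), (D (V j) - U j) * coeff k (K ^ j) = 0 := by
    intro k
    have e1 := hD k
    rw [hW k, hW (k + 1), hext V (show k < k + 1 + 1 by omega), map_sum] at e1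
    simp only [Derivation.leibniz, smul_eq_mul, Finset.sum_add_distrib, Finset.mul_sum] at e1
    have e2 : ∑ j ∈ Finset.range (k + 1 + 1), coeff k (K ^ j) * D (V j) =
        ∑ j ∈ Finset.range (k + 1), D (V j) * coeff k (K ^ j) := by
      rw [hext _ (show k < k + 1 + 1 by omega)]
      exact Finset.sum_congr rfl fun _ _ => mul_comm _ _
    rw [e2] at e1
    have e3 : ∑ j ∈ Finset.range (k + 1), D (V j) * coeff k (K ^ j) =
        ∑ j ∈ Finset.range (k + 1 + 1), V j *
          (j * (-κ * ∑ l ∈ Finset.range (k + 1), A l * coeff k (K ^ (j - 1 + l)))) := by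
      rw [eq_sub_of_add_eq' e1, ← Finset.sum_sub_distrib]
      exact Finset.sum_congr rfl fun j _ => by rw [← h2]; ring
    rw [Finset.sum_range_succ' _ (k + 1)] at e3
    simp only [Nat.cast_zero, zero_mul, mul_zero, add_zero, Nat.add_sub_cancel] at e3
    simp only [sub_mul, Finset.sum_sub_distrib, e3, sub_eq_zero, hU, Finset.mul_sum,
      Finset.sum_mul]
    -- The double sum is regrouped by the total exponent of `K`; exponents above `k` do not
    -- contribute to the coefficient of `s ^ k`.
    rw [← Finset.sum_product', ← Finset.sum_filter_add_sum_filter_not _ (fun x => x.1 + x.2 ≤ k),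
      Finset.sum_eq_zero (s := Finset.filter (fun x => ¬ _) _), add_zero,
      ← Finset.sum_fiberwise_of_maps_to (t := Finset.range (k + 1)) (g := fun x => x.1 + x.2)]
    · refine Finset.sum_congr rfl fun p hp => ?_
      rw [← Finset.Nat.sum_antidiagonal_swap]
      refine Finset.sum_congr ?_ fun x hx => ?_
      · ext x
        simp at hp ⊢
        omega
      · have := Finset.HasAntidiagonal.mem_antidiagonal.1 hx
        simp only [Prod.fst_swap, Prod.snd_swap, ← this]
        push_cast
        ring
    · intro x hx
      simp at hx ⊢
      omega
    · intro x hx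
      simp only [Finset.mem_filter, not_le] at hx
      rw [coeff_pow_eq_zero_of_lt hK0 hx.2]
      ring
  -- The system `key` is triangular with diagonal entries `coeff 1 K ^ k ≠ 0`.
  suffices h : ∀ k, D (V k) = U k from h k
  intro k
  induction k using Nat.strong_induction_on with
  | _ k ih =>
    have := key k
    rw [Finset.sum_range_succ, Finset.sum_eq_zero, zero_add, coeff_pow_self hK0] at this
    · exact sub_eq_zero.1 ((mul_eq_zero.1 this).resolve_right (pow_ne_zero _ hK1))
    · intro j hj
      rw [ih j (by simpa using hj), sub_self, zero_mul]

end Composition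

end PowerSeries

namespace SymplecticCurves

variable (n : ℕ) [NeZero n]

/-! ### The symplectic form and the total derivative -/

section Omega

variable {n}

theorem omega_self (a : Ix n → JetField n) : omega n a a = 0 := by
  simp [omega, mul_comm]

theorem omega_swap (a b : Ix n → JetField n) : omega n a b = -omega n b a := by
  simp only [omega, ← Finset.sum_neg_distrib]
  exact Finset.sum_congr rfl fun _ _ => by ring

theorem omega_sum_right {ι : Type*} (s : Finset ι) (a : Ix n → JetField n) (c : ι → JetField n)
    (b : ι → Ix n → JetField n) :
    omega n a (fun i => ∑ j ∈ s, c j * b j i) = ∑ j ∈ s, c j * omega n a (b j) := by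
  simp only [omega, Finset.mul_sum]
  rw [Finset.sum_comm]
  refine Finset.sum_congr rfl fun i _ => ?_
  rw [← Finset.sum_sub_distrib]
  exact Finset.sum_congr rfl fun _ _ => by ring

theorem omega_add_right (a b c : Ix n → JetField n) :
    omega n a (fun i => b i + c i) = omega n a b + omega n a c := by
  simp only [omega, ← Finset.sum_add_distrib]
  exact Finset.sum_congr rfl fun _ _ => by ring

theorem omega_mul_right (a b : Ix n → JetField n) (c : JetField n) :
    omega n a (fun i => c * b i) = c * omega n a b := by
  simp only [omega, Finset.mul_sum]
  exact Finset.sum_congr rfl fun _ _ => by ring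

theorem omega_mul_left (a b : Ix n → JetField n) (c : JetField n) :
    omega n (fun i => c * a i) b = c * omega n a b := by
  rw [omega_swap, omega_mul_right, omega_swap a, mul_neg]

theorem derivation_omega (D : Derivation ℝ (JetField n) (JetField n))
    (a b : Ix n → JetField n) :
    D (omega n a b) = omega n (fun i => D (a i)) b + omega n a (fun i => D (b i)) := by
  simp only [omega, map_sum, map_sub, Derivation.leibniz, smul_eq_mul, ← Finset.sum_add_distrib]
  exact Finset.sum_congr rfl fun _ _ => by ring

theorem omega_eq_sum (a b : Ix n → JetField n) :
    omega n a b = ∑ j, Sum.elim (fun i => -a (Sum.inr i)) (fun i => a (Sum.inl i)) j * b j := by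
  rw [Fintype.sum_sum_type, omega, ← Finset.sum_add_distrib]
  exact Finset.sum_congr rfl fun _ _ => by simp; ring

end Omega

theorem algebraMap_jetPoly_injective :
    Function.Injective (algebraMap (JetPoly n) (JetField n)) :=
  IsFractionRing.injective (JetPoly n) (JetField n)

theorem totalD_algebraMap (p : JetPoly n) :
    totalD n (algebraMap _ _ p) = algebraMap _ _ (totalDPoly n p) := by
  have h := totalDFun_div n p 1 one_ne_zero
  simp only [map_one, div_one, Derivation.map_one_eq_zero, map_zero, mul_one, mul_zero, sub_zero,
    one_pow] at h
  exact h

@[simp] theorem totalD_coord_t : totalD n (coord n .t) = 1 := by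
  rw [coord, totalD_algebraMap, totalDPoly, MvPolynomial.mkDerivation_X, map_one]

@[simp] theorem totalD_coord_u (i : {i : Ix n // i ≠ Sum.inl 0}) (k : ℕ) :
    totalD n (coord n (.u i k)) = coord n (.u i (k + 1)) := by
  rw [coord, totalD_algebraMap, totalDPoly, MvPolynomial.mkDerivation_X, coord]

theorem totalD_w (k : ℕ) (i : Ix n) : totalD n (w n k i) = w n (k + 1) i := by
  by_cases h : i = Sum.inl 0
  · rcases k with _ | _ | k <;> simp [w, h]
  · simp [w, h]

/-- The polynomial whose fraction is `w k i`. -/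
noncomputable def wPoly (k : ℕ) (i : Ix n) : JetPoly n :=
  if h : i = Sum.inl 0 then
    match k with
    | 0 => MvPolynomial.X .t
    | 1 => 1
    | _ + 2 => 0
  else MvPolynomial.X (.u ⟨i, h⟩ k)

theorem algebraMap_wPoly (k : ℕ) (i : Ix n) : algebraMap _ _ (wPoly n k i) = w n k i := by
  by_cases h : i = Sum.inl 0
  · rcases k with _ | _ | k <;> simp [w, wPoly, h, coord]
  · simp [w, wPoly, h, coord]

/-- The polynomial `t y₁ - y + x·z₁ - x₁·z`. -/
noncomputable def lamPoly : JetPoly n :=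
  ∑ i : Fin n, (wPoly n 0 (Sum.inl i) * wPoly n 1 (Sum.inr i) -
    wPoly n 0 (Sum.inr i) * wPoly n 1 (Sum.inl i))

theorem kappa_eq_omega (k : ℕ) : kappa n k = omega n (w n 0) (w n k) := by
  unfold kappa
  split_ifs with h
  · rw [h, omega_self]
  · rfl

theorem algebraMap_lamPoly : algebraMap _ _ (lamPoly n) = kappa n 1 := by
  simp only [kappa_eq_omega, omega, lamPoly, map_sum, map_sub, map_mul, algebraMap_wPoly]

/-- A jet at which all vectors `w k` vanish, but for two conjugate coordinates of `w 0`, `w 1`. -/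
noncomputable def basePoint : JetCoord n → ℝ
  | .t => 1
  | .u i k => if (i : Ix n) = Sum.inr 0 ∧ k = 1 then 1 else 0

theorem lamPoly_ne_zero : lamPoly n ≠ 0 := by
  intro h
  have h1 := congrArg (MvPolynomial.eval (basePoint n)) h
  simp only [lamPoly, map_sum, map_sub, map_mul, map_zero] at h1
  rw [Finset.sum_eq_single 0] at h1
  · simp [wPoly, basePoint] at h1
  · intro i _ hi
    simp [wPoly, basePoint, hi]
  · simp

theorem kappa_one_ne_zero : kappa n 1 ≠ 0 := by
  rw [← algebraMap_lamPoly]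
  simpa using lamPoly_ne_zero n

theorem nabla_eq : nabla n = (kappa n 1)⁻¹ • totalD n := by
  unfold nabla
  congr 2
  have h0 : w n 1 (Sum.inl 0) = 1 := by simp [w]
  rw [kappa_eq_omega, omega, ← Finset.add_sum_erase _ _ (Finset.mem_univ (0 : Fin n)), h0, mul_one]
  congr 1
  exact Finset.sum_congr rfl fun _ _ => by ring

theorem nabla_apply (F : JetField n) : nabla n F = (kappa n 1)⁻¹ * totalD n F := by
  rw [nabla_eq, Derivation.smul_apply, smul_eq_mul]

/-! ### Normalization of the parametrization -/

section ChainCoeff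

variable {n} {κ : ℕ → JetField n}

theorem factorial_ne_zero' (k : ℕ) : (k ! : JetField n) ≠ 0 :=
  Nat.cast_ne_zero.2 (Nat.factorial_ne_zero k)

theorem chainCoeff_self (h0 : κ 0 = 0) (k : ℕ) : chainCoeff n κ k k = κ 1 ^ k := by
  rw [chainCoeff, PowerSeries.coeff_pow_self (by simp [h0]), div_self (factorial_ne_zero' k)]
  simp

theorem chainCoeff_zero_right (k : ℕ) : chainCoeff n κ k 0 = if k = 0 then 1 else 0 := by
  rw [chainCoeff, pow_zero, PowerSeries.coeff_one]
  split_ifs with h <;> simp [h]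

theorem chainCoeff_one_right (k : ℕ) : chainCoeff n κ k 1 = κ k := by
  rw [chainCoeff, pow_one, PowerSeries.coeff_mk, Nat.factorial_one, Nat.cast_one, div_one,
    mul_div_cancel₀ _ (factorial_ne_zero' k)]

end ChainCoeff

theorem kappa_zero : kappa n 0 = 0 := if_pos rfl

theorem w_eq_chain (k : ℕ) (i : Ix n) :
    w n k i = ∑ j ∈ Finset.range (k + 1), chainCoeff n (kappa n) k j * v n j i := by
  rw [Finset.sum_range_succ, chainCoeff_self (kappa_zero n), v,
    mul_div_cancel₀ _ (pow_ne_zero k (kappa_one_ne_zero n)),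
    Fin.sum_univ_eq_sum_range (fun j => chainCoeff n (kappa n) k j * v n j i)]
  ring

theorem v_zero : v n 0 = w n 0 := by
  funext i
  rw [w_eq_chain]
  simp [chainCoeff_zero_right]

theorem omega_v_zero_v_one : omega n (v n 0) (v n 1) = 1 := by
  have h := kappa_eq_omega n 1
  rw [← v_zero, show w n 1 = fun i => _ from funext (w_eq_chain n 1), omega_sum_right] at h
  simp only [Finset.sum_range_succ, Finset.range_zero, Finset.sum_empty, chainCoeff_zero_right,
    chainCoeff_one_right, omega_self] at h
  exact mul_left_cancel₀ (kappa_one_ne_zero n) (by rw [mul_one]; simpa using h.symm)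

/-- In the chain rule for `w k` paired with `v 0`, induction leaves only the terms `j = 1` and `j =
k`. The first is `κ_k = ω(w₀, w_k)`, which is already the left side, so `κ₁ ^ k ω(v₀, v_k) = 0`. -/
theorem omega_v_zero_of_two_le {k : ℕ} (hk : 2 ≤ k) : omega n (v n 0) (v n k) = 0 := by
  induction k using Nat.strong_induction_on with
  | _ k ih =>
    have h := kappa_eq_omega n k
    rw [← v_zero, show w n k = fun i => _ from funext (w_eq_chain n k), omega_sum_right,
      Finset.sum_range_succ, chainCoeff_self (kappa_zero n),
      ← Finset.sum_subset (Finset.singleton_subset_iff.2 (Finset.mem_range.2 hk)),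
      Finset.sum_singleton, chainCoeff_one_right, omega_v_zero_v_one, mul_one] at h
    · have := pow_ne_zero k (kappa_one_ne_zero n)
      simpa [this] using h
    · intro j hj hj1
      rcases Nat.eq_zero_or_pos j with rfl | h0
      · rw [omega_self, mul_zero]
      · rw [ih j (Finset.mem_range.1 hj) (by simp at hj1; omega), mul_zero]

theorem isNormalized : IsNormalized n (kappa n) (v n) where
  zero := kappa_zero n
  chain := w_eq_chain n
  norm_one := omega_v_zero_v_one n
  norm_ge_two := fun _ => omega_v_zero_of_two_le n

/-- Pairing the chain rule with `v' 0 = w 0` leaves only the term `j = 1` and forces `κ`; the chain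
rule is then triangular in `v'`, with diagonal entries `κ₁ ^ k`. -/
theorem IsNormalized.eq {n : ℕ} [NeZero n] {κ : ℕ → JetField n} {v' : ℕ → Ix n → JetField n}
    (h : IsNormalized n κ v') : κ = kappa n ∧ v' = v n := by
  have h0 : v' 0 = w n 0 := by
    funext i
    rw [h.chain]
    simp [chainCoeff_zero_right]
  have hκ : κ = kappa n := by
    funext k
    rcases Nat.eq_zero_or_pos k with rfl | hk
    · rw [h.zero, kappa_zero]
    rw [kappa_eq_omega, ← h0, show w n k = fun i => _ from funext (h.chain k), omega_sum_right,
      ← Finset.sum_subset (Finset.singleton_subset_iff.2 (Finset.mem_range.2 (show 1 < k + 1 by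
        omega))), Finset.sum_singleton, chainCoeff_one_right, h.norm_one, mul_one]
    intro j _ hj1
    rcases Nat.eq_zero_or_pos j with rfl | h0
    · rw [omega_self, mul_zero]
    · rw [h.norm_ge_two j (by simp at hj1; omega), mul_zero]
  subst hκ
  refine ⟨rfl, funext fun k => ?_⟩
  induction k using Nat.strong_induction_on with
  | _ k ih =>
    funext i
    have h1 := h.chain k i
    rw [w_eq_chain, Finset.sum_range_succ, Finset.sum_range_succ,
      Finset.sum_congr rfl (fun j hj => by rw [← ih j (Finset.mem_range.1 hj)]),
      chainCoeff_self (kappa_zero n)] at h1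
    exact (mul_left_cancel₀ (pow_ne_zero k (kappa_one_ne_zero n)) (add_left_cancel h1)).symm

/-! ### The derivatives of the normalized frame -/

theorem derivation_div_natCast (D : Derivation ℝ (JetField n) (JetField n)) (a : JetField n)
    (m : ℕ) : D (a / m) = D a / m := by
  have h : ∀ b : JetField n, b / m = (m : ℝ)⁻¹ • b := fun b => by
    rw [Algebra.smul_def, map_inv₀, map_natCast, div_eq_inv_mul]
  rw [h, h, D.map_smul]

theorem w_one (i : Ix n) : w n 1 i = kappa n 1 * v n 1 i := by
  rw [w_eq_chain]
  simp [Finset.sum_range_succ, chainCoeff_zero_right, chainCoeff_one_right]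

theorem totalD_kappa (k : ℕ) :
    totalD n (kappa n k) = omega n (w n 1) (w n k) + kappa n (k + 1) := by
  rw [kappa_eq_omega, derivation_omega, kappa_eq_omega]
  simp only [totalD_w]

/-- In terms of the Taylor series `W`, `V`, `K` of the curve in `t`, of the curve in `τ`, and of `τ`
in `t`, the chain rule is `W = V ∘ K`. Since `W` expands the curve about the current point, `D W =
dW/ds`; since `κ_k = ω(w₀, w_k)`, the defect `dK/ds - D K` is `-κ₁ ω(v₁, V) ∘ K`. The sum is the
coefficient of the product of `ω(v₁, V)` and `V'`. -/
theorem nabla_v (k : ℕ) (i : Ix n) :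
    nabla n (v n k i) = -∑ x ∈ Finset.HasAntidiagonal.antidiagonal k,
      (k.choose x.1 : JetField n) * omega n (v n 1) (v n x.1) * v n (x.2 + 1) i := by
  have hf := factorial_ne_zero' (n := n)
  have hs : ∀ k, ((k + 1)! : JetField n) = (k + 1) * (k ! : JetField n) := fun k => by
    rw [Nat.factorial_succ]; push_cast; ring
  have hk : ∀ k : ℕ, (k + 1 : JetField n) ≠ 0 := fun k => by exact_mod_cast k.succ_ne_zero
  have key := PowerSeries.derivation_coeff_of_composition (totalD n)
    (K := PowerSeries.mk fun l => kappa n l / (l ! : JetField n)) (κ := kappa n 1)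
    (W := fun k => w n k i / (k ! : JetField n)) (V := fun k => v n k i / (k ! : JetField n))
    (A := fun k => omega n (v n 1) (v n k) / (k ! : JetField n))
    (by simp [kappa_zero]) (by simpa using kappa_one_ne_zero n) ?_ ?_ ?_ k
  · simp only [derivation_div_natCast] at key
    rw [nabla_apply, ← div_mul_cancel₀ (totalD n (v n k i)) (hf k), key, Finset.mul_sum,
      Finset.sum_mul, Finset.mul_sum, ← Finset.sum_neg_distrib]
    refine Finset.sum_congr rfl fun x hx => ?_
    have h1 : (k.choose x.1 : JetField n) * (x.1 ! : JetField n) * (x.2 ! : JetField n) = k ! := by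
      rw [← Finset.HasAntidiagonal.mem_antidiagonal.1 hx]
      rw [Nat.choose_symm_add]
      exact_mod_cast Nat.add_choose_mul_factorial_mul_factorial x.1 x.2
    rw [← h1, hs]
    have := hf x.1
    have := hf x.2
    have := hk x.2
    have := kappa_one_ne_zero n
    generalize omega n (v n 1) (v n x.1) = a at *
    generalize v n (x.2 + 1) i = b at *
    generalize kappa n 1 = c at *
    generalize (x.1 ! : JetField n) = d at *
    generalize (x.2 ! : JetField n) = e at *
    field_simp
  · intro k
    rw [w_eq_chain, Finset.sum_div]
    refine Finset.sum_congr rfl fun j _ => ?_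
    rw [chainCoeff]
    have := hf k
    have := hf j
    field_simp
  · intro k
    rw [derivation_div_natCast, totalD_w, hs]
    have := hf k
    have := hk k
    field_simp
  · intro k
    simp only [PowerSeries.coeff_mk]
    rw [derivation_div_natCast, totalD_kappa, hs, show w n 1 = fun i => _ from funext (w_one n),
      omega_mul_left, show w n k = fun i => _ from funext (w_eq_chain n k), omega_sum_right]
    have e : ∑ j ∈ Finset.range (k + 1), chainCoeff n (kappa n) k j * omega n (v n 1) (v n j) =
        (k ! : JetField n) * ∑ l ∈ Finset.range (k + 1),
          omega n (v n 1) (v n l) / (l ! : JetField n) *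
            PowerSeries.coeff k ((PowerSeries.mk fun l => kappa n l / (l ! : JetField n)) ^ l) := by
      rw [Finset.mul_sum]
      refine Finset.sum_congr rfl fun j _ => ?_
      rw [chainCoeff]
      have := hf j
      field_simp
    rw [e]
    have := hf k
    have := hk k
    generalize (∑ l ∈ Finset.range (k + 1), _ : JetField n) = S
    field_simp
    ring

/-- `v (k + 1)` in terms of `∇ (v k)` and lower order terms. -/
theorem v_succ (k : ℕ) (i : Ix n) :
    v n (k + 1) i = nabla n (v n k i) + ∑ l ∈ Finset.range k,
      (k.choose (l + 1) : JetField n) * omega n (v n 1) (v n (l + 1)) * v n (k - l) i := by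
  rw [nabla_v, Finset.Nat.sum_antidiagonal_eq_sum_range_succ_mk, Finset.sum_range_succ']
  -- The term with `ω(v₁, v₀) = -1` is the one that produces `v (k + 1)`.
  rw [omega_swap (v n 1) (v n 0), omega_v_zero_v_one]
  have e : ∀ l ∈ Finset.range k,
      (k.choose (l + 1) : JetField n) * omega n (v n 1) (v n (l + 1)) * v n (k - (l + 1) + 1) i =
        (k.choose (l + 1) : JetField n) * omega n (v n 1) (v n (l + 1)) * v n (k - l) i := by
    intro l hl
    rw [show k - l = k - (l + 1) + 1 by have := Finset.mem_range.1 hl; omega]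
  rw [Finset.sum_congr rfl e]
  simp

end SymplecticCurves

/-! ### Completing a system of linear functionals by coordinates -/

/-- Independent functionals extend to a basis by coordinate functionals, and `S` indexes those
added. Each coordinate is then a `k`-combination of the functionals in the basis. Membership in an
arbitrary `k`-submodule `P` makes the statement usable for subfields and for subalgebras of `L`
alike. -/
theorem LinearIndependent.exists_finset_forall_mem_of_sum_mem {L : Type*} [Field L] {k : Type*}
    [Field k] [Algebra k L] {ι : Type*} [Fintype ι] [DecidableEq ι] {m : ℕ} {f : Fin m → ι → k}
    (hf : LinearIndependent k f) :
    ∃ S : Finset ι, S.card + m = Fintype.card ι ∧ ∀ (P : Submodule k L) (y : ι → L),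
      (∀ a, ∑ j, f a j • y j ∈ P) → (∀ j ∈ S, y j ∈ P) → ∀ j, y j ∈ P := by
  classical
  set e : ι → ι → k := fun j => Pi.single j 1 with he
  obtain ⟨b, hbt, hsb, htb, hb⟩ := exists_linearIndepOn_id_extension hf.linearIndepOn_id
    (Set.subset_union_left (t := Set.range e))
  have hspan : Submodule.span k b = ⊤ := by
    rw [eq_top_iff, ← (Pi.basisFun k ι).span_eq, Submodule.span_le]
    rintro _ ⟨j, rfl⟩
    rw [Pi.basisFun_apply]
    exact htb (Or.inr ⟨j, rfl⟩)
  have hfin : b.Finite := hb.setFinite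
  have hcard : b.ncard = Fintype.card ι := by
    have := Module.finrank_eq_nat_card_basis
      (Module.Basis.mk hb.linearIndependent (by simp [hspan]))
    rw [Module.finrank_fintype_fun_eq_card] at this
    exact this.symm
  have hinj : Function.Injective e := fun i j h => by
    by_contra hij
    have := congrFun h i
    simp [he, hij] at this
  refine ⟨Finset.univ.filter fun j => e j ∈ b \ Set.range f, ?_, fun P y hP hS => ?_⟩
  · rw [← hcard, ← Set.ncard_sdiff_add_ncard_of_subset hsb hfin]
    congr 1
    · rw [← Set.ncard_coe_finset, ← Set.ncard_image_of_injective _ hinj]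
      congr 1
      ext g
      constructor
      · rintro ⟨j, hj, rfl⟩
        simpa using hj
      · intro hg
        rcases hbt hg.1 with h | ⟨j, rfl⟩
        · exact absurd h hg.2
        · exact ⟨j, by simpa using hg, rfl⟩
    · rw [← Set.image_univ, Set.ncard_image_of_injective _ hf.injective]
      simp
  -- The functionals with value at `y` in `P` form a subspace, which contains the basis.
  · let W : Submodule k (ι → k) :=
      { carrier := {g | ∑ j, g j • y j ∈ P}
        add_mem' := fun {a c} ha hc => by
          simpa [add_smul, Finset.sum_add_distrib] using P.add_mem ha hc
        zero_mem' := by simp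
        smul_mem' := fun r a ha => by
          simpa [mul_smul, ← Finset.smul_sum] using P.smul_mem r ha }
    have hW : ⊤ ≤ W := by
      rw [← hspan, Submodule.span_le]
      intro g hg
      rcases hbt hg with ⟨a, rfl⟩ | ⟨j, rfl⟩
      · exact hP a
      · by_cases h : e j ∈ Set.range f
        · obtain ⟨a, ha⟩ := h
          rw [← ha]
          exact hP a
        · have : ∑ i, e j i • y i = y j := by simp [he, Pi.single_apply]
          change ∑ i, e j i • y i ∈ P
          rw [this]
          exact hS j (by simpa using ⟨hg, by simpa using h⟩)
    intro j
    have : ∑ i, e j i • y i ∈ P := hW (Submodule.mem_top (x := e j))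
    simpa [he, Pi.single_apply] using this

/-- The version of `LinearIndependent.exists_finset_forall_mem_of_sum_mem` for functionals with
coefficients in a subfield. -/
theorem IntermediateField.exists_finset_forall_mem_of_sum_mem {F L : Type*} [Field F] [Field L]
    [Algebra F L] (E : IntermediateField F L) {ι : Type*} [Fintype ι] [DecidableEq ι] {m : ℕ}
    {f : Fin m → ι → L} (hf : LinearIndependent L f) (hE : ∀ a j, f a j ∈ E) :
    ∃ S : Finset ι, S.card + m = Fintype.card ι ∧ ∀ (P : Submodule E L) (y : ι → L),
      (∀ a, ∑ j, f a j * y j ∈ P) → (∀ j ∈ S, y j ∈ P) → ∀ j, y j ∈ P := by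
  let f' : Fin m → ι → E := fun a j => ⟨f a j, hE a j⟩
  have h1 : LinearIndependent E f := hf.restrict_scalars' E
  have h2 : LinearIndependent E f' := by
    refine LinearIndependent.of_comp ((Algebra.linearMap E L).compLeft ι) ?_
    exact h1
  exact h2.exists_finset_forall_mem_of_sum_mem (L := L)

namespace SymplecticCurves

variable (n : ℕ) [NeZero n]

/-! ### The functions on jets that are polynomial up to powers of `κ₁` in the denominator -/

/-- Polynomials in the jet coordinates of order at most `k` and in `κ₁⁻¹`. -/
noncomputable def T (k : ℕ) : Subalgebra ℝ (JetField n) :=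
  Algebra.adjoin ℝ (coord n '' {a | a.order ≤ k} ∪ {(kappa n 1)⁻¹})

variable {n}

theorem T_mono {k l : ℕ} (h : k ≤ l) : T n k ≤ T n l :=
  Algebra.adjoin_mono (Set.union_subset_union_left _ (Set.image_mono fun _ ha => le_trans ha h))

theorem coord_mem_T {a : JetCoord n} {k : ℕ} (h : a.order ≤ k) : coord n a ∈ T n k :=
  Algebra.subset_adjoin (Or.inl ⟨a, h, rfl⟩)

theorem kappa_one_inv_mem_T (k : ℕ) : (kappa n 1)⁻¹ ∈ T n k :=
  Algebra.subset_adjoin (Or.inr rfl)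

theorem w_mem_of_coord_mem {S : Subalgebra ℝ (JetField n)} {k : ℕ}
    (h : ∀ a : JetCoord n, a.order ≤ k → coord n a ∈ S) (i : Ix n) : w n k i ∈ S := by
  by_cases hi : i = Sum.inl 0
  · rcases k with _ | _ | k
    · simpa [w, hi] using h .t le_rfl
    · simp [w, hi]
    · simp [w, hi]
  · simpa [w, hi] using h (.u ⟨i, hi⟩ k) le_rfl

theorem w_mem_T (k : ℕ) (i : Ix n) : w n k i ∈ T n k :=
  w_mem_of_coord_mem (fun _ => coord_mem_T) i

theorem natCast_mem_T (m k : ℕ) : (m : JetField n) ∈ T n k := natCast_mem _ m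

theorem omega_mem {S : Subalgebra ℝ (JetField n)} {a b : Ix n → JetField n}
    (ha : ∀ i, a i ∈ S) (hb : ∀ i, b i ∈ S) : omega n a b ∈ S :=
  S.sum_mem fun _ _ => S.sub_mem (S.mul_mem (ha _) (hb _)) (S.mul_mem (ha _) (hb _))

theorem kappa_mem_T (k : ℕ) : kappa n k ∈ T n k := by
  rw [kappa_eq_omega]
  exact omega_mem (fun i => T_mono (Nat.zero_le k) (w_mem_T 0 i)) (w_mem_T k)

theorem coord_mem_ratJet {a : JetCoord n} {k : ℕ} (h : a.order ≤ k) : coord n a ∈ ratJet n k :=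
  IntermediateField.subset_adjoin _ _ ⟨a, h, rfl⟩

theorem ratJet_mono {k l : ℕ} (h : k ≤ l) : ratJet n k ≤ ratJet n l :=
  IntermediateField.adjoin.mono _ _ _ (Set.image_mono fun _ ha => le_trans ha h)

theorem kappa_mem_ratJet (k : ℕ) : kappa n k ∈ ratJet n k := by
  rw [kappa_eq_omega]
  exact omega_mem (S := (ratJet n k).toSubalgebra)
    (fun i => w_mem_of_coord_mem (fun _ h => coord_mem_ratJet (h.trans (Nat.zero_le k))) i)
    (fun i => w_mem_of_coord_mem (fun _ => coord_mem_ratJet) i)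

theorem T_le_ratJet {k : ℕ} (hk : 1 ≤ k) : T n k ≤ (ratJet n k).toSubalgebra := by
  refine Algebra.adjoin_le ?_
  rintro _ (⟨a, ha, rfl⟩ | rfl)
  · exact coord_mem_ratJet ha
  · exact (ratJet n k).inv_mem (ratJet_mono hk (kappa_mem_ratJet 1))

theorem totalD_mem_T {k : ℕ} (hk : 1 ≤ k) {F : JetField n} (hF : F ∈ T n k) :
    totalD n F ∈ T n (k + 1) := by
  have hle := T_mono (n := n) k.le_succ
  induction hF using Algebra.adjoin_induction with
  | mem x hx =>
    rcases hx with ⟨a, ha, rfl⟩ | rfl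
    · cases a with
      | t => rw [totalD_coord_t]; exact one_mem _
      | u i j => rw [totalD_coord_u]; exact coord_mem_T (Nat.succ_le_succ ha)
    -- `D κ₁ = ω(w₁, w₁) + κ₂` has order two, which is where `1 ≤ k` is needed.
    · rw [Derivation.leibniz_inv, totalD_kappa, smul_eq_mul]
      refine mul_mem (neg_mem (pow_mem (kappa_one_inv_mem_T _) 2)) (add_mem ?_ ?_)
      · rw [omega_self]; exact zero_mem _
      · exact T_mono (by omega) (kappa_mem_T 2)
  | algebraMap r => rw [Derivation.map_algebraMap]; exact zero_mem _
  | add x y _ _ hx hy => rw [map_add]; exact add_mem hx hy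
  | mul x y hx' hy' hx hy =>
    rw [Derivation.leibniz, smul_eq_mul, smul_eq_mul]
    exact add_mem (mul_mem (hle hx') hy) (mul_mem (hle hy') hx)

theorem nabla_mem_T {k : ℕ} (hk : 1 ≤ k) {F : JetField n} (hF : F ∈ T n k) :
    nabla n F ∈ T n (k + 1) := by
  rw [nabla_apply]
  exact mul_mem (kappa_one_inv_mem_T _) (totalD_mem_T hk hF)

theorem v_one (i : Ix n) : v n 1 i = (kappa n 1)⁻¹ * w n 1 i := by
  rw [w_one, inv_mul_cancel_left₀ (kappa_one_ne_zero n)]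

theorem v_mem_T (k : ℕ) (i : Ix n) : v n k i ∈ T n k := by
  induction k using Nat.strong_induction_on generalizing i with
  | _ k ih =>
    rcases k with _ | _ | k
    · rw [v_zero]; exact w_mem_T 0 i
    · rw [v_one]; exact mul_mem (kappa_one_inv_mem_T _) (w_mem_T 1 i)
    · have h : ∀ m i, m < k + 2 → v n m i ∈ T n (k + 2) := fun m i hm =>
        T_mono hm.le (ih m hm i)
      rw [v_succ]
      refine add_mem (nabla_mem_T (by omega) (ih _ (by omega) i)) (sum_mem fun l hl => ?_)
      have := Finset.mem_range.1 hl
      exact mul_mem (mul_mem (natCast_mem_T _ _)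
        (omega_mem (fun i => h 1 i (by omega)) fun i => h _ i (by omega))) (h _ i (by omega))

theorem v_mem_T_of_le {k m : ℕ} (h : k ≤ m) (i : Ix n) : v n k i ∈ T n m :=
  T_mono h (v_mem_T k i)

theorem omega_v_mem_T {k l m : ℕ} (hk : k ≤ m) (hl : l ≤ m) : omega n (v n k) (v n l) ∈ T n m :=
  omega_mem (v_mem_T_of_le hk) (v_mem_T_of_le hl)

theorem v_mem_ratJet {k m : ℕ} (h : k ≤ m) (i : Ix n) : v n k i ∈ ratJet n m := by
  rcases Nat.eq_zero_or_pos k with rfl | hk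
  · rw [v_zero]
    exact w_mem_of_coord_mem (S := (ratJet n m).toSubalgebra)
      (fun _ h => coord_mem_ratJet (h.trans (Nat.zero_le m))) i
  · exact ratJet_mono h (T_le_ratJet hk (v_mem_T k i))

/-- The difference between `v (k + 1)` and `∇ (v k)` has lower order. -/
theorem v_succ_sub_nabla_mem_T (k : ℕ) (i : Ix n) :
    v n (k + 1) i - nabla n (v n k i) ∈ T n k := by
  rw [v_succ, add_sub_cancel_left]
  refine sum_mem fun l hl => ?_
  have := Finset.mem_range.1 hl
  exact mul_mem (mul_mem (natCast_mem_T _ _) (omega_v_mem_T (by omega) (by omega)))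
    (v_mem_T_of_le (by omega) i)

/-- The terms of the highest order of `v k`. -/
theorem v_sub_mem_T (k : ℕ) (i : Ix n) :
    v n (k + 2) i - (kappa n 1)⁻¹ ^ (k + 2) *
      (w n (k + 2) i - kappa n (k + 2) * v n 1 i) ∈ T n (k + 1) := by
  have hμ : totalD n (kappa n 1)⁻¹ = -(kappa n 1)⁻¹ ^ 2 * kappa n 2 := by
    rw [Derivation.leibniz_inv, totalD_kappa, omega_self, zero_add, smul_eq_mul]
  induction k with
  | zero =>
    have h : nabla n (v n 1 i) =
        (kappa n 1)⁻¹ ^ 2 * (w n 2 i - kappa n 2 * v n 1 i) := by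
      rw [nabla_apply, v_one, Derivation.leibniz, hμ, totalD_w]
      simp only [smul_eq_mul]
      ring
    have := v_succ_sub_nabla_mem_T 1 i
    rw [h] at this
    exact this
  | succ k ih =>
    set μ := (kappa n 1)⁻¹ with hμ'
    set r := v n (k + 2) i - μ ^ (k + 2) * (w n (k + 2) i - kappa n (k + 2) * v n 1 i) with hr
    have hv : v n (k + 2) i = μ ^ (k + 2) * (w n (k + 2) i - kappa n (k + 2) * v n 1 i) + r := by
      rw [hr]; ring
    have h1 := v_succ_sub_nabla_mem_T (k + 2) i
    -- In the derivative of the leading term only `w (k + 3)` and `κ (k + 3)` have order `k + 3`;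
    -- everything else is collected in the second summand.
    have h2 : nabla n (v n (k + 2) i) =
        μ ^ (k + 3) * (w n (k + 3) i - kappa n (k + 3) * v n 1 i) +
        (μ ^ (k + 3) * (-omega n (w n 1) (w n (k + 2)) * v n 1 i -
          kappa n (k + 2) * totalD n (v n 1 i)) +
        μ * totalD n (μ ^ (k + 2)) * (w n (k + 2) i - kappa n (k + 2) * v n 1 i) +
        nabla n r) := by
      rw [hv, map_add, nabla_apply, ← hμ', Derivation.leibniz, map_sub, Derivation.leibniz,
        totalD_w, totalD_kappa]
      simp only [smul_eq_mul]
      ring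
    have hw : ∀ i, w n (k + 2) i ∈ T n (k + 2) := w_mem_T _
    have h3 : totalD n (v n 1 i) ∈ T n (k + 2) :=
      T_mono (by omega) (totalD_mem_T le_rfl (v_mem_T 1 i))
    have h4 : totalD n (μ ^ (k + 2)) ∈ T n (k + 2) :=
      T_mono (by omega) (totalD_mem_T le_rfl (pow_mem (kappa_one_inv_mem_T 1) _))
    have hμT : μ ∈ T n (k + 2) := kappa_one_inv_mem_T _
    have hκ : kappa n (k + 2) ∈ T n (k + 2) := kappa_mem_T _
    have hv1 : v n 1 i ∈ T n (k + 2) := v_mem_T_of_le (by omega) i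
    have h5 : nabla n r ∈ T n (k + 2) := nabla_mem_T (by omega) ih
    have h6 : omega n (w n 1) (w n (k + 2)) ∈ T n (k + 2) :=
      omega_mem (fun i => T_mono (by omega) (w_mem_T 1 i)) hw
    rw [h2] at h1
    have h7 := add_mem h1 (add_mem (add_mem (mul_mem (pow_mem hμT (k + 3))
      (sub_mem (mul_mem (neg_mem h6) hv1) (mul_mem hκ h3)))
      (mul_mem (mul_mem hμT h4) (sub_mem (hw i) (mul_mem hκ hv1)))) h5)
    convert h7 using 1
    ring

/-- Up to terms of lower order, `ω(v_i, v_k)` is a derivative of `I (i + 1)`. -/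
theorem omega_v_sub_gen_mem_T {i : ℕ} (hi : 1 ≤ i) (j : ℕ) :
    omega n (v n i) (v n (i + 1 + j)) - gen n j (i + 1) ∈ T n (i + j) := by
  induction j with
  | zero => simp [gen, I]
  | succ j ih =>
    have h1 := nabla_mem_T (by omega) ih
    rw [map_sub, derivation_omega] at h1
    have h2 : omega n (fun a => nabla n (v n i a)) (v n (i + 1 + j)) ∈ T n (i + (j + 1)) :=
      omega_mem (fun a => T_mono (by omega) (nabla_mem_T hi (v_mem_T i a)))
        (v_mem_T_of_le (by omega))
    have h3 : omega n (v n i) (fun a => v n (i + 1 + j + 1) a - nabla n (v n (i + 1 + j) a)) ∈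
        T n (i + (j + 1)) :=
      omega_mem (v_mem_T_of_le (by omega))
        fun a => T_mono (by omega) (v_succ_sub_nabla_mem_T (i + 1 + j) a)
    have h4 : omega n (v n i) (v n (i + 1 + (j + 1))) =
        omega n (v n i) (fun a => nabla n (v n (i + 1 + j) a)) +
        omega n (v n i) (fun a => v n (i + 1 + j + 1) a - nabla n (v n (i + 1 + j) a)) := by
      rw [← omega_add_right]
      congr 1
      funext a
      rw [add_sub_cancel]
      rfl
    have h5 : gen n (j + 1) (i + 1) = nabla n (gen n j (i + 1)) := by
      rw [gen, Function.iterate_succ_apply', gen]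
    rw [h4, h5]
    have h6 := add_mem (sub_mem h1 h2) h3
    have e : ∀ a b c d : JetField n, b + c - d = a + b - d - a + c := fun _ _ _ _ => by ring
    rw [e]
    exact h6

/-- The Leibniz rule for `∇ ω(v_i, v_m)`, with `∇ v_i` and `∇ v_m` eliminated by `v_succ`. For `i <
m` the right side involves only pairings among `v 0, …, v m` and one derivative of such a pairing.
-/
theorem omega_v_succ (i m : ℕ) :
    omega n (v n i) (v n (m + 1)) = nabla n (omega n (v n i) (v n m)) -
      (omega n (v n (i + 1)) (v n m) - ∑ l ∈ Finset.range i, (i.choose (l + 1) : JetField n) *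
        omega n (v n 1) (v n (l + 1)) * omega n (v n (i - l)) (v n m)) +
      ∑ l ∈ Finset.range m, (m.choose (l + 1) : JetField n) *
        omega n (v n 1) (v n (l + 1)) * omega n (v n i) (v n (m - l)) := by
  have h : ∑ l ∈ Finset.range i, (i.choose (l + 1) : JetField n) *
        omega n (v n 1) (v n (l + 1)) * omega n (v n (i - l)) (v n m) =
      -∑ l ∈ Finset.range i, (i.choose (l + 1) : JetField n) *
        omega n (v n 1) (v n (l + 1)) * omega n (v n m) (v n (i - l)) := by
    rw [← Finset.sum_neg_distrib]
    exact Finset.sum_congr rfl fun l _ => by rw [omega_swap (v n m)]; ring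
  rw [h, derivation_omega, show v n (m + 1) = fun a => _ from funext (v_succ n m),
    omega_add_right, omega_sum_right, omega_swap (v n (i + 1)),
    show v n (i + 1) = fun a => _ from funext (v_succ n i), omega_add_right, omega_sum_right,
    omega_swap (fun a => nabla n (v n i a))]
  have e : ∀ a b c d : JetField n, a + b = -c + a - (-(c + d) - -d) + b :=
    fun _ _ _ _ => by ring
  exact e _ _ _ _

end SymplecticCurves

namespace SymplecticCurves

variable (n : ℕ) [NeZero n]

/-! ### The normalized frame -/

/-- The `t`-components of the `w k` are not free: they are `t, 1, 0, 0, …`. For the `w k` to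
specialize to the standard basis, in some order, the `t`-direction has to be matched with `w 1`. -/
theorem exists_equiv_Ix : ∃ e : Fin (2 * n) ≃ Ix n,
    ∀ k, e k = Sum.inl 0 ↔ (k : ℕ) = 1 := by
  have h1 : 1 < 2 * n := by have := NeZero.pos n; omega
  let e₀ : Fin (2 * n) ≃ Ix n := Fintype.equivOfCardEq (by simp [two_mul])
  refine ⟨e₀.trans (Equiv.swap (e₀ ⟨1, h1⟩) (Sum.inl 0)), fun k => ?_⟩
  rw [Equiv.trans_apply, ← Equiv.eq_symm_apply, Equiv.symm_swap,
    Equiv.swap_apply_right, e₀.apply_eq_iff_eq, Fin.ext_iff]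

theorem linearIndependent_w : LinearIndependent (JetField n) fun k : Fin (2 * n) => w n k := by
  classical
  obtain ⟨e, he⟩ := exists_equiv_Ix n
  -- A jet at which `w k` is the basis vector with index `e k`, so that the determinant specializes
  -- to `1`.
  let x : JetCoord n → ℝ := fun
    | .t => 0
    | .u i k => if ∃ h : k < 2 * n, e ⟨k, h⟩ = i then 1 else 0
  have hx : ∀ (k : Fin (2 * n)) i, MvPolynomial.eval x (wPoly n k i) = if e k = i then 1 else 0 := by
    rintro ⟨k, hk⟩ i
    by_cases hi : i = Sum.inl 0
    · subst hi
      rcases k with _ | _ | k <;> simp [wPoly, he, x]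
    · simp [wPoly, hi, x, hk]
  let M : Matrix (Ix n) (Ix n) (JetPoly n) := Matrix.of fun a i => wPoly n (e.symm a) i
  have hM : M.det ≠ 0 := by
    intro h
    have h1 : (MvPolynomial.eval x).mapMatrix M = 1 := by
      ext a i
      simp [M, hx, Matrix.one_apply]
    have h2 := congrArg (MvPolynomial.eval x) h
    rw [RingHom.map_det, h1, Matrix.det_one, map_zero] at h2
    exact one_ne_zero h2
  have hM' : ((algebraMap (JetPoly n) (JetField n)).mapMatrix M).det ≠ 0 := by
    rw [← RingHom.map_det]
    simpa using hM
  have h3 := (Matrix.linearIndependent_rows_of_det_ne_zero hM').comp e e.injective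
  have h4 : (fun k : Fin (2 * n) => w n k) =
      (fun i => (algebraMap (JetPoly n) (JetField n)).mapMatrix M i) ∘ e := by
    funext k i
    simp [M, algebraMap_wPoly]
  rw [h4]
  exact h3

theorem linearIndependent_v : LinearIndependent (JetField n) fun k : Fin (2 * n) => v n k := by
  refine linearIndependent_of_top_le_span_of_card_eq_finrank ?_ (by simp [two_mul])
  have h := (linearIndependent_w n).span_eq_top_of_card_eq_finrank (by simp [two_mul])
  rw [← h, Submodule.span_le]
  rintro _ ⟨k, rfl⟩
  have : w n k = ∑ j ∈ Finset.range (k + 1), chainCoeff n (kappa n) k j • v n j := by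
    funext i
    simp [w_eq_chain n k i]
  simp only
  rw [this]
  refine Submodule.sum_mem _ fun j hj => Submodule.smul_mem _ _ (Submodule.subset_span ?_)
  have := Finset.mem_range.1 hj
  exact ⟨⟨j, by omega⟩, rfl⟩

variable {n} in
/-- The coefficients of the linear functional `ω(a, ·)`. -/
noncomputable def dual (a : Ix n → JetField n) : Ix n → JetField n :=
  Sum.elim (fun i => -a (Sum.inr i)) fun i => a (Sum.inl i)

theorem linearIndependent_dual_v {k : ℕ} (hk : k ≤ 2 * n) :
    LinearIndependent (JetField n) fun i : Fin k => dual (v n i) := by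
  have h := (linearIndependent_v n).comp (Fin.castLE hk) (Fin.castLE_injective hk)
  let f : (Ix n → JetField n) →ₗ[JetField n] (Ix n → JetField n) :=
    { toFun := dual
      map_add' := fun a b => by funext i; rcases i with i | i <;> simp [dual]; ring
      map_smul' := fun c a => by funext i; rcases i with i | i <;> simp [dual] }
  refine h.map' f (LinearMap.ker_eq_bot'.2 fun a ha => ?_)
  funext i
  rcases i with i | i
  · simpa [f, dual] using congrFun ha (Sum.inr i)
  · simpa [f, dual] using congrFun ha (Sum.inl i)

/-- For `k ≤ 2n` there are `2n - k` coordinates such that every vector is determined by these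
coordinates and its pairings with `v 0, …, v (k - 1)`. -/
theorem exists_coordinates {k l : ℕ} (hk : k ≤ 2 * n) (hl : k ≤ l + 1) :
    ∃ S : Finset (Ix n), S.card + k = 2 * n ∧
      ∀ (P : Submodule (ratJet n l) (JetField n)) (y : Ix n → JetField n),
        (∀ i < k, omega n (v n i) y ∈ P) → (∀ j ∈ S, y j ∈ P) → ∀ j, y j ∈ P := by
  classical
  obtain ⟨S, hS, h⟩ := (ratJet n l).exists_finset_forall_mem_of_sum_mem
    (linearIndependent_dual_v n hk) (fun a j => by
      have h1 : ∀ i, v n a i ∈ ratJet n l := v_mem_ratJet (by omega)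
      rcases j with j | j
      · exact neg_mem (h1 _)
      · exact h1 _)
  refine ⟨S, by simpa [two_mul] using hS, fun P y hP hy => h P y (fun a => ?_) hy⟩
  rw [dual, ← omega_eq_sum]
  exact hP a a.2

/-! ### The pairings of the vectors of the frame as functions of the generators -/

/-- The field of rational functions of the generators of order at most `m`. -/
noncomputable abbrev genField (m : ℕ) : IntermediateField ℝ (JetField n) :=
  IntermediateField.adjoin ℝ (gensUpTo n m)

variable {n}

theorem genField_mono {k l : ℕ} (h : k ≤ l) : genField n k ≤ genField n l :=
  IntermediateField.adjoin.mono _ _ _ fun _ ⟨i, j, h1, h2, h3, h4⟩ =>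
    ⟨i, j, h1, h2, h3.trans h, h4⟩

theorem gen_mem_genField {i k m : ℕ} (h1 : 2 ≤ k) (h2 : k ≤ 2 * n) (h3 : i + k ≤ m) :
    gen n i k ∈ genField n m :=
  IntermediateField.subset_adjoin _ _ ⟨i, k, h1, h2, h3, rfl⟩

theorem derivation_mem_of_mem_adjoin (D : Derivation ℝ (JetField n) (JetField n))
    {s : Set (JetField n)} {E : IntermediateField ℝ (JetField n)} (hs : s ⊆ E)
    (h : ∀ F ∈ s, D F ∈ E) {F : JetField n} (hF : F ∈ IntermediateField.adjoin ℝ s) :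
    D F ∈ E := by
  have hle : IntermediateField.adjoin ℝ s ≤ E := IntermediateField.adjoin_le_iff.2 hs
  induction hF using IntermediateField.adjoin_induction with
  | mem x hx => exact h x hx
  | algebraMap r => rw [Derivation.map_algebraMap]; exact E.zero_mem
  | add x y _ _ hx hy => rw [map_add]; exact E.add_mem hx hy
  | inv x hx' hx =>
    rw [Derivation.leibniz_inv, smul_eq_mul]
    exact E.mul_mem (E.neg_mem (pow_mem (E.inv_mem (hle hx')) 2)) hx
  | mul x y hx' hy' hx hy =>
    rw [Derivation.leibniz, smul_eq_mul, smul_eq_mul]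
    exact E.add_mem (E.mul_mem (hle hx') hy) (E.mul_mem (hle hy') hx)

theorem nabla_mem_genField {m : ℕ} {F : JetField n} (hF : F ∈ genField n m) :
    nabla n F ∈ genField n (m + 1) := by
  refine derivation_mem_of_mem_adjoin (nabla n)
    ((IntermediateField.subset_adjoin _ _).trans (genField_mono m.le_succ)) ?_ hF
  rintro _ ⟨i, k, h1, h2, h3, rfl⟩
  rw [gen, ← Function.iterate_succ_apply' (nabla n)]
  exact gen_mem_genField (i := i + 1) h1 h2 (by omega)

/-- Induction on the largest index. A pairing of `v (m + 1)` with `v i`, `i < m`, comes from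
`omega_v_succ`; the pairing with `v m` is a generator for `m < 2n`. Beyond that, `v m` is a
combination of the frame whose coefficients solve a linear system with the Gram matrix, so they are
again functions of the generators, and the pairing reduces to the case `i < m`. -/
theorem omega_v_mem_genField {m : ℕ} : ∀ {i j : ℕ}, i ≤ m → j ≤ m →
    omega n (v n i) (v n j) ∈ genField n m := by
  induction m with
  | zero =>
    intro i j hi hj
    rw [Nat.le_zero.1 hi, Nat.le_zero.1 hj, omega_self]
    exact zero_mem _
  | succ m ih =>
    have hle := genField_mono (n := n) m.le_succ
    have h0 : ∀ j, omega n (v n 0) (v n j) ∈ genField n (m + 1) := by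
      intro j
      rcases j with _ | _ | j
      · rw [omega_self]; exact zero_mem _
      · rw [omega_v_zero_v_one]; exact one_mem _
      · rw [omega_v_zero_of_two_le n (by omega)]; exact zero_mem _
    have h1 : ∀ i < m, omega n (v n i) (v n (m + 1)) ∈ genField n (m + 1) := by
      intro i hi
      have hc : ∀ a b c d e, a ≤ m → b ≤ m → c ≤ m → d ≤ m → (Nat.choose e a : JetField n) *
          omega n (v n 1) (v n b) * omega n (v n c) (v n d) ∈ genField n m :=
        fun a b c d e _ hb hc hd =>
          mul_mem (mul_mem (natCast_mem _ _) (ih (by omega) hb)) (ih hc hd)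
      rw [omega_v_succ]
      refine add_mem (sub_mem (nabla_mem_genField (ih hi.le le_rfl)) (hle (sub_mem
        (ih (by omega) le_rfl) (sum_mem fun l hl => ?_)))) (hle (sum_mem fun l hl => ?_))
      all_goals
        have := Finset.mem_range.1 hl
        exact hc _ _ _ _ _ (by omega) (by omega) (by omega) (by omega)
    have h2 : omega n (v n m) (v n (m + 1)) ∈ genField n (m + 1) := by
      rcases Nat.eq_zero_or_pos m with rfl | hm
      · exact h0 _
      rcases Nat.lt_or_ge m (2 * n) with hm2 | hm2
      · exact gen_mem_genField (i := 0) (k := m + 1) (by omega) (by omega) (by omega)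
      · -- `v m` is a combination of the frame
        have hb := linearIndependent_v n
        obtain ⟨c, hc⟩ : ∃ c : Fin (2 * n) → JetField n, ∑ p, c p • v n p = v n m := by
          have h := hb.span_eq_top_of_card_eq_finrank (by simp [two_mul])
          exact (Submodule.mem_span_range_iff_exists_fun _).1 (h ▸ Submodule.mem_top)
        have hc' : v n m = fun i => ∑ p, c p * v n p i := by
          rw [← hc]; funext i; simp
        -- The Gram matrix of the frame is nonsingular: a relation between its rows gives a
        -- functional that vanishes on the frame, hence everywhere.
        have hG : LinearIndependent (JetField n)
            fun q : Fin (2 * n) => fun p : Fin (2 * n) => omega n (v n q) (v n p) := by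
          rw [Fintype.linearIndependent_iff]
          intro g hg q
          refine Fintype.linearIndependent_iff.1 (linearIndependent_dual_v n le_rfl) g ?_ q
          have hz : ∀ p : Fin (2 * n), ∑ j, (∑ q, g q * dual (v n q) j) * v n p j = 0 := by
            intro p
            have := congrFun hg p
            simp only [Finset.sum_apply, Pi.smul_apply, smul_eq_mul, Pi.zero_apply,
              omega_eq_sum, Finset.mul_sum] at this
            rw [Finset.sum_comm] at this
            rw [← this]
            refine Finset.sum_congr rfl fun j _ => ?_
            rw [Finset.sum_mul]
            exact Finset.sum_congr rfl fun q _ => by rw [dual]; ring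
          have hz' : ∀ y : Ix n → JetField n, ∑ j, (∑ q, g q * dual (v n q) j) * y j = 0 := by
            intro y
            obtain ⟨d, hd⟩ : ∃ d : Fin (2 * n) → JetField n, ∑ p, d p • v n p = y := by
              have h := hb.span_eq_top_of_card_eq_finrank (by simp [two_mul])
              exact (Submodule.mem_span_range_iff_exists_fun _).1 (h ▸ Submodule.mem_top)
            rw [← hd]
            simp only [Finset.sum_apply, Pi.smul_apply, smul_eq_mul, Finset.mul_sum]
            rw [Finset.sum_comm]
            refine Finset.sum_eq_zero fun p _ => ?_
            rw [← mul_zero (d p), ← hz p, Finset.mul_sum]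
            exact Finset.sum_congr rfl fun j _ => by ring
          classical
          funext j
          have := hz' (Pi.single j 1)
          simpa [Pi.single_apply] using this
        obtain ⟨S, hS, h⟩ := (genField n m).exists_finset_forall_mem_of_sum_mem hG
          (fun a j => ih (by omega) (by omega))
        -- With `2n` independent equations no coordinates are left to prescribe, so the coefficients
        -- `c` lie in the field of the Gram entries.
        have hS0 : S = ∅ := by simpa using hS
        have hcm : ∀ p, c p ∈ genField n m := by
          have := h (Subalgebra.toSubmodule (⊥ : Subalgebra (genField n m) (JetField n))) c
            (fun a => by
              have h3 : ∑ p : Fin (2 * n), omega n (v n a) (v n p) * c p = omega n (v n a) (v n m) := by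
                rw [hc', omega_sum_right]
                exact Finset.sum_congr rfl fun _ _ => mul_comm _ _
              rw [h3]
              exact ⟨⟨_, ih (by omega) le_rfl⟩, rfl⟩) (by simp [hS0])
          intro p
          obtain ⟨y, hy⟩ := Algebra.mem_bot.1 (this p)
          rw [← hy]
          exact y.2
        rw [omega_swap, hc', omega_sum_right]
        refine neg_mem (sum_mem fun p _ => mul_mem (hle (hcm p)) ?_)
        rw [omega_swap]
        exact neg_mem (h1 p (by omega))
    have h3 : ∀ i ≤ m + 1, omega n (v n i) (v n (m + 1)) ∈ genField n (m + 1) := by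
      intro i hi
      rcases lt_trichotomy i m with h | rfl | h
      · exact h1 i h
      · exact h2
      · rw [show i = m + 1 by omega, omega_self]; exact zero_mem _
    intro i j hi hj
    rcases Nat.lt_or_ge j (m + 1) with hj' | hj'
    · rcases Nat.lt_or_ge i (m + 1) with hi' | hi'
      · exact hle (ih (by omega) (by omega))
      · rw [show i = m + 1 by omega, omega_swap]
        exact neg_mem (h3 j hj)
    · rw [show j = m + 1 by omega]
      exact h3 i hi

end SymplecticCurves

/-! ### Generators of a field of the right number are algebraically independent -/

section TranscendenceDegree

variable {F L : Type} [Field F] [Field L] [Algebra F L]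

theorem IntermediateField.isAlgebraic_of_mem_adjoin {s : Set L} {x : L}
    (hx : x ∈ IntermediateField.adjoin F s) : IsAlgebraic (Algebra.adjoin F s) x := by
  induction hx using IntermediateField.adjoin_induction with
  | mem x hx => exact isAlgebraic_algebraMap (⟨x, Algebra.subset_adjoin hx⟩ : Algebra.adjoin F s)
  | algebraMap r => exact isAlgebraic_algebraMap (algebraMap F (Algebra.adjoin F s) r)
  | add x y _ _ hx hy => exact hx.add hy
  | inv x _ hx => exact hx.inv
  | mul x y _ _ hx hy => exact hx.mul hy

/-- The field generated by `x` has transcendence degree at least `Nat.card κ`, and a generating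
family with no more elements than the transcendence degree is a transcendence basis. -/
theorem AlgebraicIndependent.of_forall_mem_adjoin {ι κ : Type} [Finite ι] [Finite κ] {x : ι → L}
    {y : κ → L} (hy : AlgebraicIndependent F y)
    (h : ∀ k, y k ∈ IntermediateField.adjoin F (Set.range x))
    (hcard : Nat.card ι ≤ Nat.card κ) : AlgebraicIndependent F x := by
  set A := IntermediateField.adjoin F (Set.range x) with hA
  let x' : ι → A := fun i => ⟨x i, IntermediateField.subset_adjoin _ _ ⟨i, rfl⟩⟩
  let y' : κ → A := fun k => ⟨y k, h k⟩
  have hy' : AlgebraicIndependent F y' := AlgebraicIndependent.of_comp A.val hy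
  have halg : Algebra.IsAlgebraic (Algebra.adjoin F (Set.range x')) A := by
    refine ⟨fun a => ?_⟩
    obtain ⟨r, s, hrs⟩ := (IntermediateField.mem_adjoin_range_iff F x a).1 a.2
    have e : ∀ p : MvPolynomial ι F, A.val (MvPolynomial.aeval x' p) = MvPolynomial.aeval x p :=
      fun p => MvPolynomial.comp_aeval_apply x' A.val p
    have ha : a = MvPolynomial.aeval x' r / MvPolynomial.aeval x' s := by
      apply Subtype.val_injective
      rw [hrs, ← e, ← e]
      rfl
    have hm : ∀ p : MvPolynomial ι F, IsAlgebraic (Algebra.adjoin F (Set.range x'))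
        (MvPolynomial.aeval x' p) := fun p => by
      have : MvPolynomial.aeval x' p ∈ Algebra.adjoin F (Set.range x') := by
        rw [Algebra.adjoin_range_eq_range_aeval]
        exact ⟨p, rfl⟩
      exact isAlgebraic_algebraMap (⟨_, this⟩ : Algebra.adjoin F (Set.range x'))
    rw [ha, div_eq_mul_inv]
    exact (hm r).mul (hm s).inv
  have hle : Cardinal.mk ι ≤ Algebra.trdeg F A := by
    refine le_trans ?_ hy'.cardinalMk_le_trdeg
    rw [← Nat.cast_card, ← Nat.cast_card]
    exact_mod_cast hcard
  have := (Algebra.IsAlgebraic.isTranscendenceBasis_of_le_trdeg_of_finite F x' hle).1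
  exact this.map' (f := A.val) A.val.injective

end TranscendenceDegree

namespace SymplecticCurves

variable (n : ℕ) [NeZero n]

/-! ### A transcendence basis consisting of the generators and coordinates of the frame -/

/-- Only the first `2n` vectors are independent, whence the condition `i < 2 * n`. For `k ≥ 2n` the
truncated difference `2 * n - k` is zero and no coordinates are needed; for `k = 0` there are no
pairings and all coordinates are taken. -/
theorem exists_coordSet (k : ℕ) : ∃ S : Finset (Ix n), S.card = 2 * n - k ∧
    ∀ (P : Submodule (ratJet n (k - 1)) (JetField n)) (y : Ix n → JetField n),
      (∀ i < k, i < 2 * n → omega n (v n i) y ∈ P) → (∀ j ∈ S, y j ∈ P) → ∀ j, y j ∈ P := by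
  rcases Nat.lt_or_ge k (2 * n) with hk | hk
  · obtain ⟨S, hS, h⟩ := exists_coordinates n (l := k - 1) hk.le (by omega)
    exact ⟨S, by omega, fun P y h1 h2 => h P y (fun i hi => h1 i hi (hi.trans hk)) h2⟩
  · obtain ⟨S, hS, h⟩ := exists_coordinates n (l := k - 1) (le_refl (2 * n)) (by omega)
    exact ⟨S, by omega, fun P y h1 h2 => h P y (fun i hi => h1 i (hi.trans_le hk) hi) h2⟩

/-- Coordinates that complete the pairings with `v 0, …, v (k - 1)` to a coordinate system. -/
noncomputable def coordSet (k : ℕ) : Finset (Ix n) := (exists_coordSet n k).choose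

theorem card_coordSet (k : ℕ) : (coordSet n k).card = 2 * n - k :=
  (exists_coordSet n k).choose_spec.1

variable {n} in
theorem mem_of_mem_coordSet {k : ℕ} (P : Submodule (ratJet n (k - 1)) (JetField n))
    (y : Ix n → JetField n) (h1 : ∀ i < k, i < 2 * n → omega n (v n i) y ∈ P)
    (h2 : ∀ j ∈ coordSet n k, y j ∈ P) (j : Ix n) : y j ∈ P :=
  (exists_coordSet n k).choose_spec.2 P y h1 h2 j

/-- The indices of the generators. -/
abbrev GenIx := ℕ × Set.Icc 2 (2 * n)

/-- The indices of the remaining elements of the transcendence basis. -/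
abbrev FrameIx := Σ k : Fin (2 * n), coordSet n k

/-- The generators. -/
noncomputable def genFun (a : GenIx n) : JetField n := gen n a.1 (a.2 : ℕ)

/-- The chosen coordinates of the frame. -/
noncomputable def frameFun (b : FrameIx n) : JetField n := v n b.1 b.2

/-- The generators and the chosen coordinates of the frame. -/
noncomputable def Z : GenIx n ⊕ FrameIx n → JetField n := Sum.elim (genFun n) (frameFun n)

/-- The orders of the functions `Z`. -/
def zOrder : GenIx n ⊕ FrameIx n → ℕ := Sum.elim (fun a => a.1 + (a.2 : ℕ)) fun b => b.1

variable {n}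

theorem gen_mem_T {k : ℕ} (hk : 1 ≤ k) (j : ℕ) : gen n j k ∈ T n (j + k) := by
  induction j with
  | zero =>
    rw [zero_add]
    exact omega_v_mem_T (by omega) le_rfl
  | succ j ih =>
    rw [gen, Function.iterate_succ_apply', show j + 1 + k = j + k + 1 by omega]
    exact nabla_mem_T (by omega) ih

theorem Z_mem_ratJet (a : GenIx n ⊕ FrameIx n) : Z n a ∈ ratJet n (zOrder n a) := by
  rcases a with ⟨j, k, hk⟩ | ⟨k, i⟩
  · have := (Set.mem_Icc.1 hk).1
    exact T_le_ratJet (show 1 ≤ j + k by omega) (gen_mem_T (by omega) j)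
  · exact v_mem_ratJet le_rfl _

theorem T_le_of_coord_mem {S : Subalgebra ℝ (JetField n)} {k : ℕ} (h0 : (kappa n 1)⁻¹ ∈ S)
    (h : ∀ a : JetCoord n, a.order ≤ k → coord n a ∈ S) : T n k ≤ S := by
  refine Algebra.adjoin_le ?_
  rintro _ (⟨a, ha, rfl⟩ | rfl)
  · exact h a ha
  · exact h0

theorem coord_mem_of_w_mem {S : Subalgebra ℝ (JetField n)} {k : ℕ} (h : ∀ i, w n k i ∈ S)
    {a : JetCoord n} (ha : a.order = k) : coord n a ∈ S := by
  cases a with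
  | t =>
    obtain rfl : k = 0 := ha.symm
    simpa [w] using h (Sum.inl 0)
  | u i j =>
    obtain rfl : j = k := ha
    simpa [w, i.2] using h i

/-- Inverts the leading term formula `v_sub_mem_T`, in which the components of `w (k + 2)` appear
mixed with `κ (k + 2)`. -/
theorem w_mem_of_v_mem {S : Subalgebra ℝ (JetField n)} {k : ℕ} (hT : T n (k + 1) ≤ S)
    (h : ∀ i, v n (k + 2) i ∈ S) (i : Ix n) : w n (k + 2) i ∈ S := by
  have hκ : kappa n 1 ∈ S := hT (T_mono (by omega) (kappa_mem_T 1))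
  have hκ0 := kappa_one_ne_zero n
  have h1 : ∀ i, (w n (k + 2) i - kappa n (k + 2) * v n 1 i) ∈ S := by
    intro i
    have h2 := mul_mem (pow_mem hκ (k + 2)) (sub_mem (h i) (hT (v_sub_mem_T k i)))
    rwa [sub_sub_cancel, inv_pow, mul_inv_cancel_left₀ (pow_ne_zero _ hκ0)] at h2
  -- In the `t`-component `w (k + 2)` vanishes and `v 1` is `κ₁⁻¹`, which isolates `κ (k + 2)`.
  have h3 : kappa n (k + 2) ∈ S := by
    have h2 := mul_mem (neg_mem hκ) (h1 (Sum.inl 0))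
    have h4 : w n (k + 2) (Sum.inl 0) = 0 := by simp [w]
    have h5 : v n 1 (Sum.inl 0) = (kappa n 1)⁻¹ := by rw [v_one]; simp [w]
    have e : -kappa n 1 * (0 - kappa n (k + 2) * (kappa n 1)⁻¹) = kappa n (k + 2) := by
      field_simp
      simp
    rwa [h4, h5, e] at h2
  have := add_mem (h1 i) (mul_mem h3 (hT (v_mem_T_of_le (show 1 ≤ k + 1 by omega) i)))
  rwa [sub_add_cancel] at this

/-- The pairings of order `k` lie in every algebra containing the generators of order `k` and the
functions of lower order. -/
theorem omega_v_mem_of_gen_mem {S : Subalgebra ℝ (JetField n)} {i k : ℕ} (hi : i < k)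
    (hin : i < 2 * n) (hT : 2 ≤ k → T n (k - 1) ≤ S)
    (hS : ∀ j l, 2 ≤ l → l ≤ 2 * n → j + l = k → gen n j l ∈ S) :
    omega n (v n i) (v n k) ∈ S := by
  rcases Nat.eq_zero_or_pos i with rfl | hi0
  · obtain _ | _ | k := k
    · omega
    · rw [omega_v_zero_v_one]; exact one_mem _
    · rw [omega_v_zero_of_two_le n (by omega)]; exact zero_mem _
  · obtain ⟨j, rfl⟩ : ∃ j, k = i + 1 + j := ⟨k - (i + 1), by omega⟩
    have h1 : omega n (v n i) (v n (i + 1 + j)) - gen n j (i + 1) ∈ S := by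
      refine hT (by omega) ?_
      rw [show i + 1 + j - 1 = i + j by omega]
      exact omega_v_sub_gen_mem_T hi0 j
    rcases Nat.lt_or_ge (i + 1) (2 * n + 1) with h2 | h2
    · have := add_mem h1 (hS j (i + 1) (by omega) (by omega) (by omega))
      rwa [sub_add_cancel] at this
    · omega

/-- The jet of order `m` is determined by the vectors `v 0, …, v m`. -/
theorem ratJet_le_of_v_mem {E : IntermediateField ℝ (JetField n)} {m : ℕ}
    (hv : ∀ k ≤ m, ∀ i, v n k i ∈ E) : ratJet n m ≤ E := by
  have hw : ∀ k ≤ m, ∀ i, w n k i ∈ E := by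
    intro k
    induction k using Nat.strong_induction_on with
    | _ k ih =>
      intro hk
      have hκ : 1 ≤ m → (kappa n 1)⁻¹ ∈ E := fun hm => by
        have h5 : v n 1 (Sum.inl 0) = (kappa n 1)⁻¹ := by rw [v_one]; simp [w]
        exact h5 ▸ hv 1 hm _
      obtain _ | _ | k := k
      · simpa [v_zero] using hv 0 hk
      · intro i
        rw [w_one, ← inv_inv (kappa n 1)]
        exact E.mul_mem (E.inv_mem (hκ hk)) (hv 1 hk i)
      · exact w_mem_of_v_mem (S := E.toSubalgebra) (T_le_of_coord_mem (hκ (by omega)) fun a ha =>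
          coord_mem_of_w_mem (S := E.toSubalgebra) (ih _ (by omega) (by omega)) rfl) (hv _ hk)
  refine IntermediateField.adjoin_le_iff.2 ?_
  rintro _ ⟨a, ha, rfl⟩
  exact coord_mem_of_w_mem (S := E.toSubalgebra) (hw _ ha) rfl

/-- Modulo lower order the generators of order `m` are the nonconstant pairings of `v m` with the
preceding frame vectors; with the components in `coordSet n m` they determine `v m`, and the `v k`,
`k ≤ m`, determine the jet. -/
theorem ratJet_le_adjoin_Z (m : ℕ) :
    ratJet n m ≤ IntermediateField.adjoin ℝ (Z n '' {a | zOrder n a ≤ m}) := by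
  induction m using Nat.strong_induction_on with
  | _ m ih =>
    set E := IntermediateField.adjoin ℝ (Z n '' {a | zOrder n a ≤ m}) with hE
    have hlt : ∀ k < m, ratJet n k ≤ E := fun k hk => (ih k hk).trans
      (IntermediateField.adjoin.mono _ _ _ (Set.image_mono fun a ha => le_trans ha hk.le))
    have hgen : ∀ j l, 2 ≤ l → l ≤ 2 * n → j + l = m → gen n j l ∈ E.toSubalgebra :=
      fun j l h1 h2 h3 => IntermediateField.subset_adjoin _ _
        ⟨Sum.inl (j, ⟨l, h1, h2⟩), h3.le, rfl⟩
    have hS : ∀ i ∈ coordSet n m, v n m i ∈ E := by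
      intro i hi
      have hm : m < 2 * n := by
        have := card_coordSet n m
        have := Finset.card_pos.2 ⟨i, hi⟩
        omega
      exact IntermediateField.subset_adjoin _ _ 
        ⟨Sum.inr ⟨⟨m, hm⟩, ⟨i, hi⟩⟩, le_refl m, rfl⟩
    have hv : ∀ i, v n m i ∈ E := by
      rcases Nat.eq_zero_or_pos m with rfl | hm
      · have : coordSet n 0 = Finset.univ := by
          rw [← Finset.card_eq_iff_eq_univ, card_coordSet]
          simp [two_mul]
        exact fun i => hS i (this ▸ Finset.mem_univ i)
      · let P : Submodule (ratJet n (m - 1)) (JetField n) :=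
          { carrier := E
            add_mem' := E.add_mem
            zero_mem' := E.zero_mem
            smul_mem' := fun c x hx => E.mul_mem (hlt _ (by omega) c.2) hx }
        refine mem_of_mem_coordSet P _ (fun i hi hin => ?_) hS
        exact omega_v_mem_of_gen_mem (S := E.toSubalgebra) hi hin
          (fun hm2 => (T_le_ratJet (by omega)).trans (hlt _ (by omega))) hgen
    refine ratJet_le_of_v_mem fun k hk i => ?_
    rcases Nat.lt_or_ge k m with h | h
    · exact hlt k h (v_mem_ratJet le_rfl i)
    · obtain rfl : k = m := le_antisymm hk h
      exact hv i

theorem ratJet_eq_adjoin_Z (m : ℕ) :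
    ratJet n m = IntermediateField.adjoin ℝ (Z n '' {a | zOrder n a ≤ m}) := by
  refine le_antisymm (ratJet_le_adjoin_Z m) (IntermediateField.adjoin_le_iff.2 ?_)
  rintro _ ⟨a, ha, rfl⟩
  exact ratJet_mono ha (Z_mem_ratJet a)

variable (n) in
theorem algebraicIndependent_coord : AlgebraicIndependent ℝ (coord n) := by
  have h : AlgebraicIndependent ℝ (MvPolynomial.X : JetCoord n → JetPoly n) :=
    MvPolynomial.algebraicIndependent_X _ _
  exact h.map' (f := IsScalarTower.toAlgHom ℝ (JetPoly n) (JetField n))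
    (algebraMap_jetPoly_injective n)

/-- Bounds the number of functions `Z` of order at most `M`. The index `k` on the right stands for
the generators `∇ʲ I_{k+2}`, and `j < M - 1 - k` says `j + (k + 2) ≤ M`. -/
theorem exists_injective_zIndex (M : ℕ) :
    ∃ f : {a : GenIx n ⊕ FrameIx n // zOrder n a ≤ M} →
      (Σ k : Fin (2 * n - 1), Fin (M - 1 - k)) ⊕ FrameIx n, Function.Injective f := by
  refine ⟨fun a => match a with
    | ⟨Sum.inl (j, k), h⟩ => Sum.inl ⟨⟨k - 2, by have := k.2.1; have := k.2.2; omega⟩, ⟨j, by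
        have := k.2.1; have : j + (k : ℕ) ≤ M := h; simp only; omega⟩⟩
    | ⟨Sum.inr b, _⟩ => Sum.inr b, ?_⟩
  rintro ⟨⟨j, k, hk⟩ | b, h⟩ ⟨⟨j', k', hk'⟩ | b', h'⟩ e
  · simp only [Sum.inl.injEq, Sigma.mk.injEq, Fin.mk.injEq] at e
    obtain ⟨e1, e2⟩ := e
    obtain rfl : k = k' := by
      have := hk.1
      have := hk'.1
      omega
    simp at e2
    simp [e2]
  · simp at e
  · simp at e
  · simpa using e

variable (n) in
-- A finite subfamily has order at most some `M ≥ 2n`. The functions `Z` up to order `M` generate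
-- the field of `M`-jets, and they are at most `(2n - 1)(M + 1) + 1` in number, as many as the jet
-- coordinates.
theorem algebraicIndependent_Z : AlgebraicIndependent ℝ (Z n) := by
  refine algebraicIndependent_of_finite_type fun t ht => ?_
  obtain ⟨M, hM⟩ : ∃ M, 2 * n ≤ M ∧ ∀ a ∈ t, zOrder n a ≤ M := by
    obtain ⟨M, hM⟩ := (ht.image (zOrder n)).bddAbove
    exact ⟨max M (2 * n), le_max_right _ _, fun a ha =>
      (hM ⟨a, ha, rfl⟩).trans (le_max_left _ _)⟩
  obtain ⟨f, hf⟩ := exists_injective_zIndex (n := n) M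
  have := Finite.of_injective f hf
  let g : Option ({i : Ix n // i ≠ Sum.inl 0} × Fin (M + 1)) → JetCoord n := fun
    | none => .t
    | some (i, k) => .u i k
  have hg : Function.Injective g := by
    rintro (_ | ⟨i, k⟩) (_ | ⟨i', k'⟩) h
    · rfl
    · simp [g] at h
    · simp [g] at h
    · simpa [g, Fin.ext_iff] using h
  have hcard : Nat.card {a : GenIx n ⊕ FrameIx n // zOrder n a ≤ M} ≤
      Nat.card (Option ({i : Ix n // i ≠ Sum.inl 0} × Fin (M + 1))) := by
    refine (Nat.card_le_card_of_injective f hf).trans (le_of_eq ?_)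
    have h1 : ∀ k, Fintype.card (coordSet n k) = 2 * n - k := fun k => by
      rw [Fintype.card_coe, card_coordSet]
    obtain ⟨N, hN⟩ : ∃ N, 2 * n = N + 1 := ⟨2 * n - 1, by have := NeZero.pos n; omega⟩
    have hI : Fintype.card {i : Ix n // i ≠ Sum.inl 0} = N := by
      rw [Fintype.card_subtype_compl]
      simp
      omega
    simp only [Nat.card_eq_fintype_card, Fintype.card_sum, Fintype.card_sigma, Fintype.card_fin,
      Fintype.card_option, Fintype.card_prod, hI, h1]
    -- With `2n = N + 1`, reversing the second sum pairs `M - 1 - k` with `k + 2`: each of the `N`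
    -- pairs contributes `M + 1`, and the term `k = N` contributes the remaining `1`.
    rw [Fin.sum_univ_eq_sum_range (fun k => M - 1 - k), Fin.sum_univ_eq_sum_range
      (fun k => 2 * n - k), hN, Nat.add_sub_cancel, Finset.sum_range_succ, ← add_assoc,
      ← Finset.sum_range_reflect (fun k => N + 1 - k), ← Finset.sum_add_distrib,
      Finset.sum_congr rfl (g := fun _ => M + 1)]
    · simp
    · intro k hk
      have := Finset.mem_range.1 hk
      omega
  have h := AlgebraicIndependent.of_forall_mem_adjoin
    (x := fun a : {a : GenIx n ⊕ FrameIx n // zOrder n a ≤ M} => Z n a)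
    ((algebraicIndependent_coord n).comp g hg) (fun k => ?_) hcard
  · exact h.comp (fun i : t => ⟨i, hM.2 i i.2⟩) fun i j h => by simpa [Subtype.ext_iff] using h
  · have h1 : coord n (g k) ∈ ratJet n M := coord_mem_ratJet (by
      rcases k with _ | ⟨i, k⟩
      · exact Nat.zero_le _
      · exact Nat.lt_succ_iff.1 k.2)
    rw [ratJet_eq_adjoin_Z, Set.image_eq_range] at h1
    exact h1

theorem algebraicIndependent_gen : AlgebraicIndependent ℝ (fun a : ℕ × Set.Icc 2 (2 * n) =>
    gen n a.1 (a.2 : ℕ)) :=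
  (algebraicIndependent_Z n).comp Sum.inl Sum.inl_injective

/-- If `I k` had lower order it would be algebraic over the functions `Z` of lower order, to which
it does not belong; this contradicts independence. -/
theorem hasOrder_I {k : ℕ} (h1 : 2 ≤ k) (h2 : k ≤ 2 * n) : HasOrder n (I n k) k := by
  refine ⟨T_le_ratJet (by omega) (omega_v_mem_T (by omega) le_rfl), fun l hl h => ?_⟩
  rw [ratJet_eq_adjoin_Z] at h
  have h3 := IntermediateField.isAlgebraic_of_mem_adjoin h
  refine (algebraicIndependent_Z n).transcendental_adjoin (s := {a | zOrder n a ≤ l})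
    (i := Sum.inl (0, ⟨k, h1, h2⟩)) ?_ h3
  simp [zOrder, hl]

/-- For `l ≥ 2n - 1` the whole frame lives on `l`-jets, so a vector is a combination of its `2n`
pairings with the frame, with coefficients rational on `l`-jets. This is the source of the bound on
`l`. -/
theorem v_mem_of_omega_mem {S : Subalgebra ℝ (JetField n)} {l : ℕ} (hl : 2 * n - 1 ≤ l)
    (hS : ∀ F ∈ ratJet n l, F ∈ S) {y : Ix n → JetField n}
    (h : ∀ i < 2 * n, omega n (v n i) y ∈ S) (j : Ix n) : y j ∈ S := by
  obtain ⟨S', hS', h'⟩ := exists_coordinates n (l := l) (le_refl (2 * n)) (by omega)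
  have hS0 : S' = ∅ := by
    rw [← Finset.card_eq_zero]
    omega
  let P : Submodule (ratJet n l) (JetField n) :=
    { carrier := S
      add_mem' := S.add_mem
      zero_mem' := S.zero_mem
      smul_mem' := fun c x hx => S.mul_mem (hS _ c.2) hx }
  exact h' P y h (by simp [hS0]) j

/-- Above order `l`, generators give the pairings of `v k` with the frame, hence `v k` and `w k`, by
polynomial operations over the field of `l`-jets; the only denominators needed are functions on
`l`-jets. -/
theorem coord_mem_of_gens_subset {S : Subalgebra ℝ (JetField n)} {l : ℕ} (hl : 2 * n - 1 ≤ l)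
    (hS : ∀ F ∈ ratJet n l, F ∈ S) (hg : gens n ⊆ S) (a : JetCoord n) : coord n a ∈ S := by
  have hn := NeZero.pos n
  obtain ⟨k, hk⟩ : ∃ k, a.order = k := ⟨_, rfl⟩
  induction k using Nat.strong_induction_on generalizing a with
  | _ k ih =>
    rcases Nat.lt_or_ge l k with hlk | hlk
    · have hT : T n (k - 1) ≤ S :=
        T_le_of_coord_mem (hS _ ((ratJet n l).inv_mem
          (ratJet_mono (by omega) (kappa_mem_ratJet 1)))) fun a ha => ih _ (by omega) a rfl
      obtain ⟨k, rfl⟩ : ∃ k', k = k' + 2 := ⟨k - 2, by omega⟩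
      refine coord_mem_of_w_mem (w_mem_of_v_mem hT (v_mem_of_omega_mem hl hS fun i hi => ?_)) hk
      exact omega_v_mem_of_gen_mem (by omega) hi (fun _ => hT)
        fun j m h1 h2 _ => hg ⟨j, m, h1, h2, rfl⟩
    · exact hS _ (coord_mem_ratJet (hk.trans_le hlk))

/-- Functions polynomial in jets of order greater than `l` are polynomials in the generators, with
coefficients on the space of `l`-jets. -/
theorem polyAbove_le_adjoin_gens {l : ℕ} (hl : 2 * n - 1 ≤ l) :
    polyAbove n l ≤ Algebra.adjoin (ratJet n l) (gens n) := by
  refine Algebra.adjoin_le ?_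
  rintro _ ⟨a, rfl⟩
  exact coord_mem_of_gens_subset
    (S := (Algebra.adjoin (ratJet n l) (gens n)).restrictScalars ℝ) hl
    (fun F hF => (Algebra.adjoin (ratJet n l) (gens n)).algebraMap_mem ⟨F, hF⟩)
    Algebra.subset_adjoin a

end SymplecticCurves

/-! ### Values of rational functions at real points -/

section Value

open MvPolynomial

variable {L : Type*} [Field L] [Algebra ℝ L] {ι : Type*}

/-- The value at `z` of `F`, a rational function of the variables `Z`, is defined and equal
to `r`. -/
def IsValue (Z : ι → L) (z : ι → ℝ) (F : L) (r : ℝ) : Prop :=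
  ∃ P Q : MvPolynomial ι ℝ, eval z Q ≠ 0 ∧ F * aeval Z Q = aeval Z P ∧ r * eval z Q = eval z P

namespace IsValue

variable {Z : ι → L} {z : ι → ℝ} {F G : L} {r s : ℝ}

theorem aeval_self (Z : ι → L) (z : ι → ℝ) (P : MvPolynomial ι ℝ) :
    IsValue Z z (aeval Z P) (eval z P) := ⟨P, 1, by simp, by simp, by simp⟩

theorem var (Z : ι → L) (z : ι → ℝ) (i : ι) : IsValue Z z (Z i) (z i) := by
  simpa using aeval_self Z z (X i)

theorem const (Z : ι → L) (z : ι → ℝ) (c : ℝ) : IsValue Z z (algebraMap ℝ L c) c := by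
  simpa using aeval_self Z z (C c)

theorem add (hF : IsValue Z z F r) (hG : IsValue Z z G s) : IsValue Z z (F + G) (r + s) := by
  obtain ⟨P, Q, h1, h2, h3⟩ := hF
  obtain ⟨P', Q', h1', h2', h3'⟩ := hG
  refine ⟨P * Q' + P' * Q, Q * Q', ?_, ?_, ?_⟩
  · simpa using ⟨h1, h1'⟩
  · simp only [map_add, map_mul]
    linear_combination aeval Z Q' * h2 + aeval Z Q * h2'
  · simp only [map_add, map_mul]
    linear_combination eval z Q' * h3 + eval z Q * h3'

theorem mul (hF : IsValue Z z F r) (hG : IsValue Z z G s) : IsValue Z z (F * G) (r * s) := by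
  obtain ⟨P, Q, h1, h2, h3⟩ := hF
  obtain ⟨P', Q', h1', h2', h3'⟩ := hG
  refine ⟨P * P', Q * Q', ?_, ?_, ?_⟩
  · simpa using ⟨h1, h1'⟩
  · simp only [map_mul]
    rw [← h2, ← h2']
    ring
  · simp only [map_mul]
    rw [← h3, ← h3']
    ring

theorem neg (hF : IsValue Z z F r) : IsValue Z z (-F) (-r) := by
  simpa using (const Z z (-1)).mul hF

theorem sub (hF : IsValue Z z F r) (hG : IsValue Z z G s) : IsValue Z z (F - G) (r - s) := by
  simpa [sub_eq_add_neg] using hF.add hG.neg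

theorem sum {κ : Type*} (t : Finset κ) {f : κ → L} {x : κ → ℝ}
    (h : ∀ k ∈ t, IsValue Z z (f k) (x k)) : IsValue Z z (∑ k ∈ t, f k) (∑ k ∈ t, x k) := by
  classical
  induction t using Finset.induction_on with
  | empty => simpa using const Z z 0
  | insert a t ha ih =>
    rw [Finset.sum_insert ha, Finset.sum_insert ha]
    exact (h a (by simp)).add (ih fun k hk => h k (by simp [hk]))

theorem aeval_of_forall {κ : Type*} {f : κ → L} {x : κ → ℝ} (h : ∀ k, IsValue Z z (f k) (x k))
    (p : MvPolynomial κ ℝ) : IsValue Z z (aeval f p) (eval x p) := by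
  induction p using MvPolynomial.induction_on with
  | C a => simpa using const Z z a
  | add p q hp hq => simpa using hp.add hq
  | mul_X p i hp => simpa using hp.mul (h i)

theorem aeval_of_vars {κ : Type*} {f : κ → L} {x : κ → ℝ} (p : MvPolynomial κ ℝ)
    (h : ∀ k ∈ p.vars, IsValue Z z (f k) (x k)) : IsValue Z z (aeval f p) (eval x p) := by
  classical
  have h1 : aeval f p = aeval (fun k => if k ∈ p.vars then f k else 0) p :=
    eval₂Hom_congr' rfl (fun i hi _ => by simp [hi]) rfl
  have h2 : eval x p = eval (fun k => if k ∈ p.vars then x k else 0) p :=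
    eval₂Hom_congr' rfl (fun i hi _ => by simp [hi]) rfl
  rw [h1, h2]
  refine aeval_of_forall (fun k => ?_) p
  split_ifs with hk
  · exact h k hk
  · simpa using const Z z 0

/-- A nonzero value makes the numerator a nonzero polynomial; independence is what turns this into a
nonzero element of `L`. -/
theorem inv (hZ : AlgebraicIndependent ℝ Z) (hF : IsValue Z z F r) (hr : r ≠ 0) :
    IsValue Z z F⁻¹ r⁻¹ := by
  obtain ⟨P, Q, h1, h2, h3⟩ := hF
  have hP : eval z P ≠ 0 := h3 ▸ mul_ne_zero hr h1
  have hP' : aeval Z P ≠ 0 := fun h => hP (by rw [hZ.eq_zero_of_aeval_eq_zero P h, map_zero])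
  have hF0 : F ≠ 0 := by
    rintro rfl
    exact hP' (by rw [← h2, zero_mul])
  exact ⟨Q, P, hP, by rw [← h2, inv_mul_cancel_left₀ hF0], by rw [← h3, inv_mul_cancel_left₀ hr]⟩

theorem div (hZ : AlgebraicIndependent ℝ Z) (hF : IsValue Z z F r) (hG : IsValue Z z G s)
    (hs : s ≠ 0) : IsValue Z z (F / G) (r / s) := by
  rw [div_eq_mul_inv, div_eq_mul_inv]
  exact hF.mul (hG.inv hZ hs)

/-- By independence two fractions representing `F` cross-multiply to an identity of polynomials,
which can be evaluated at `z`. -/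
theorem unique (hZ : AlgebraicIndependent ℝ Z) (hF : IsValue Z z F r) (hG : IsValue Z z F s) :
    r = s := by
  obtain ⟨P, Q, h1, h2, h3⟩ := hF
  obtain ⟨P', Q', h1', h2', h3'⟩ := hG
  have h : P * Q' = P' * Q := by
    apply hZ
    simp only [map_mul]
    rw [← h2, ← h2']
    ring
  have h4 := congrArg (eval z) h
  simp only [map_mul] at h4
  rw [← h3, ← h3'] at h4
  exact mul_right_cancel₀ (mul_ne_zero h1 h1') (by linear_combination h4)

theorem of_comp {κ : Type*} {e : κ → ι} (hF : IsValue (Z ∘ e) (z ∘ e) F r) : IsValue Z z F r := by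
  obtain ⟨P, Q, h1, h2, h3⟩ := hF
  refine ⟨rename e P, rename e Q, ?_, ?_, ?_⟩
  · rwa [eval_rename]
  · rwa [aeval_rename, aeval_rename]
  · rwa [eval_rename, eval_rename]

theorem exists_of_mem_adjoin {Z : ι → L} (hZ : AlgebraicIndependent ℝ Z) {F : L}
    (hF : F ∈ IntermediateField.adjoin ℝ (Set.range Z)) :
    ∃ h : MvPolynomial ι ℝ, h ≠ 0 ∧ ∀ z, eval z h ≠ 0 → ∃ r, IsValue Z z F r ∧ (F ≠ 0 → r ≠ 0) := by
  by_cases hF0 : F = 0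
  · exact ⟨1, one_ne_zero, fun z _ => ⟨0, by simpa [hF0] using const Z z 0, fun h => absurd hF0 h⟩⟩
  obtain ⟨P, Q, rfl⟩ := (IntermediateField.mem_adjoin_range_iff ℝ Z F).1 hF
  obtain ⟨h1, h2⟩ := div_ne_zero_iff.1 hF0
  refine ⟨P * Q, mul_ne_zero (fun h => h1 (by simp [h])) (fun h => h2 (by simp [h])),
    fun z hz => ?_⟩
  rw [map_mul] at hz
  have hP := left_ne_zero_of_mul hz
  have hQ := right_ne_zero_of_mul hz
  exact ⟨_, (aeval_self Z z P).div hZ (aeval_self Z z Q) hQ, fun _ => div_ne_zero hP hQ⟩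

/-- At a generic point, finitely many rational functions are defined, and vanish only if they are
identically zero. -/
theorem exists_of_subset_adjoin {Z : ι → L} (hZ : AlgebraicIndependent ℝ Z) {s : Set L}
    (hs : s.Finite) (hF : ∀ F ∈ s, F ∈ IntermediateField.adjoin ℝ (Set.range Z)) :
    ∃ h : MvPolynomial ι ℝ, h ≠ 0 ∧ ∀ z, eval z h ≠ 0 → ∀ F ∈ s, ∃ r, IsValue Z z F r ∧
      (F ≠ 0 → r ≠ 0) := by
  induction s, hs using Set.Finite.induction_on with
  | empty => exact ⟨1, one_ne_zero, by simp⟩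
  | @insert a s _ _ ih =>
    obtain ⟨h, h0, h1⟩ := ih fun F hFs => hF F (Or.inr hFs)
    obtain ⟨g, g0, g1⟩ := exists_of_mem_adjoin hZ (hF a (Or.inl rfl))
    refine ⟨g * h, mul_ne_zero g0 h0, fun z hz F hFs => ?_⟩
    rw [map_mul] at hz
    rcases hFs with rfl | hFs
    · exact g1 z (left_ne_zero_of_mul hz)
    · exact h1 z (right_ne_zero_of_mul hz) F hFs

end IsValue

end Value

/-! ### Values at jets and in another coordinate system. -/

namespace SymplecticCurves

variable {n : ℕ} [NeZero n]

theorem aeval_coord (p : JetPoly n) :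
    MvPolynomial.aeval (coord n) p = algebraMap (JetPoly n) (JetField n) p := by
  have h := MvPolynomial.comp_aeval_apply (R := ℝ) (MvPolynomial.X : JetCoord n → JetPoly n)
    (IsScalarTower.toAlgHom ℝ (JetPoly n) (JetField n)) p
  rw [MvPolynomial.aeval_X_left_apply] at h
  exact h.symm

theorem isValue_algebraMap (x : JetCoord n → ℝ) (p : JetPoly n) :
    IsValue (coord n) x (algebraMap _ _ p) (MvPolynomial.eval x p) := by
  rw [← aeval_coord]
  exact IsValue.aeval_self _ _ _

theorem isValue_div {x : JetCoord n → ℝ} {p q : JetPoly n} (hq : MvPolynomial.eval x q ≠ 0) :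
    IsValue (coord n) x (algebraMap _ _ p / algebraMap _ _ q)
      (MvPolynomial.eval x p / MvPolynomial.eval x q) :=
  (isValue_algebraMap x p).div (algebraicIndependent_coord n) (isValue_algebraMap x q) hq

theorem isValue_omega {ι : Type*} {Z : ι → JetField n} {z : ι → ℝ} {a b : Ix n → JetField n}
    {r s : Ix n → ℝ} (ha : ∀ i, IsValue Z z (a i) (r i)) (hb : ∀ i, IsValue Z z (b i) (s i)) :
    IsValue Z z (omega n a b)
      (∑ i : Fin n, (r (Sum.inl i) * s (Sum.inr i) - r (Sum.inr i) * s (Sum.inl i))) :=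
  IsValue.sum _ fun _ _ => ((ha _).mul (hb _)).sub ((ha _).mul (hb _))

/-- The functions with the same value at a jet and at a point in another coordinate system. -/
def commonValues {ι : Type*} (Z : ι → JetField n) (z : ι → ℝ) (x : JetCoord n → ℝ) :
    Subalgebra ℝ (JetField n) where
  carrier := {F | ∃ r, IsValue (coord n) x F r ∧ IsValue Z z F r}
  add_mem' := fun ⟨_, h1, h2⟩ ⟨_, h3, h4⟩ => ⟨_, h1.add h3, h2.add h4⟩
  mul_mem' := fun ⟨_, h1, h2⟩ ⟨_, h3, h4⟩ => ⟨_, h1.mul h3, h2.mul h4⟩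
  algebraMap_mem' := fun c => ⟨c, .const _ _ _, .const _ _ _⟩

theorem isValue_kappa_one {ι : Type*} {Z : ι → JetField n} {z : ι → ℝ}
    {x : JetCoord n → ℝ} {k : ℕ} (hk : 1 ≤ k)
    (h : ∀ a : JetCoord n, a.order ≤ k → IsValue Z z (coord n a) (x a)) :
    IsValue Z z (kappa n 1) (MvPolynomial.eval x (lamPoly n)) := by
  have h1 : ∀ a : JetCoord n, a.order ≤ k → coord n a ∈ commonValues Z z x :=
    fun a ha => ⟨x a, .var _ _ _, h a ha⟩
  have h2 : kappa n 1 ∈ commonValues Z z x := by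
    rw [kappa_eq_omega]
    exact omega_mem (fun i => w_mem_of_coord_mem (fun a ha => h1 a (ha.trans k.zero_le)) i)
      fun i => w_mem_of_coord_mem (fun a ha => h1 a (ha.trans hk)) i
  obtain ⟨r, h3, h4⟩ := h2
  have h5 : r = MvPolynomial.eval x (lamPoly n) :=
    h3.unique (algebraicIndependent_coord n) (algebraMap_lamPoly n ▸ isValue_algebraMap x _)
  exact h5 ▸ h4

/-- Elements of `T n k` have no poles off `κ₁ = 0`. So if the point `z` gives the jet coordinates of
order at most `k` the values they have at `x`, it also gives every element of `T n k` its value at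
`x`. -/
theorem T_le_commonValues {ι : Type*} {Z : ι → JetField n} (hZ : AlgebraicIndependent ℝ Z)
    {z : ι → ℝ} {x : JetCoord n → ℝ} {k : ℕ} (hk : 1 ≤ k)
    (h : ∀ a : JetCoord n, a.order ≤ k → IsValue Z z (coord n a) (x a))
    (hx : MvPolynomial.eval x (lamPoly n) ≠ 0) : T n k ≤ commonValues Z z x :=
  T_le_of_coord_mem
    ⟨_, (algebraMap_lamPoly n ▸ isValue_algebraMap x _ : IsValue _ _ (kappa n 1) _).inv
      (algebraicIndependent_coord n) hx, (isValue_kappa_one hk h).inv hZ hx⟩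
    fun a ha => ⟨x a, .var _ _ _, h a ha⟩

end SymplecticCurves

theorem ContDiffAt.iteratedDeriv_top {f : ℝ → ℝ} {t : ℝ} (hf : ContDiffAt ℝ ∞ f t) (k : ℕ) :
    ContDiffAt ℝ ∞ (iteratedDeriv k f) t := by
  induction k with
  | zero => simpa using hf
  | succ k ih =>
    rw [iteratedDeriv_succ]
    exact ih.derivWithin (by simp)

namespace SymplecticCurves

/-! ### The symplectic form over a commutative ring -/

section Pairing

variable {n : ℕ} {A : Type*} [CommRing A]

/-- The symplectic form on `A²ⁿ`. -/
def pairing (a b : Ix n → A) : A :=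
  ∑ i : Fin n, (a (Sum.inl i) * b (Sum.inr i) - a (Sum.inr i) * b (Sum.inl i))

theorem pairing_eq_dotProduct (a b : Ix n → A) :
    pairing a b = -(a ⬝ᵥ Matrix.J (Fin n) A *ᵥ b) := by
  simp only [pairing, Matrix.J, dotProduct, Fintype.sum_sum_type, Matrix.fromBlocks_mulVec,
    Sum.elim_inl, Sum.elim_inr, ← Finset.sum_add_distrib, ← Finset.sum_neg_distrib]
  refine Finset.sum_congr rfl fun i _ => ?_
  simp [Matrix.neg_mulVec]
  ring

theorem pairing_mulVec {g : Matrix (Ix n) (Ix n) A} (hg : g ∈ Matrix.symplecticGroup (Fin n) A)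
    (a b : Ix n → A) : pairing (g *ᵥ a) (g *ᵥ b) = pairing a b := by
  rw [pairing_eq_dotProduct, pairing_eq_dotProduct, Matrix.mulVec_mulVec,
    ← Matrix.vecMul_transpose, ← Matrix.dotProduct_mulVec, Matrix.mulVec_mulVec,
    ← Matrix.mul_assoc, SymplecticGroup.mem_iff'.1 hg]

theorem pairing_smul_right (a b : Ix n → A) (r : A) : pairing a (r • b) = r * pairing a b := by
  simp only [pairing, Finset.mul_sum, Pi.smul_apply, smul_eq_mul]
  exact Finset.sum_congr rfl fun _ _ => by ring

end Pairing

theorem mulVec_contDiffAt {n : ℕ} (g : Matrix (Ix n) (Ix n) ℝ) {c : ℝ → Ix n → ℝ} {t : ℝ}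
    (h : ContDiffAt ℝ ∞ c t) (i : Ix n) : ContDiffAt ℝ ∞ (fun s => (g *ᵥ c s) i) t := by
  simp only [Matrix.mulVec, dotProduct]
  exact ContDiffAt.sum fun j _ => contDiffAt_const.mul (contDiffAt_pi.1 h j)

variable {n : ℕ} [NeZero n]

/-! ### Jets of curves -/

theorem IsGraphAt.eventually {c : ℝ → Ix n → ℝ} {t : ℝ} (h : IsGraphAt n c t) :
    ∀ᶠ s in 𝓝 t, IsGraphAt n c s := h.eventually_nhds

theorem IsGraphAt.contDiffAt {c : ℝ → Ix n → ℝ} {t : ℝ} (h : IsGraphAt n c t) :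
    ContDiffAt ℝ ∞ c t := h.self_of_nhds.1

theorem IsGraphAt.contDiffAt_apply {c : ℝ → Ix n → ℝ} {t : ℝ} (h : IsGraphAt n c t) (i : Ix n) :
    ContDiffAt ℝ ∞ (fun s => c s i) t := contDiffAt_pi.1 h.contDiffAt i

theorem IsGraphAt.hasDerivAt_eval {c : ℝ → Ix n → ℝ} {t : ℝ} (h : IsGraphAt n c t)
    (p : JetPoly n) : HasDerivAt (fun s => MvPolynomial.eval (jet n c s) p)
      (MvPolynomial.eval (jet n c t) (totalDPoly n p)) t := by
  have hX : ∀ a, HasDerivAt (fun s => jet n c s a)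
      (MvPolynomial.eval (jet n c t) (totalDPoly n (MvPolynomial.X a))) t := by
    intro a
    rw [totalDPoly, MvPolynomial.mkDerivation_X]
    cases a with
    | t => simpa [jet] using hasDerivAt_id' t
    | u i k =>
      have h1 := (((h.contDiffAt_apply i).iteratedDeriv_top k).differentiableAt
        (by simp)).hasDerivAt
      rw [← iteratedDeriv_succ] at h1
      simpa [jet] using h1
  induction p using MvPolynomial.induction_on with
  | C a => simpa using hasDerivAt_const t a
  | add p q hp hq => simpa using hp.fun_add hq
  | mul_X p a hp =>
    have := hp.fun_mul (hX a)
    simp only [Derivation.leibniz, smul_eq_mul, map_add, map_mul, MvPolynomial.eval_X] at this ⊢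
    exact this.congr_deriv (by ring)

theorem IsGraphAt.eventually_eval_ne_zero {c : ℝ → Ix n → ℝ} {t : ℝ} (h : IsGraphAt n c t)
    {p : JetPoly n} (hp : MvPolynomial.eval (jet n c t) p ≠ 0) :
    ∀ᶠ s in 𝓝 t, MvPolynomial.eval (jet n c s) p ≠ 0 :=
  (h.hasDerivAt_eval p).continuousAt.eventually_ne hp

theorem IsGraphAt.eval_wPoly {c : ℝ → Ix n → ℝ} {t : ℝ} (h : IsGraphAt n c t) (k : ℕ) (i : Ix n) :
    MvPolynomial.eval (jet n c t) (wPoly n k i) = iteratedDeriv k (fun s => c s i) t := by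
  by_cases hi : i = Sum.inl 0
  · have h1 : (fun s => c s i) =ᶠ[𝓝 t] id := h.mono fun s hs => hi ▸ hs.2
    rw [h1.iteratedDeriv_eq, iteratedDeriv_id]
    rcases k with _ | _ | k <;> simp [wPoly, hi, jet]
  · simp [wPoly, hi, jet]

theorem IsGraphAt.eval_lamPoly {c : ℝ → Ix n → ℝ} {t : ℝ} (h : IsGraphAt n c t) :
    MvPolynomial.eval (jet n c t) (lamPoly n) =
      pairing (c t) (fun i => deriv (fun s => c s i) t) := by
  simp only [lamPoly, map_sum, map_sub, map_mul, h.eval_wPoly, pairing, iteratedDeriv_zero,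
    iteratedDeriv_one]

theorem IsGraphAt.isValue_v_zero {c : ℝ → Ix n → ℝ} {t : ℝ} (h : IsGraphAt n c t) (i : Ix n) :
    IsValue (coord n) (jet n c t) (v n 0 i) (c t i) := by
  have := isValue_algebraMap (jet n c t) (wPoly n 0 i)
  rwa [algebraMap_wPoly, h.eval_wPoly, iteratedDeriv_zero, ← v_zero] at this

section Germ

variable {g : Matrix (Ix n) (Ix n) ℝ} {c c' : ℝ → Ix n → ℝ} {t t' : ℝ}

theorem MapsGerm.tendsto (h : MapsGerm n g c t c' t') :
    Tendsto (fun s => (g *ᵥ c s) (Sum.inl 0)) (𝓝 t) (𝓝 t') := by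
  have := (mulVec_contDiffAt g h.graph.contDiffAt (Sum.inl 0)).continuousAt.tendsto
  rwa [h.base] at this

theorem MapsGerm.hasDerivAt (h : MapsGerm n g c t c' t') :
    HasDerivAt (fun s => (g *ᵥ c s) (Sum.inl 0))
      (deriv (fun s => (g *ᵥ c s) (Sum.inl 0)) t) t :=
  ((mulVec_contDiffAt g h.graph.contDiffAt (Sum.inl 0)).differentiableAt (by simp)).hasDerivAt

/-- An identity valid for all mapped jets thus holds along the curve near `t` and may be
differentiated. -/
theorem MapsGerm.eventually (h : MapsGerm n g c t c' t') :
    ∀ᶠ s in 𝓝 t, MapsGerm n g c s c' ((g *ᵥ c s) (Sum.inl 0)) := by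
  have h1 : ContinuousAt (deriv fun s => (g *ᵥ c s) (Sum.inl 0)) t :=
    ((mulVec_contDiffAt g h.graph.contDiffAt (Sum.inl 0)).derivWithin (m := ∞)
      (by simp)).continuousAt
  filter_upwards [h.graph.eventually, h.tendsto.eventually h.graph'.eventually,
    h1.eventually_ne h.immersed, h.maps.eventually_nhds] with s h2 h3 h4 h5
  exact ⟨h2, h3, rfl, h4, h5⟩

theorem MapsGerm.apply_eq (h : MapsGerm n g c t c' t') : g *ᵥ c t = c' t' := by
  have := h.maps.self_of_nhds
  rwa [h.base] at this

/-- `lamPoly` is `ω(c, dc/dt)`. The matrix preserves `ω`, and the chain rule for `g c = c' ∘ f`,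
with `f` the new first coordinate, contributes the factor `f'`. The derivative `D_t` acquires the
same factor, so it cancels in `∇`. -/
theorem MapsGerm.eval_lamPoly (h : MapsGerm n g c t c' t')
    (hg : g ∈ Matrix.symplecticGroup (Fin n) ℝ) :
    MvPolynomial.eval (jet n c t) (lamPoly n) =
      deriv (fun s => (g *ᵥ c s) (Sum.inl 0)) t *
        MvPolynomial.eval (jet n c' t') (lamPoly n) := by
  rw [h.graph.eval_lamPoly, h.graph'.eval_lamPoly, ← pairing_smul_right, ← pairing_mulVec hg,
    h.apply_eq]
  congr 1
  funext i
  have hc : ∀ j, HasDerivAt (fun s => c s j) (deriv (fun s => c s j) t) t := fun j =>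
    ((h.graph.contDiffAt_apply j).differentiableAt (by simp)).hasDerivAt
  have h1 : HasDerivAt (fun s => (g *ᵥ c s) i)
      ((g *ᵥ fun j => deriv (fun s => c s j) t) i) t := by
    simp only [Matrix.mulVec, dotProduct]
    exact HasDerivAt.fun_sum fun j _ => (hc j).const_mul _
  have h2 : HasDerivAt (fun s => c' s i) (deriv (fun s => c' s i) t')
      ((g *ᵥ c t) (Sum.inl 0)) := by
    rw [h.base]
    exact ((h.graph'.contDiffAt_apply i).differentiableAt (by simp)).hasDerivAt
  have h3 := h2.comp t h.hasDerivAt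
  have h4 : (fun s => (g *ᵥ c s) i) =ᶠ[𝓝 t]
      (fun s => c' s i) ∘ fun s => (g *ᵥ c s) (Sum.inl 0) :=
    h.maps.mono fun s hs => congrFun hs i
  rw [(h3.congr_of_eventuallyEq h4).unique h1 |>.symm, Pi.smul_apply, smul_eq_mul, mul_comm]

/-- The invariance of the derivation `∇`, for functions represented by fractions. -/
theorem MapsGerm.eval_nabla (h : MapsGerm n g c t c' t')
    (hg : g ∈ Matrix.symplecticGroup (Fin n) ℝ) {p q r s : JetPoly n}
    (hq : MvPolynomial.eval (jet n c' t') q ≠ 0) (hs : MvPolynomial.eval (jet n c t) s ≠ 0)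
    (hl : MvPolynomial.eval (jet n c t) (lamPoly n) ≠ 0)
    (heq : ∀ᶠ y in 𝓝 t, MvPolynomial.eval (jet n c y) r / MvPolynomial.eval (jet n c y) s =
      MvPolynomial.eval (jet n c' ((g *ᵥ c y) (Sum.inl 0))) p /
        MvPolynomial.eval (jet n c' ((g *ᵥ c y) (Sum.inl 0))) q) :
    MvPolynomial.eval (jet n c t) (totalDPoly n r * s - r * totalDPoly n s) /
        MvPolynomial.eval (jet n c t) (lamPoly n * s ^ 2) =
      MvPolynomial.eval (jet n c' t') (totalDPoly n p * q - p * totalDPoly n q) /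
        MvPolynomial.eval (jet n c' t') (lamPoly n * q ^ 2) := by
  have h1 := (h.graph.hasDerivAt_eval r).div (h.graph.hasDerivAt_eval s) hs
  have h2 := (h.graph'.hasDerivAt_eval p).div (h.graph'.hasDerivAt_eval q) hq
  rw [← h.base] at h2
  have h3 := h2.comp t h.hasDerivAt
  have h4 := h1.unique (h3.congr_of_eventuallyEq heq)
  rw [h.base] at h4
  have hl' := h.eval_lamPoly hg
  simp only [map_sub, map_mul, map_pow]
  rw [hl'] at hl ⊢
  have h5 := left_ne_zero_of_mul hl
  have h6 := right_ne_zero_of_mul hl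
  rw [div_mul_eq_div_div_swap, h4]
  generalize MvPolynomial.eval (jet n c' t') q = a at *
  field_simp

end Germ

/-! ### Pullbacks of rational functions -/

theorem nabla_div {p q : JetPoly n} (hq : q ≠ 0) :
    nabla n (algebraMap _ _ p / algebraMap _ _ q) =
      algebraMap _ _ (totalDPoly n p * q - p * totalDPoly n q) /
        algebraMap _ _ (lamPoly n * q ^ 2) := by
  rw [nabla_apply]
  have h : totalD n (algebraMap _ _ p / algebraMap _ _ q) = _ := totalDFun_div n p q hq
  rw [h, map_mul, map_pow, algebraMap_lamPoly, inv_mul_eq_div, div_div, mul_comm (kappa n 1)]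
  simp only [map_sub, map_mul]

theorem lamPoly_mul_sq_ne_zero {q : JetPoly n} (hq : q ≠ 0) : lamPoly n * q ^ 2 ≠ 0 :=
  mul_ne_zero (lamPoly_ne_zero n) (pow_ne_zero 2 hq)

theorem IsPullback.nabla {g : Matrix (Ix n) (Ix n) ℝ}
    (hg : g ∈ Matrix.symplecticGroup (Fin n) ℝ) {F H : JetField n} (h : IsPullback n g F H) :
    IsPullback n g (SymplecticCurves.nabla n F) (SymplecticCurves.nabla n H) := by
  obtain ⟨p, q, r, s, hq, hs, rfl, rfl, heq⟩ := h
  refine ⟨_, _, _, _, lamPoly_mul_sq_ne_zero hq, lamPoly_mul_sq_ne_zero hs, nabla_div hq,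
    nabla_div hs, fun c t c' t' hM hq' hs' => ?_⟩
  rw [map_mul, map_pow] at hq' hs'
  have hq1 := pow_ne_zero_iff two_ne_zero |>.1 (right_ne_zero_of_mul hq')
  have hs1 := pow_ne_zero_iff two_ne_zero |>.1 (right_ne_zero_of_mul hs')
  refine hM.eval_nabla hg hq1 hs1 (left_ne_zero_of_mul hs') ?_
  filter_upwards [hM.eventually, hM.tendsto.eventually (hM.graph'.eventually_eval_ne_zero hq1),
    hM.graph.eventually_eval_ne_zero hs1] with y h1 h2 h3
  exact heq _ _ _ _ h1 h2 h3

theorem IsInvariant.nabla {F : JetField n} (h : IsInvariant n F) :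
    IsInvariant n (SymplecticCurves.nabla n F) := by
  obtain ⟨p, q, hq, rfl, heq⟩ := h
  refine ⟨_, _, lamPoly_mul_sq_ne_zero hq, nabla_div hq, fun g hg c t c' t' hM hs' hq' => ?_⟩
  rw [map_mul, map_pow] at hq' hs'
  have hq1 := pow_ne_zero_iff two_ne_zero |>.1 (right_ne_zero_of_mul hq')
  have hs1 := pow_ne_zero_iff two_ne_zero |>.1 (right_ne_zero_of_mul hs')
  refine hM.eval_nabla hg hq1 hs1 (left_ne_zero_of_mul hs') ?_
  filter_upwards [hM.eventually, hM.tendsto.eventually (hM.graph'.eventually_eval_ne_zero hq1),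
    hM.graph.eventually_eval_ne_zero hs1] with y h1 h2 h3
  exact heq g hg _ _ _ _ h1 h3 h2

variable (n) in
/-- The field of rational differential invariants. -/
def invariantField : IntermediateField ℝ (JetField n) where
  carrier := {F | IsInvariant n F}
  add_mem' := by
    rintro _ _ ⟨p, q, hq, rfl, h⟩ ⟨r, s, hs, rfl, h'⟩
    have hq' : algebraMap (JetPoly n) (JetField n) q ≠ 0 := by simpa using hq
    have hs' : algebraMap (JetPoly n) (JetField n) s ≠ 0 := by simpa using hs
    refine ⟨p * s + q * r, q * s, mul_ne_zero hq hs, ?_, ?_⟩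
    · rw [div_add_div _ _ hq' hs']; simp only [map_add, map_mul]
    · intro g hg c t c' t' hM h1 h2
      simp only [map_mul, map_add] at h1 h2 ⊢
      rw [← div_add_div _ _ (left_ne_zero_of_mul h1) (right_ne_zero_of_mul h1),
        ← div_add_div _ _ (left_ne_zero_of_mul h2) (right_ne_zero_of_mul h2),
        h g hg c t c' t' hM (left_ne_zero_of_mul h1) (left_ne_zero_of_mul h2),
        h' g hg c t c' t' hM (right_ne_zero_of_mul h1) (right_ne_zero_of_mul h2)]
  mul_mem' := by
    rintro _ _ ⟨p, q, hq, rfl, h⟩ ⟨r, s, hs, rfl, h'⟩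
    refine ⟨p * r, q * s, mul_ne_zero hq hs, ?_, ?_⟩
    · rw [div_mul_div_comm]; simp only [map_mul]
    · intro g hg c t c' t' hM h1 h2
      simp only [map_mul] at h1 h2 ⊢
      rw [← div_mul_div_comm, ← div_mul_div_comm,
        h g hg c t c' t' hM (left_ne_zero_of_mul h1) (left_ne_zero_of_mul h2),
        h' g hg c t c' t' hM (right_ne_zero_of_mul h1) (right_ne_zero_of_mul h2)]
  algebraMap_mem' := fun r => by
    refine ⟨MvPolynomial.C r, 1, one_ne_zero, ?_, by simp⟩
    rw [map_one, div_one, IsScalarTower.algebraMap_apply ℝ (JetPoly n) (JetField n)]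
    rfl
  inv_mem' := by
    rintro _ ⟨p, q, hq, rfl, h⟩
    by_cases hp : p = 0
    · exact ⟨0, 1, one_ne_zero, by simp [hp], by simp⟩
    have hp' : algebraMap (JetPoly n) (JetField n) p ≠ 0 := by simpa using hp
    have hq' : algebraMap (JetPoly n) (JetField n) q ≠ 0 := by simpa using hq
    -- The extra factor `q` in the denominator ensures that the invariance of `p / q` applies
    -- wherever the new denominator is nonzero.
    refine ⟨q * q, p * q, mul_ne_zero hp hq, ?_, ?_⟩
    · rw [map_mul, map_mul, mul_div_mul_right _ _ hq', inv_div]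
    · intro g hg c t c' t' hM h1 h2
      simp only [map_mul] at h1 h2 ⊢
      have h3 := right_ne_zero_of_mul h1
      have h4 := right_ne_zero_of_mul h2
      rw [mul_div_mul_right _ _ h3, mul_div_mul_right _ _ h4, ← inv_div, ← inv_div (MvPolynomial.eval _ p),
        h g hg c t c' t' hM h3 h4]

/-! ### Equivariance of the normalized frame -/

/-- The value of `H` at every jet is the value of `F` at the image of this jet. -/
def Corresponds (g : Matrix (Ix n) (Ix n) ℝ) (H F : JetField n) : Prop :=
  ∀ c t c' t', MapsGerm n g c t c' t' → MvPolynomial.eval (jet n c t) (lamPoly n) ≠ 0 →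
    ∃ r, IsValue (coord n) (jet n c t) H r ∧ IsValue (coord n) (jet n c' t') F r

namespace Corresponds

variable {g : Matrix (Ix n) (Ix n) ℝ} {F F' H H' : JetField n}

theorem const (r : ℝ) : Corresponds g (algebraMap ℝ (JetField n) r) (algebraMap ℝ _ r) :=
  fun _ _ _ _ _ _ => ⟨r, .const _ _ _, .const _ _ _⟩

theorem add (h : Corresponds g H F) (h' : Corresponds g H' F') :
    Corresponds g (H + H') (F + F') := fun c t c' t' hM hl => by
  obtain ⟨r, h1, h2⟩ := h c t c' t' hM hl
  obtain ⟨s, h3, h4⟩ := h' c t c' t' hM hl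
  exact ⟨r + s, h1.add h3, h2.add h4⟩

theorem mul (h : Corresponds g H F) (h' : Corresponds g H' F') :
    Corresponds g (H * H') (F * F') := fun c t c' t' hM hl => by
  obtain ⟨r, h1, h2⟩ := h c t c' t' hM hl
  obtain ⟨s, h3, h4⟩ := h' c t c' t' hM hl
  exact ⟨r * s, h1.mul h3, h2.mul h4⟩

theorem sub (h : Corresponds g H F) (h' : Corresponds g H' F') :
    Corresponds g (H - H') (F - F') := by
  simpa [sub_eq_add_neg] using h.add ((const (-1)).mul h')

theorem sum {ι : Type*} (s : Finset ι) {f f' : ι → JetField n}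
    (h : ∀ i ∈ s, Corresponds g (f i) (f' i)) :
    Corresponds g (∑ i ∈ s, f i) (∑ i ∈ s, f' i) := by
  classical
  induction s using Finset.induction_on with
  | empty => simpa using const (g := g) (n := n) 0
  | insert a s ha ih =>
    rw [Finset.sum_insert ha, Finset.sum_insert ha]
    exact (h a (by simp)).add (ih fun k hk => h k (by simp [hk]))

theorem omega {a a' b b' : Ix n → JetField n} (ha : ∀ i, Corresponds g (a i) (a' i))
    (hb : ∀ i, Corresponds g (b i) (b' i)) :
    Corresponds g (omega n a b) (SymplecticCurves.omega n a' b') :=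
  sum _ fun _ _ => ((ha _).mul (hb _)).sub ((ha _).mul (hb _))

theorem nabla (hg : g ∈ Matrix.symplecticGroup (Fin n) ℝ) (h : Corresponds g H F) :
    Corresponds g (nabla n H) (SymplecticCurves.nabla n F) := fun c t c' t' hM hl => by
  obtain ⟨r, h1, h2⟩ := h c t c' t' hM hl
  -- The fractions are chosen for the given pair of jets; their denominators stay nonzero at nearby
  -- points of the curves, which suffices for differentiation.
  have rep : ∀ {x : JetCoord n → ℝ} {F : JetField n}, IsValue (coord n) x F r →
      ∃ p q : JetPoly n, q ≠ 0 ∧ MvPolynomial.eval x q ≠ 0 ∧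
        F = algebraMap _ _ p / algebraMap _ _ q := by
    rintro x F ⟨P, Q, hQ, hPQ, -⟩
    have hQ0 : Q ≠ 0 := by rintro rfl; simp at hQ
    refine ⟨P, Q, hQ0, hQ, ?_⟩
    rw [aeval_coord, aeval_coord] at hPQ
    rw [← hPQ, mul_div_cancel_right₀ _ (by simpa using hQ0)]
  obtain ⟨R, S, hS0, hS, rfl⟩ := rep h1
  obtain ⟨P, Q, hQ0, hQ, rfl⟩ := rep h2
  have hl' : MvPolynomial.eval (jet n c' t') (lamPoly n) ≠ 0 :=
    right_ne_zero_of_mul (hM.eval_lamPoly hg ▸ hl)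
  have key := hM.eval_nabla hg (p := P) (r := R) hQ hS hl (by
    filter_upwards [hM.eventually, hM.tendsto.eventually (hM.graph'.eventually_eval_ne_zero hQ),
      hM.graph.eventually_eval_ne_zero hS, hM.graph.eventually_eval_ne_zero hl] with y e1 e2 e3 e4
    obtain ⟨u, h3, h4⟩ := h _ _ _ _ e1 e4
    rw [(isValue_div e3).unique (algebraicIndependent_coord n) h3,
      (isValue_div e2).unique (algebraicIndependent_coord n) h4])
  rw [nabla_div hS0, nabla_div hQ0]
  refine ⟨_, isValue_div (by simpa using ⟨hl, hS⟩), ?_⟩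
  rw [key]
  exact isValue_div (by simpa using ⟨hl', hQ⟩)

end Corresponds

/-- The action of a real matrix on vectors of rational functions. -/
noncomputable def act (g : Matrix (Ix n) (Ix n) ℝ) (a : Ix n → JetField n) : Ix n → JetField n :=
  g.map (algebraMap ℝ (JetField n)) *ᵥ a

theorem act_apply (g : Matrix (Ix n) (Ix n) ℝ) (a : Ix n → JetField n) (i : Ix n) :
    act g a i = ∑ j, algebraMap ℝ (JetField n) (g i j) * a j := rfl

theorem omega_act {g : Matrix (Ix n) (Ix n) ℝ} (hg : g ∈ Matrix.symplecticGroup (Fin n) ℝ)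
    (a b : Ix n → JetField n) : omega n (act g a) (act g b) = omega n a b :=
  pairing_mulVec (SymplecticGroup.map_mem hg (algebraMap ℝ (JetField n))) a b

theorem act_v_succ (g : Matrix (Ix n) (Ix n) ℝ) (k : ℕ) (i : Ix n) :
    act g (v n (k + 1)) i = nabla n (act g (v n k) i) + ∑ l ∈ Finset.range k,
      (k.choose (l + 1) : JetField n) * omega n (v n 1) (v n (l + 1)) * act g (v n (k - l)) i := by
  simp only [act_apply, v_succ n k, map_sum, Derivation.leibniz, Derivation.map_algebraMap,
    smul_eq_mul, mul_zero, add_zero, mul_add, Finset.sum_add_distrib, Finset.mul_sum]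
  congr 1
  rw [Finset.sum_comm]
  exact Finset.sum_congr rfl fun _ _ => Finset.sum_congr rfl fun _ _ => by ring

/-- For `k = 0` this is `g c(t) = c'(t')`. The recursion `v_succ` involves only `∇`, natural numbers
and `ω`: the first is compatible with `g`, and `ω` is preserved by it. -/
theorem corresponds_v {g : Matrix (Ix n) (Ix n) ℝ} (hg : g ∈ Matrix.symplecticGroup (Fin n) ℝ)
    (k : ℕ) (i : Ix n) : Corresponds g (act g (v n k) i) (v n k i) := by
  induction k using Nat.strong_induction_on generalizing i with
  | _ k ih =>
    rcases k with _ | k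
    · intro c t c' t' hM _
      refine ⟨(g *ᵥ c t) i, ?_, ?_⟩
      · rw [act_apply]
        exact IsValue.sum _ fun j _ => (IsValue.const _ _ _).mul (hM.graph.isValue_v_zero j)
      · rw [hM.apply_eq]
        exact hM.graph'.isValue_v_zero i
    · rw [act_v_succ, v_succ]
      refine ((ih k k.lt_succ_self i).nabla hg).add (Corresponds.sum _ fun l hl => ?_)
      have := Finset.mem_range.1 hl
      refine Corresponds.mul (Corresponds.mul ?_ ?_) (ih _ (by omega) i)
      · rw [← map_natCast (algebraMap ℝ (JetField n))]
        exact Corresponds.const _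
      · nth_rewrite 1 [← omega_act hg]
        exact Corresponds.omega (ih 1 (by omega)) (ih _ (by omega))

theorem corresponds_omega_v {g : Matrix (Ix n) (Ix n) ℝ}
    (hg : g ∈ Matrix.symplecticGroup (Fin n) ℝ) (k l : ℕ) :
    Corresponds g (omega n (v n k) (v n l)) (omega n (v n k) (v n l)) := by
  nth_rewrite 1 [← omega_act hg]
  exact Corresponds.omega (corresponds_v hg k) (corresponds_v hg l)

/-! ### Invariance of the generators. -/

theorem exists_pow_mul_eq_of_mem_T {k : ℕ} {F : JetField n} (hF : F ∈ T n k) :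
    ∃ (p : JetPoly n) (N : ℕ), F * algebraMap _ _ (lamPoly n ^ N) = algebraMap _ _ p := by
  induction hF using Algebra.adjoin_induction with
  | mem x hx =>
    rcases hx with ⟨a, ha, rfl⟩ | rfl
    · exact ⟨MvPolynomial.X a, 0, by simp [coord]⟩
    · exact ⟨1, 1, by
        rw [pow_one, algebraMap_lamPoly, inv_mul_cancel₀ (kappa_one_ne_zero n), map_one]⟩
  | algebraMap r =>
    refine ⟨MvPolynomial.C r, 0, ?_⟩
    rw [pow_zero, map_one, mul_one, IsScalarTower.algebraMap_apply ℝ (JetPoly n) (JetField n)]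
    rfl
  | add x y _ _ hx hy =>
    obtain ⟨p, N, hp⟩ := hx
    obtain ⟨q, M, hq⟩ := hy
    refine ⟨p * lamPoly n ^ M + q * lamPoly n ^ N, N + M, ?_⟩
    simp only [map_add, map_mul, ← hp, ← hq, pow_add]
    ring
  | mul x y _ _ hx hy =>
    obtain ⟨p, N, hp⟩ := hx
    obtain ⟨q, M, hq⟩ := hy
    refine ⟨p * q, N + M, ?_⟩
    simp only [map_mul, ← hp, ← hq, pow_add]
    ring

theorem isInvariant_of_corresponds {k : ℕ} {F : JetField n} (hF : F ∈ T n k)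
    (h : ∀ g ∈ Matrix.symplecticGroup (Fin n) ℝ, Corresponds g F F) : IsInvariant n F := by
  obtain ⟨p, N, hp⟩ := exists_pow_mul_eq_of_mem_T hF
  have hl := lamPoly_ne_zero n
  have hl' : algebraMap (JetPoly n) (JetField n) (lamPoly n ^ (N + 1)) ≠ 0 := by simpa using hl
  -- With exponent `N + 1` rather than `N`, a nonzero denominator forces `lamPoly ≠ 0` even for `N =
  -- 0`, as `Corresponds` requires.
  have hF' : F = algebraMap _ _ (p * lamPoly n) / algebraMap _ _ (lamPoly n ^ (N + 1)) := by
    rw [eq_div_iff hl', pow_succ, map_mul, map_mul, ← mul_assoc, hp]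
  refine ⟨p * lamPoly n, lamPoly n ^ (N + 1), pow_ne_zero _ hl, hF', ?_⟩
  intro g hg c t c' t' hM h1 h2
  have h3 : MvPolynomial.eval (jet n c t) (lamPoly n) ≠ 0 := fun h => h1 (by simp [h])
  obtain ⟨r, h4, h5⟩ := h g hg c t c' t' hM h3
  rw [hF'] at h4 h5
  rw [(isValue_div h1).unique (algebraicIndependent_coord n) h4,
    (isValue_div h2).unique (algebraicIndependent_coord n) h5]

theorem isInvariant_I {k : ℕ} : IsInvariant n (I n k) :=
  isInvariant_of_corresponds (omega_v_mem_T (Nat.sub_le k 1) le_rfl)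
    fun _ hg => corresponds_omega_v hg _ _

theorem isInvariant_gen (j k : ℕ) : IsInvariant n (gen n j k) := by
  induction j with
  | zero => exact isInvariant_I
  | succ j ih =>
    rw [gen, Function.iterate_succ_apply']
    exact ih.nabla

end SymplecticCurves

theorem IsValue.det {L : Type*} [Field L] [Algebra ℝ L] {ι κ : Type*} [Fintype κ] [DecidableEq κ]
    {Z : ι → L} {z : ι → ℝ} {A : Matrix κ κ L} {B : Matrix κ κ ℝ}
    (h : ∀ i j, IsValue Z z (A i j) (B i j)) : IsValue Z z A.det B.det := by
  have h1 : MvPolynomial.aeval (fun p : κ × κ => A p.1 p.2)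
      (Matrix.mvPolynomialX κ κ ℝ).det = A.det := by
    rw [AlgHom.map_det, Matrix.mvPolynomialX_mapMatrix_aeval]
  have h2 : MvPolynomial.eval (fun p : κ × κ => B p.1 p.2)
      (Matrix.mvPolynomialX κ κ ℝ).det = B.det := by
    rw [RingHom.map_det, Matrix.mvPolynomialX_mapMatrix_eval]
  have h3 := IsValue.aeval_of_forall (f := fun p : κ × κ => A p.1 p.2)
    (x := fun p : κ × κ => B p.1 p.2) (fun p => h p.1 p.2) (Matrix.mvPolynomialX κ κ ℝ).det
  rwa [h1, h2] at h3

theorem aeval_mem_of_forall {R A σ : Type*} [CommSemiring R] [CommSemiring A] [Algebra R A]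
    (S : Subalgebra R A) {f : σ → A} (hf : ∀ i, f i ∈ S) (p : MvPolynomial σ R) :
    MvPolynomial.aeval f p ∈ S := by
  have h : MvPolynomial.aeval f p ∈ (MvPolynomial.aeval (R := R) f).range := ⟨p, rfl⟩
  rw [← Algebra.adjoin_range_eq_range_aeval] at h
  exact Algebra.adjoin_le (Set.range_subset_iff.2 hf) h

namespace SymplecticCurves

/-! ### Orbits of jets -/

/-- Two systems of vectors with the same pairings, the first `2n` of which are bases, are related
by a symplectic matrix. -/
theorem exists_symplectic_of_pairing_eq {n M : ℕ} (hM : 2 * n ≤ M) (e : Fin (2 * n) ≃ Ix n)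
    {a b : ℕ → Ix n → ℝ}
    (h : ∀ i ≤ M, ∀ j ≤ M, pairing (a i) (a j) = pairing (b i) (b j))
    (ha : (Matrix.of fun p i => a (e.symm p) i).det ≠ 0) :
    ∃ g ∈ Matrix.symplecticGroup (Fin n) ℝ, ∀ k ≤ M, g *ᵥ a k = b k := by
  set R : Matrix (Ix n) (Ix n) ℝ := Matrix.of fun p i => a (e.symm p) i with hR
  set S : Matrix (Ix n) (Ix n) ℝ := Matrix.of fun p i => b (e.symm p) i with hS
  -- Equality of the Gram matrices of the two systems; it also forces the second to be a basis.
  have hRS : R * Matrix.J (Fin n) ℝ * Rᵀ = S * Matrix.J (Fin n) ℝ * Sᵀ := by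
    have key : ∀ (A : Matrix (Ix n) (Ix n) ℝ) p q,
        (A * Matrix.J (Fin n) ℝ * Aᵀ) p q = -pairing (A p) (A q) := by
      intro A p q
      rw [pairing_eq_dotProduct, neg_neg, Matrix.mul_assoc, Matrix.mul_apply']
      rfl
    ext p q
    rw [key, key]
    exact congrArg _ (h _ (by omega) _ (by omega))
  have hRu : IsUnit R.det := ha.isUnit
  have hJ : (Matrix.J (Fin n) ℝ).det ≠ 0 := (Matrix.isUnit_det_J (Fin n) ℝ).ne_zero
  have hSd : S.det ≠ 0 := by
    have h1 := congrArg Matrix.det hRS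
    simp only [Matrix.det_mul, Matrix.det_transpose] at h1
    intro h0
    rw [h0, mul_zero] at h1
    exact mul_ne_zero (mul_ne_zero ha hJ) ha h1
  have hRh : R * (R⁻¹ * S) = S := by rw [← Matrix.mul_assoc, Matrix.mul_nonsing_inv _ hRu, one_mul]
  set g := R⁻¹ * S with hg
  have hgm : g ∈ Matrix.symplecticGroup (Fin n) ℝ := by
    rw [SymplecticGroup.mem_iff]
    rw [← hRh, Matrix.transpose_mul] at hRS
    have hRt : IsUnit Rᵀ.det := by rwa [Matrix.det_transpose]
    have h1 : R * (Matrix.J (Fin n) ℝ * Rᵀ) = R * (g * Matrix.J (Fin n) ℝ * gᵀ * Rᵀ) := by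
      simpa only [Matrix.mul_assoc] using hRS
    have h2 := congrArg (fun A => R⁻¹ * A * Rᵀ⁻¹) h1
    simp only [← Matrix.mul_assoc, Matrix.nonsing_inv_mul _ hRu, one_mul] at h2
    simp only [Matrix.mul_assoc, Matrix.mul_nonsing_inv _ hRt, mul_one] at h2
    simpa only [Matrix.mul_assoc] using h2.symm
  have hgt := SymplecticGroup.transpose_mem hgm
  -- `R * g = S` is an action on row vectors, so on column vectors the matrix is `gᵀ`.
  refine ⟨gᵀ, hgt, ?_⟩
  have hfr : ∀ p, gᵀ *ᵥ R p = S p := by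
    intro p
    rw [Matrix.mulVec_transpose]
    exact congrFun hRh p
  intro k hk
  -- The difference of `gᵀ *ᵥ a k` and `b k` pairs to zero with the basis formed by the rows of `S`.
  rw [← sub_eq_zero]
  refine Matrix.eq_zero_of_mulVec_eq_zero (M := S * Matrix.J (Fin n) ℝ)
    (by rw [Matrix.det_mul]; exact mul_ne_zero hSd hJ) ?_
  funext p
  have h1 : pairing (S p) (gᵀ *ᵥ a k) = pairing (S p) (b k) := by
    rw [← hfr p, pairing_mulVec hgt, hfr p]
    exact h _ (by omega) _ hk
  rw [pairing_eq_dotProduct, pairing_eq_dotProduct, neg_inj] at h1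
  rw [← Matrix.mulVec_mulVec, Matrix.mulVec_sub, Matrix.mulVec_sub, Pi.sub_apply, Pi.zero_apply,
    sub_eq_zero]
  exact h1

variable {n : ℕ} [NeZero n]

/-- A curve with a given jet. -/
theorem exists_curve (x : JetCoord n → ℝ) (M : ℕ) : ∃ c : ℝ → Ix n → ℝ,
    (∀ t, IsGraphAt n c t) ∧ ∀ a : JetCoord n, a.order ≤ M → jet n c (x .t) a = x a := by
  let c : ℝ → Ix n → ℝ := fun s i => if h : i = Sum.inl 0 then s else
    ∑ k ∈ Finset.range (M + 1), x (.u ⟨i, h⟩ k) / (k ! : ℝ) * (s - x .t) ^ k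
  have hc : ContDiff ℝ ∞ c := by
    refine contDiff_pi.2 fun i => ?_
    by_cases h : i = Sum.inl 0
    · simpa [c, h] using contDiff_fun_id
    · simp only [c, h, dite_false]
      fun_prop
  refine ⟨c, fun t => Eventually.of_forall fun s => ⟨hc.contDiffAt, by simp [c]⟩, ?_⟩
  rintro (_ | ⟨⟨i, hi⟩, k⟩) hk
  · rfl
  · have hk' : k < M + 1 := Nat.lt_succ_of_le hk
    simp only [jet, c, hi, dite_false]
    rw [iteratedDeriv_comp_sub_const k (fun s => ∑ k ∈ Finset.range (M + 1),
      x (.u ⟨i, hi⟩ k) / (k ! : ℝ) * s ^ k)]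
    beta_reduce
    rw [sub_self, iteratedDeriv_fun_sum (fun j _ => by fun_prop)]
    simp only [iteratedDeriv_const_mul_field, iteratedDeriv_fun_pow_zero]
    rw [Finset.sum_eq_single k]
    · have : (k ! : ℝ) ≠ 0 := by exact_mod_cast k.factorial_ne_zero
      simp [this]
    · intro j _ hj
      simp [hj.symm]
    · intro h
      exact absurd (Finset.mem_range.2 hk') h

/-- The new first coordinate is a local diffeomorphism at `t`; reparametrizing `g c` by its inverse
makes the image a graph again. -/
theorem exists_mapsGerm {c : ℝ → Ix n → ℝ} {t : ℝ} (hc : IsGraphAt n c t)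
    (g : Matrix (Ix n) (Ix n) ℝ) (hd : deriv (fun s => (g *ᵥ c s) (Sum.inl 0)) t ≠ 0) :
    ∃ c' t', MapsGerm n g c t c' t' := by
  set f : ℝ → ℝ := fun s => (g *ᵥ c s) (Sum.inl 0) with hf
  have hfc : ContDiffAt ℝ ∞ f t := mulVec_contDiffAt g hc.contDiffAt _
  have hfd : HasDerivAt f (deriv f t) t := (hfc.differentiableAt (by simp)).hasDerivAt
  have hn : (∞ : WithTop ℕ∞) ≠ 0 := by simp
  set H := hfc.toOpenPartialHomeomorph f (hfd.hasFDerivAt_equiv hd) hn with hH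
  have hHf : ∀ s, H s = f s := fun s => by
    rw [hH, ContDiffAt.toOpenPartialHomeomorph_coe]
  have hts : t ∈ H.source := hfc.mem_toOpenPartialHomeomorph_source _ hn
  have htt : f t ∈ H.target := hHf t ▸ H.map_source hts
  have hst : H.symm (f t) = t := by rw [← hHf, H.left_inv hts]
  have hcont : Tendsto H.symm (𝓝 (f t)) (𝓝 t) := by
    have := (H.continuousAt_symm htt).tendsto
    rwa [hst] at this
  have hd' : ∀ᶠ s in 𝓝 t, deriv f s ≠ 0 :=
    (hfc.derivWithin (m := ∞) (by simp)).continuousAt.eventually_ne hd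
  refine ⟨fun y => g *ᵥ c (H.symm y), f t, hc, ?_, rfl, hd, ?_⟩
  · filter_upwards [H.open_target.mem_nhds htt, hcont.eventually hd',
      hcont.eventually hc.eventually] with y h1 h2 h3
    have h4 : ContDiffAt ℝ ∞ f (H.symm y) := mulVec_contDiffAt g h3.contDiffAt _
    have h5 : ContDiffAt ℝ ∞ H.symm y := by
      have hfun : (H : ℝ → ℝ) = f := funext hHf
      refine H.contDiffAt_symm_deriv h2 h1 ?_ ?_
      · rw [hfun]; exact (h4.differentiableAt (by simp)).hasDerivAt
      · rw [hfun]; exact h4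
    refine ⟨contDiffAt_pi.2 fun i => ?_, ?_⟩
    · exact (mulVec_contDiffAt g h3.contDiffAt i).comp y h5
    · change f (H.symm y) = y
      rw [← hHf, H.right_inv h1]
  · filter_upwards [H.open_source.mem_nhds hts] with s hs
    change _ = g *ᵥ c (H.symm (f s))
    rw [← hHf, H.left_inv hs]

theorem finite_order_le (M : ℕ) : {a : JetCoord n | a.order ≤ M}.Finite := by
  let g : Option ({i : Ix n // i ≠ Sum.inl 0} × Fin (M + 1)) → JetCoord n := fun
    | none => .t
    | some (i, k) => .u i k
  refine (Set.finite_range g).subset ?_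
  rintro (_ | ⟨i, k⟩) hk
  · exact ⟨none, rfl⟩
  · exact ⟨some (i, ⟨k, Nat.lt_succ_of_le hk⟩), rfl⟩

/-- The components of the vectors `v 0, …, v M`. -/
noncomputable def vFun (M : ℕ) (a : Fin (M + 1) × Ix n) : JetField n := v n a.1 a.2

theorem coord_mem_adjoin_vFun {M : ℕ} {a : JetCoord n} (ha : a.order ≤ M) :
    coord n a ∈ IntermediateField.adjoin ℝ (Set.range (vFun (n := n) M)) :=
  ratJet_le_of_v_mem (fun k hk i => IntermediateField.subset_adjoin _ _
    (Set.mem_range.2 ⟨(⟨k, Nat.lt_succ_of_le hk⟩, i), rfl⟩)) (coord_mem_ratJet ha)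

theorem mem_adjoin_range_Z {F : JetField n} {m : ℕ} (hF : F ∈ ratJet n m) :
    F ∈ IntermediateField.adjoin ℝ (Set.range (Z n)) := by
  rw [ratJet_eq_adjoin_Z] at hF
  exact IntermediateField.adjoin.mono _ _ _ (Set.image_subset_range _ _) hF

theorem genField_le_adjoin_range (m : ℕ) :
    genField n m ≤ IntermediateField.adjoin ℝ (Set.range (genFun n)) := by
  refine IntermediateField.adjoin.mono _ _ _ ?_
  rintro _ ⟨j, k, h1, h2, _, rfl⟩
  exact ⟨(j, ⟨k, h1, h2⟩), rfl⟩

theorem algebraMap_mem_ratJet {p : JetPoly n} {m : ℕ} (hp : ∀ a ∈ p.vars, a.order ≤ m) :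
    algebraMap _ _ p ∈ ratJet n m := by
  have h : MvPolynomial.supported ℝ {a : JetCoord n | a.order ≤ m} ≤
      (ratJet n m).toSubalgebra.comap (MvPolynomial.aeval (coord n)) := by
    rw [MvPolynomial.supported_eq_adjoin_X]
    refine Algebra.adjoin_le ?_
    rintro _ ⟨a, ha, rfl⟩
    simpa using coord_mem_ratJet ha
  rw [← aeval_coord]
  exact h (MvPolynomial.mem_supported.2 hp)

/-- The matrix whose rows are the vectors of the frame. -/
noncomputable def frameMatrix (e : Fin (2 * n) ≃ Ix n) (a : ℕ → Ix n → JetField n) :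
    Matrix (Ix n) (Ix n) (JetField n) := Matrix.of fun p i => a (e.symm p) i

theorem det_frameMatrix_ne_zero (e : Fin (2 * n) ≃ Ix n) : (frameMatrix e (v n)).det ≠ 0 := by
  have h := (linearIndependent_v n).comp e.symm e.symm.injective
  exact ((Matrix.isUnit_iff_isUnit_det _).1
    (Matrix.linearIndependent_rows_iff_isUnit.1 h)).ne_zero

/-- If the rational functions `v k`, `k ≤ M`, have the same values at two points as at two jets of
curves, and the pairings of the frames are equal, then the jets are related by the group. -/
theorem exists_mapsGerm_of_pairing_eq {M : ℕ} (hM : 2 * n ≤ M) (e : Fin (2 * n) ≃ Ix n)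
    {c : ℝ → Ix n → ℝ} {t : ℝ} (hc : IsGraphAt n c t)
    (hl : MvPolynomial.eval (jet n c t) (lamPoly n) ≠ 0) {a b : ℕ → Ix n → ℝ}
    (ha : ∀ k ≤ M, ∀ i, IsValue (coord n) (jet n c t) (v n k i) (a k i))
    (h : ∀ i ≤ M, ∀ j ≤ M, pairing (a i) (a j) = pairing (b i) (b j))
    (hdet : (Matrix.of fun p i => a (e.symm p) i).det ≠ 0) (hb : b 1 (Sum.inl 0) ≠ 0) :
    ∃ g ∈ Matrix.symplecticGroup (Fin n) ℝ, ∃ c' t', MapsGerm n g c t c' t' ∧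
      ∀ k ≤ M, ∀ i, IsValue (coord n) (jet n c' t') (v n k i) (b k i) := by
  have hn := NeZero.pos n
  have hind := algebraicIndependent_coord n
  obtain ⟨g, hg, hgab⟩ := exists_symplectic_of_pairing_eq hM e h hdet
  have hcd : ∀ j, HasDerivAt (fun s => c s j)
      (MvPolynomial.eval (jet n c t) (lamPoly n) * a 1 j) t := by
    intro j
    have h1 := ((hc.contDiffAt_apply j).differentiableAt (by simp)).hasDerivAt
    have h2 := isValue_algebraMap (jet n c t) (wPoly n 1 j)
    rw [algebraMap_wPoly, hc.eval_wPoly, iteratedDeriv_one, w_one, ← algebraMap_lamPoly] at h2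
    rwa [h2.unique hind ((isValue_algebraMap _ _).mul (ha 1 (by omega) j))] at h1
  -- As `w 1 = κ₁ v 1`, the derivative of the new first coordinate is `κ₁` times the `t`-component
  -- of `b 1`; `hb` makes the image a graph.
  have hd : HasDerivAt (fun s => (g *ᵥ c s) (Sum.inl 0))
      (MvPolynomial.eval (jet n c t) (lamPoly n) * b 1 (Sum.inl 0)) t := by
    rw [← hgab 1 (by omega)]
    simp only [Matrix.mulVec, dotProduct, Finset.mul_sum]
    exact (HasDerivAt.fun_sum fun j _ => (hcd j).const_mul (g (Sum.inl 0) j)).congr_deriv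
      (Finset.sum_congr rfl fun j _ => by ring)
  obtain ⟨c', t', hmaps⟩ := exists_mapsGerm hc g (by rw [hd.deriv]; exact mul_ne_zero hl hb)
  refine ⟨g, hg, c', t', hmaps, fun k hk i => ?_⟩
  obtain ⟨r, h1, h2⟩ := corresponds_v hg k i c t c' t' hmaps hl
  have h3 : IsValue (coord n) (jet n c t) (act g (v n k) i) ((g *ᵥ a k) i) :=
    IsValue.sum Finset.univ fun j _ => (IsValue.const _ _ _).mul (ha k hk j)
  rw [hgab k hk] at h3
  rwa [h1.unique hind h3] at h2

/-- At generic points with the same values of the generators, an invariant has the same value. -/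
theorem exists_isValue_of_isInvariant {F : JetField n} (hF : IsInvariant n F) :
    ∃ h : MvPolynomial (GenIx n ⊕ FrameIx n) ℝ, h ≠ 0 ∧ ∀ z z', (∀ a, z (Sum.inl a) =
      z' (Sum.inl a)) → MvPolynomial.eval z h ≠ 0 → MvPolynomial.eval z' h ≠ 0 →
        ∃ r, IsValue (Z n) z F r ∧ IsValue (Z n) z' F r := by
  classical
  obtain ⟨p, q, hq, rfl, hinv⟩ := hF
  obtain ⟨e, -⟩ := exists_equiv_Ix n
  obtain ⟨M, hM, hp, hq'⟩ : ∃ M, 2 * n ≤ M ∧ (∀ a ∈ p.vars, a.order ≤ M) ∧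
      ∀ a ∈ q.vars, a.order ≤ M := by
    obtain ⟨M, hM⟩ := ((p.vars ∪ q.vars).finite_toSet.image JetCoord.order).bddAbove
    have : ∀ a ∈ p.vars ∪ q.vars, a.order ≤ max M (2 * n) := fun a ha =>
      (hM ⟨a, ha, rfl⟩).trans (le_max_left _ _)
    exact ⟨max M (2 * n), le_max_right _ _, fun a ha => this a (by simp [ha]),
      fun a ha => this a (by simp [ha])⟩
  have hn := NeZero.pos n
  have hM1 : 1 ≤ M := by omega
  have hZ := algebraicIndependent_Z n
  have hind := algebraicIndependent_coord n
  -- Jet coordinates as fractions in the components of the `v k`, used below to read a jet off the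
  -- values of these components; above order `M` the choice is arbitrary.
  have hA : ∀ a : JetCoord n, ∃ A B : MvPolynomial (Fin (M + 1) × Ix n) ℝ, a.order ≤ M →
      MvPolynomial.aeval (vFun M) B ≠ 0 ∧ coord n a =
        MvPolynomial.aeval (vFun M) A / MvPolynomial.aeval (vFun M) B := by
    intro a
    by_cases ha : a.order ≤ M
    · obtain ⟨A, B, hAB⟩ := (IntermediateField.mem_adjoin_range_iff ℝ _ _).1
        (coord_mem_adjoin_vFun ha)
      refine ⟨A, B, fun _ => ⟨fun hB => ?_, hAB⟩⟩
      rw [hB, div_zero] at hAB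
      exact hind.ne_zero a hAB
    · exact ⟨0, 0, fun h => absurd h ha⟩
  choose A B hAB using hA
  have hvM : ∀ a, vFun (n := n) M a ∈ ratJet n M := fun a =>
    v_mem_ratJet (Nat.lt_succ_iff.1 a.1.2) _
  -- the functions that have to be defined at generic points
  set s : Set (JetField n) := coord n '' {a | a.order ≤ M} ∪ Set.range (vFun M) ∪
    {kappa n 1, algebraMap _ _ q, (frameMatrix e (v n)).det} ∪
    (fun a => MvPolynomial.aeval (vFun M) (B a)) '' {a : JetCoord n | a.order ≤ M} with hs
  have hsf : s.Finite := (((finite_order_le M).image _).union (Set.finite_range _)).union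
    (Set.toFinite _) |>.union ((finite_order_le M).image _)
  have hsZ : ∀ F ∈ s, F ∈ IntermediateField.adjoin ℝ (Set.range (Z n)) := by
    have hle : ∀ F ∈ ratJet n M, F ∈ IntermediateField.adjoin ℝ (Set.range (Z n)) :=
      fun F => mem_adjoin_range_Z
    rintro F (((⟨a, ha, rfl⟩ | ⟨a, rfl⟩) | (rfl | rfl | rfl)) | ⟨a, ha, rfl⟩)
    · exact hle _ (coord_mem_ratJet ha)
    · exact hle _ (hvM a)
    · exact hle _ (ratJet_mono hM1 (kappa_mem_ratJet 1))
    · exact hle _ (algebraMap_mem_ratJet hq')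
    · refine hle _ ?_
      rw [Matrix.det_apply]
      exact sum_mem fun σ _ => (ratJet n M).toSubalgebra.zsmul_mem (prod_mem fun i _ =>
        v_mem_ratJet (by omega) _) _
    · exact hle _ (aeval_mem_of_forall (ratJet n M).toSubalgebra hvM _)
  obtain ⟨h₁, h₁0, h₁s⟩ := IsValue.exists_of_subset_adjoin hZ hsf hsZ
  have hG : AlgebraicIndependent ℝ (genFun n) := algebraicIndependent_gen
  obtain ⟨h₂, h₂0, h₂s⟩ := IsValue.exists_of_subset_adjoin hG
    (s := Set.range fun x : Fin (M + 1) × Fin (M + 1) => omega n (v n x.1) (v n x.2))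
    (Set.finite_range _) (by
      rintro _ ⟨x, rfl⟩
      exact genField_le_adjoin_range M (omega_v_mem_genField (Nat.lt_succ_iff.1 x.1.2)
        (Nat.lt_succ_iff.1 x.2.2)))
  refine ⟨h₁ * MvPolynomial.rename Sum.inl h₂, mul_ne_zero h₁0 ((map_ne_zero_iff _
    (MvPolynomial.rename_injective _ Sum.inl_injective)).2 h₂0), fun z z' hzz' hz hz' => ?_⟩
  rw [map_mul, MvPolynomial.eval_rename] at hz hz'
  have hz2 := right_ne_zero_of_mul hz
  replace hz := h₁s z (left_ne_zero_of_mul hz)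
  replace hz' := h₁s z' (left_ne_zero_of_mul hz')
  have hcoord : ∀ a : JetCoord n, a.order ≤ M → coord n a ∈ s := fun a ha =>
    Or.inl (Or.inl (Or.inl ⟨a, ha, rfl⟩))
  have hv : ∀ k ≤ M, ∀ i, v n k i ∈ s := fun k hk i =>
    Or.inl (Or.inl (Or.inr ⟨(⟨k, Nat.lt_succ_of_le hk⟩, i), rfl⟩))
  have hqs : algebraMap (JetPoly n) (JetField n) q ∈ s := Or.inl (Or.inr (Or.inr (Or.inl rfl)))
  have hpoly : ∀ {z : GenIx n ⊕ FrameIx n → ℝ} {x : JetCoord n → ℝ} {p : JetPoly n},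
      (∀ a ∈ p.vars, a.order ≤ M) →
      (∀ a : JetCoord n, a.order ≤ M → IsValue (Z n) z (coord n a) (x a)) →
      IsValue (Z n) z (algebraMap _ _ p) (MvPolynomial.eval x p) := by
    intro z x p hp hx
    rw [← aeval_coord]
    exact IsValue.aeval_of_vars p fun a ha => hx a (hp a ha)
  -- a curve whose jet has the coordinates determined by `z`
  choose! x hx using fun a (ha : a.order ≤ M) =>
    (hz _ (hcoord a ha)).imp fun _ h => h.1
  obtain ⟨c, hc, hcx⟩ := exists_curve x M
  set X := jet n c (x .t) with hX
  have hXz : ∀ a : JetCoord n, a.order ≤ M → IsValue (Z n) z (coord n a) (X a) :=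
    fun a ha => (hcx a ha).symm ▸ hx a ha
  have hl : MvPolynomial.eval X (lamPoly n) ≠ 0 := by
    obtain ⟨r, h1, h2⟩ := hz (kappa n 1) (Or.inl (Or.inr (Or.inl rfl)))
    rw [(isValue_kappa_one hM1 hXz).unique hZ h1]
    exact h2 (kappa_one_ne_zero n)
  -- `a` collects the values of the `v k` at the jet `X`, which are also their values at `z`. The
  -- values `b` at `z'` are not yet known to come from a jet.
  choose! a ha haz using fun k i (hk : k ≤ M) =>
    T_le_commonValues hZ hM1 hXz hl (v_mem_T_of_le (n := n) hk i)
  choose! b hb using fun k i (hk : k ≤ M) => (hz' _ (hv k hk i)).imp fun _ h => h.1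
  -- The pairings are functions of the generators alone, and `z`, `z'` agree on the generators.
  have hab : ∀ i ≤ M, ∀ j ≤ M, pairing (a i) (a j) = pairing (b i) (b j) := by
    intro i hi j hj
    obtain ⟨r, h1, -⟩ := h₂s _ hz2 _
      ⟨(⟨i, Nat.lt_succ_of_le hi⟩, ⟨j, Nat.lt_succ_of_le hj⟩), rfl⟩
    have h2 : IsValue (Z n) z (omega n (v n i) (v n j)) r := IsValue.of_comp (e := Sum.inl) h1
    have h3 : IsValue (Z n) z' (omega n (v n i) (v n j)) r := by
      refine IsValue.of_comp (e := Sum.inl) ?_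
      have : z' ∘ Sum.inl = z ∘ Sum.inl := funext fun a => (hzz' a).symm
      rw [this]
      exact h1
    exact ((isValue_omega (fun k => haz i k hi) fun k => haz j k hj).unique hZ h2).trans
      (h3.unique hZ (isValue_omega (fun k => hb i k hi) fun k => hb j k hj))
  have hdet : (Matrix.of fun p i => a (e.symm p) i).det ≠ 0 := by
    obtain ⟨r, h1, h2⟩ := hz (frameMatrix e (v n)).det (Or.inl (Or.inr (Or.inr (Or.inr rfl))))
    rw [(IsValue.det (B := Matrix.of fun p i => a (e.symm p) i)
      fun p i => haz _ i (by omega)).unique hZ h1]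
    exact h2 (det_frameMatrix_ne_zero e)
  have hb1 : b 1 (Sum.inl 0) ≠ 0 := by
    obtain ⟨r, h1, h2⟩ := hz' _ (hv 1 hM1 (Sum.inl 0))
    rw [(hb 1 _ hM1).unique hZ h1]
    refine h2 ?_
    rw [v_one]
    simpa [w] using kappa_one_ne_zero n
  obtain ⟨g, hg, c', t', hmaps, hbX⟩ := exists_mapsGerm_of_pairing_eq hM e (hc _) hl
    (fun k hk i => ha k i hk) hab hdet hb1
  set X' := jet n c' t' with hX'
  -- At the image jet `X'` the `v k` take the values `b`; through the fractions `A / B` its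
  -- coordinates are therefore those prescribed by `z'`.
  have hXz' : ∀ a : JetCoord n, a.order ≤ M → IsValue (Z n) z' (coord n a) (X' a) := by
    intro d hd
    obtain ⟨hB0, hd'⟩ := hAB d hd
    obtain ⟨r, h1, h2⟩ := hz' (MvPolynomial.aeval (vFun M) (B d)) (Or.inr ⟨d, hd, rfl⟩)
    let y : Fin (M + 1) × Ix n → ℝ := fun k => b k.1 k.2
    have hy : ∀ P, IsValue (Z n) z' (MvPolynomial.aeval (vFun M) P) (MvPolynomial.eval y P) :=
      IsValue.aeval_of_forall fun k => hb _ _ (Nat.lt_succ_iff.1 k.1.2)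
    have hyX : ∀ P, IsValue (coord n) X' (MvPolynomial.aeval (vFun M) P)
        (MvPolynomial.eval y P) :=
      IsValue.aeval_of_forall fun k => hbX _ (Nat.lt_succ_iff.1 k.1.2) _
    have hBy : MvPolynomial.eval y (B d) ≠ 0 := by
      rw [(hy _).unique hZ h1]
      exact h2 hB0
    have h3 := (hyX (A d)).div hind (hyX (B d)) hBy
    rw [← hd'] at h3
    rw [(IsValue.var (coord n) X' d).unique hind h3, hd']
    exact (hy (A d)).div hZ (hy (B d)) hBy
  have hq0 : algebraMap (JetPoly n) (JetField n) q ≠ 0 := by simpa using hq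
  have hqX : MvPolynomial.eval X q ≠ 0 := by
    obtain ⟨r, h1, h2⟩ := hz _ hqs
    rw [(hpoly hq' hXz).unique hZ h1]
    exact h2 hq0
  have hqX' : MvPolynomial.eval X' q ≠ 0 := by
    obtain ⟨r, h1, h2⟩ := hz' _ hqs
    rw [(hpoly hq' hXz').unique hZ h1]
    exact h2 hq0
  refine ⟨_, (hpoly hp hXz).div hZ (hpoly hq' hXz) hqX, ?_⟩
  rw [hinv g hg _ _ _ _ hmaps hqX hqX']
  exact (hpoly hp hXz').div hZ (hpoly hq' hXz') hqX'

end SymplecticCurves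

/-! ### Eliminating the frame functions. -/

theorem mem_adjoin_of_mem {K L : Type*} [Field K] [Field L] [Algebra K L]
    {E : IntermediateField K L} {s : Set L} {x : L} (hx : x ∈ E) : x ∈ Algebra.adjoin E s :=
  (Algebra.adjoin E s).algebraMap_mem (⟨x, hx⟩ : E)

namespace SymplecticCurves

variable {n : ℕ} [NeZero n]

/-- The generators, together with constant values of the frame functions. -/
noncomputable def specialization (y : FrameIx n → ℝ) : GenIx n ⊕ FrameIx n → JetField n :=
  Sum.elim (genFun n) fun b => algebraMap ℝ (JetField n) (y b)

/-- In an expression of an invariant by the generators and the frame functions, the latter may be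
replaced with suitable constants. -/
theorem exists_specialization {F : JetField n} (hF : IsInvariant n F)
    {P Q : MvPolynomial (GenIx n ⊕ FrameIx n) ℝ} (hQ : MvPolynomial.aeval (Z n) Q ≠ 0)
    (h : F * MvPolynomial.aeval (Z n) Q = MvPolynomial.aeval (Z n) P) :
    ∃ y : FrameIx n → ℝ, MvPolynomial.aeval (specialization y) Q ≠ 0 ∧
      F * MvPolynomial.aeval (specialization y) Q = MvPolynomial.aeval (specialization y) P := by
  obtain ⟨D₀, hD₀, hval⟩ := exists_isValue_of_isInvariant hF
  have hQ0 : Q ≠ 0 := by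
    rintro rfl
    simp at hQ
  set D := D₀ * Q with hD
  have hD0 : D ≠ 0 := mul_ne_zero hD₀ hQ0
  obtain ⟨z₁, hz₁⟩ : ∃ z, MvPolynomial.eval z D ≠ 0 := by
    by_contra! hall
    exact hD0 (MvPolynomial.funext fun z => by rw [hall, map_zero])
  -- Taken from a point where `D` is nonzero, so that `D` remains a nonzero polynomial after the
  -- substitution.
  let y : FrameIx n → ℝ := z₁ ∘ Sum.inr
  let σ : MvPolynomial (GenIx n ⊕ FrameIx n) ℝ →ₐ[ℝ] MvPolynomial (GenIx n) ℝ :=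
    MvPolynomial.aeval (Sum.elim MvPolynomial.X fun b => MvPolynomial.C (y b))
  have hσ : ∀ g R, MvPolynomial.eval g (σ R) = MvPolynomial.eval (Sum.elim g y) R := by
    intro g R
    induction R using MvPolynomial.induction_on with
    | C a => simp [σ]
    | add p q hp hq => simp only [map_add, hp, hq]
    | mul_X p i hp =>
      rw [map_mul, map_mul, map_mul, hp]
      rcases i with i | i <;> simp [σ]
  have hσZ : ∀ R, MvPolynomial.aeval (genFun n) (σ R) =
      MvPolynomial.aeval (specialization y) R := by
    intro R
    induction R using MvPolynomial.induction_on with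
    | C a => simp [σ]
    | add p q hp hq => simp only [map_add, hp, hq]
    | mul_X p i hp =>
      rw [map_mul, map_mul, map_mul, hp]
      rcases i with i | i <;> simp [σ, specialization]
  have hσD : σ D ≠ 0 := by
    intro h0
    have h1 := hσ (z₁ ∘ Sum.inl) D
    rw [h0, map_zero, show Sum.elim (z₁ ∘ Sum.inl) y = z₁ from Sum.elim_comp_inl_inr z₁] at h1
    exact hz₁ h1.symm
  have hinj := MvPolynomial.rename_injective (R := ℝ) (Sum.inl : GenIx n → GenIx n ⊕ FrameIx n)
    Sum.inl_injective
  have hZ := algebraicIndependent_Z n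
  have hG : AlgebraicIndependent ℝ (genFun n) := algebraicIndependent_gen
  -- Where `D` is nonzero at both `z` and its specialization, `F` has the same value at the two
  -- points, so `P / Q` does too; elsewhere the factors `D` and `σ D` make the product vanish.
  have key : D * MvPolynomial.rename Sum.inl (σ D) *
      (P * MvPolynomial.rename Sum.inl (σ Q) - MvPolynomial.rename Sum.inl (σ P) * Q) = 0 := by
    refine MvPolynomial.funext fun z => ?_
    simp only [map_mul, map_sub, map_zero, MvPolynomial.eval_rename, hσ]
    by_cases h1 : MvPolynomial.eval z D = 0
    · rw [h1, zero_mul, zero_mul]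
    by_cases h2 : MvPolynomial.eval (Sum.elim (z ∘ Sum.inl) y) D = 0
    · rw [h2, mul_zero, zero_mul]
    rw [hD, map_mul] at h1 h2
    obtain ⟨r, hr, hr'⟩ := hval z (Sum.elim (z ∘ Sum.inl) y) (fun _ => rfl)
      (left_ne_zero_of_mul h1) (left_ne_zero_of_mul h2)
    have h3 := hr.mul (IsValue.aeval_self (Z n) z Q)
    have h4 := hr'.mul (IsValue.aeval_self (Z n) _ Q)
    rw [h] at h3 h4
    rw [(IsValue.aeval_self (Z n) z P).unique hZ h3, (IsValue.aeval_self (Z n) _ P).unique hZ h4]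
    ring
  have key' := sub_eq_zero.1 ((mul_eq_zero.1 key).resolve_left
    (mul_ne_zero hD0 ((map_ne_zero_iff _ hinj).2 hσD)))
  have hren : ∀ R, MvPolynomial.aeval (Z n) (MvPolynomial.rename Sum.inl (σ R)) =
      MvPolynomial.aeval (specialization y) R := fun R => by
    rw [MvPolynomial.aeval_rename, ← hσZ]
    rfl
  refine ⟨y, fun h0 => ?_, ?_⟩
  · rw [← hσZ] at h0
    refine hσD ?_
    rw [hD, map_mul, hG.eq_zero_of_aeval_eq_zero _ h0, mul_zero]
  · have h5 := congrArg (MvPolynomial.aeval (Z n)) key'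
    rw [map_mul, map_mul, hren, hren, ← h] at h5
    exact mul_right_cancel₀ hQ (by linear_combination h5)

theorem specialization_mem_genField (y : FrameIx n → ℝ) {a : GenIx n ⊕ FrameIx n} {m : ℕ}
    (ha : zOrder n a ≤ m) : specialization y a ∈ genField n m := by
  rcases a with ⟨j, k, hk⟩ | b
  · exact gen_mem_genField hk.1 hk.2 ha
  · exact (genField n m).algebraMap_mem _

theorem aeval_mem_of_mem_supported {R A σ : Type*} [CommSemiring R] [CommSemiring A] [Algebra R A]
    (S : Subalgebra R A) {f : σ → A} {s : Set σ} (hf : ∀ i ∈ s, f i ∈ S) {p : MvPolynomial σ R}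
    (hp : p ∈ MvPolynomial.supported R s) : MvPolynomial.aeval f p ∈ S := by
  have h : MvPolynomial.supported R s ≤ S.comap (MvPolynomial.aeval f) := by
    rw [MvPolynomial.supported_eq_adjoin_X]
    refine Algebra.adjoin_le ?_
    rintro _ ⟨a, ha, rfl⟩
    simpa using hf a ha
  exact h hp

/-- Rational functions on jets of order at most `m` as quotients of polynomials in the generators
and the frame functions of order at most `m`. -/
theorem exists_supported_of_mem_ratJet {F : JetField n} {m : ℕ} (hF : F ∈ ratJet n m) :
    ∃ P ∈ MvPolynomial.supported ℝ {a : GenIx n ⊕ FrameIx n | zOrder n a ≤ m},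
      ∃ Q ∈ MvPolynomial.supported ℝ {a : GenIx n ⊕ FrameIx n | zOrder n a ≤ m},
        MvPolynomial.aeval (Z n) Q ≠ 0 ∧
          F * MvPolynomial.aeval (Z n) Q = MvPolynomial.aeval (Z n) P := by
  by_cases hF0 : F = 0
  · exact ⟨0, zero_mem _, 1, one_mem _, by simp, by simp [hF0]⟩
  rw [ratJet_eq_adjoin_Z, Set.image_eq_range, IntermediateField.mem_adjoin_range_iff] at hF
  obtain ⟨P, Q, h⟩ := hF
  have hQ : MvPolynomial.aeval (fun x : {a // zOrder n a ≤ m} => Z n x) Q ≠ 0 := by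
    intro h0
    apply hF0
    rw [h]
    exact (congrArg _ h0).trans (div_zero _)
  refine ⟨MvPolynomial.rename Subtype.val P, ?_, MvPolynomial.rename Subtype.val Q, ?_, ?_, ?_⟩
  · rw [MvPolynomial.supported_eq_range_rename]
    exact ⟨P, rfl⟩
  · rw [MvPolynomial.supported_eq_range_rename]
    exact ⟨Q, rfl⟩
  · rw [MvPolynomial.aeval_rename]
    exact hQ
  · rw [MvPolynomial.aeval_rename, MvPolynomial.aeval_rename, h]
    exact div_mul_cancel₀ _ hQ

/-! ### Generation of the invariants. -/

theorem genField_le_ratJet (m : ℕ) : genField n m ≤ ratJet n m := by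
  rw [IntermediateField.adjoin_le_iff]
  rintro _ ⟨j, k, h1, h2, h3, rfl⟩
  exact ratJet_mono h3 (T_le_ratJet (show 1 ≤ j + k by omega) (gen_mem_T (by omega) j))

theorem genField_le_invariantField (m : ℕ) : genField n m ≤ invariantField n := by
  rw [IntermediateField.adjoin_le_iff]
  rintro _ ⟨j, k, -, -, -, rfl⟩
  exact isInvariant_gen j k

/-- Constants have no order, so specialization turns a fraction in the functions `Z` of order at
most `m` into one in the generators of order at most `m`. -/
theorem setOf_mem_ratJet_and_isInvariant (m : ℕ) :
    {F | F ∈ ratJet n m ∧ IsInvariant n F} = (genField n m : Set (JetField n)) := by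
  refine Set.Subset.antisymm ?_ fun F hF =>
    ⟨genField_le_ratJet m hF, genField_le_invariantField m hF⟩
  rintro F ⟨hF, hinv⟩
  obtain ⟨P, hP, Q, hQ, hQ0, h⟩ := exists_supported_of_mem_ratJet hF
  obtain ⟨y, hy0, hy⟩ := exists_specialization hinv hQ0 h
  have hmem : ∀ R ∈ MvPolynomial.supported ℝ {a : GenIx n ⊕ FrameIx n | zOrder n a ≤ m},
      MvPolynomial.aeval (specialization y) R ∈ genField n m := fun R hR =>
    aeval_mem_of_mem_supported (genField n m).toSubalgebra
      (fun a ha => specialization_mem_genField y ha) hR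
  rw [eq_div_of_mul_eq hy0 hy]
  exact div_mem (hmem P hP) (hmem Q hQ)

theorem T_le_polyAbove {l : ℕ} (hl : 1 ≤ l) (k : ℕ) :
    T n k ≤ (polyAbove n l).restrictScalars ℝ := by
  refine Algebra.adjoin_le ?_
  rintro F hF
  rw [SetLike.mem_coe, Subalgebra.mem_restrictScalars]
  rcases hF with ⟨a, -, rfl⟩ | hF
  · exact Algebra.subset_adjoin ⟨a, rfl⟩
  · rw [Set.mem_singleton_iff.1 hF]
    exact mem_adjoin_of_mem
      ((ratJet n l).inv_mem (ratJet_mono hl (kappa_mem_ratJet 1)))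

/-- Denominators come only from the coefficients, which live on `l`-jets; the order of the numerator
is not bounded. -/
theorem exists_supported_of_mem_adjoin_gens {F : JetField n} {l : ℕ}
    (hF : F ∈ Algebra.adjoin (ratJet n l) (gens n)) :
    ∃ P : MvPolynomial (GenIx n ⊕ FrameIx n) ℝ,
      ∃ Q ∈ MvPolynomial.supported ℝ {a : GenIx n ⊕ FrameIx n | zOrder n a ≤ l},
        MvPolynomial.aeval (Z n) Q ≠ 0 ∧
          F * MvPolynomial.aeval (Z n) Q = MvPolynomial.aeval (Z n) P := by
  induction hF using Algebra.adjoin_induction with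
  | mem x hx =>
    obtain ⟨j, k, h1, h2, rfl⟩ := hx
    exact ⟨MvPolynomial.X (Sum.inl (j, ⟨k, h1, h2⟩)), 1, one_mem _, by simp,
      by simp [Z, genFun]⟩
  | algebraMap r =>
    obtain ⟨P, -, Q, hQ, hQ0, h⟩ := exists_supported_of_mem_ratJet (F := (r : JetField n)) r.2
    exact ⟨P, Q, hQ, hQ0, h⟩
  | add x y _ _ hx hy =>
    obtain ⟨P, Q, hQ, hQ0, h⟩ := hx
    obtain ⟨P', Q', hQ', hQ0', h'⟩ := hy
    refine ⟨P * Q' + P' * Q, Q * Q', mul_mem hQ hQ', ?_, ?_⟩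
    · rw [map_mul]
      exact mul_ne_zero hQ0 hQ0'
    · simp only [map_add, map_mul]
      rw [← h, ← h']
      ring
  | mul x y _ _ hx hy =>
    obtain ⟨P, Q, hQ, hQ0, h⟩ := hx
    obtain ⟨P', Q', hQ', hQ0', h'⟩ := hy
    refine ⟨P * P', Q * Q', mul_mem hQ hQ', ?_, ?_⟩
    · rw [map_mul]
      exact mul_ne_zero hQ0 hQ0'
    · simp only [map_mul]
      rw [← h, ← h']
      ring

theorem specialization_mem_adjoin_gens (l : ℕ) (y : FrameIx n → ℝ) (a : GenIx n ⊕ FrameIx n) :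
    specialization y a ∈ Algebra.adjoin (genField n l) (gens n) := by
  rcases a with ⟨j, k, hk⟩ | b
  · have h : gen n j k ∈ gens n := ⟨j, k, hk.1, hk.2, rfl⟩
    exact Algebra.subset_adjoin h
  · have h : algebraMap ℝ (JetField n) (y b) ∈ genField n l := (genField n l).algebraMap_mem _
    exact mem_adjoin_of_mem h

/-- After specialization the denominator lies in `genField n l` and can be inverted there, while the
numerator is a polynomial in the generators. -/
theorem setOf_mem_polyAbove_and_isInvariant {l : ℕ} (hl : 2 * n - 1 ≤ l) :
    {F | F ∈ polyAbove n l ∧ IsInvariant n F} =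
      (Algebra.adjoin (genField n l) (gens n) : Set (JetField n)) := by
  have hn := NeZero.pos n
  refine Set.Subset.antisymm ?_ fun F hF => ?_
  · rintro F ⟨hF, hinv⟩
    obtain ⟨P, Q, hQ, hQ0, h⟩ :=
      exists_supported_of_mem_adjoin_gens (polyAbove_le_adjoin_gens hl hF)
    obtain ⟨y, hy0, hy⟩ := exists_specialization hinv hQ0 h
    have hQy : MvPolynomial.aeval (specialization y) Q ∈ genField n l :=
      aeval_mem_of_mem_supported (genField n l).toSubalgebra
        (fun a ha => specialization_mem_genField y ha) hQ
    have hPy : MvPolynomial.aeval (specialization y) P ∈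
        Algebra.adjoin (genField n l) (gens n) :=
      aeval_mem_of_forall ((Algebra.adjoin (genField n l) (gens n)).restrictScalars ℝ)
        (specialization_mem_adjoin_gens l y) P
    have hQ' : (MvPolynomial.aeval (specialization y) Q)⁻¹ ∈
        Algebra.adjoin (genField n l) (gens n) :=
      mem_adjoin_of_mem ((genField n l).inv_mem hQy)
    rw [eq_div_of_mul_eq hy0 hy, div_eq_mul_inv]
    exact mul_mem hPy hQ'
  · rw [SetLike.mem_coe] at hF
    induction hF using Algebra.adjoin_induction with
    | mem x hx =>
      obtain ⟨j, k, h1, h2, rfl⟩ := hx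
      exact ⟨T_le_polyAbove (by omega) _ (gen_mem_T (by omega) j), isInvariant_gen j k⟩
    | algebraMap r =>
      exact ⟨mem_adjoin_of_mem (genField_le_ratJet l r.2),
        genField_le_invariantField l r.2⟩
    | add x y _ _ hx hy =>
      exact ⟨add_mem hx.1 hy.1, (invariantField n).add_mem hx.2 hy.2⟩
    | mul x y _ _ hx hy =>
      exact ⟨mul_mem hx.1 hy.1, (invariantField n).mul_mem hx.2 hy.2⟩

end SymplecticCurves

theorem mainTheorem2 (n : ℕ) [NeZero n] :
    -- the normalization of the parametrization is possible in exactly one way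
    (SymplecticCurves.IsNormalized n (SymplecticCurves.kappa n) (SymplecticCurves.v n) ∧
      ∀ κ v, SymplecticCurves.IsNormalized n κ v →
        κ = SymplecticCurves.kappa n ∧ v = SymplecticCurves.v n) ∧
    -- `I_k` is a differential invariant of order `k`
    (∀ k, 2 ≤ k → k ≤ 2 * n →
      SymplecticCurves.IsInvariant n (SymplecticCurves.I n k) ∧
        SymplecticCurves.HasOrder n (SymplecticCurves.I n k) k) ∧
    -- `∇` is an invariant derivation: it commutes with the group action
    (∀ g ∈ Matrix.symplecticGroup (Fin n) ℝ, ∀ F H,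
      SymplecticCurves.IsPullback n g F H →
        SymplecticCurves.IsPullback n g (SymplecticCurves.nabla n F)
          (SymplecticCurves.nabla n H)) ∧
    -- freeness: there are no relations among the `∇ʲ I_k`
    AlgebraicIndependent ℝ (fun a : ℕ × Set.Icc 2 (2 * n) =>
      SymplecticCurves.gen n a.1 (a.2 : ℕ)) ∧
    -- generation: the rational differential invariants of order `≤ m` are the rational functions
    -- of the `∇ʲ I_k` with `j + k ≤ m`
    (∀ m : ℕ, {F | F ∈ SymplecticCurves.ratJet n m ∧ SymplecticCurves.IsInvariant n F} =
      (IntermediateField.adjoin ℝ (SymplecticCurves.gensUpTo n m) :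
        Set (SymplecticCurves.JetField n))) ∧
    -- generation: the invariants that are rational in jets of order `≤ l` and polynomial in higher
    -- jets are the polynomials in the `∇ʲ I_k` whose coefficients are rational functions of those
    -- with `j + k ≤ l`
    (∀ l : ℕ, 2 * n - 1 ≤ l →
      {F | F ∈ SymplecticCurves.polyAbove n l ∧ SymplecticCurves.IsInvariant n F} =
        (Algebra.adjoin (IntermediateField.adjoin ℝ (SymplecticCurves.gensUpTo n l))
          (SymplecticCurves.gens n) : Set (SymplecticCurves.JetField n))) := by
  exact ⟨⟨SymplecticCurves.isNormalized n, fun _ _ h => h.eq⟩,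
    fun _ h1 h2 => ⟨SymplecticCurves.isInvariant_I, SymplecticCurves.hasOrder_I h1 h2⟩,
    fun _ hg _ _ h => h.nabla hg, SymplecticCurves.algebraicIndependent_gen,
    SymplecticCurves.setOf_mem_ratJet_and_isInvariant,
    fun _ => SymplecticCurves.setOf_mem_polyAbove_and_isInvariant⟩
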